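/- Write the nontrivial zeros of the Riemann zeta function, counted with multiplicity, as $\rho=\tfrac12\pm i\tau_k$, $k=1,2,\dots$, with $\operatorname{Re}\tau_k>0$ non-decreasing; the Riemann Hypothesis is not assumed. For real $v>-(\operatorname{Re}\tau_1)^2$ (as $\tau_1\approx 14.13$ is real, this is $v>-\tau_1^2$) let $\mathcal Z(\sigma,v)=\sum_{k\ge1}(\tau_k^2+v)^{-\sigma}$ for $\operatorname{Re}\sigma>\tfrac12$ (principal powers), and put $\mathcal Z(\sigma)=\mathcal Z(\sigma,0)$, $Z(\sigma)=\mathcal Z(\sigma,\tfrac14)$. Let $\Delta(z\mid\{\tau_k^2+v\})=\prod_{k\ge1}\bigl(1+z/(\tau_k^2+v)\bigr)$. Let $\Xi$ be the entire function $\Xi(s)=\pi^{-s/2}\,s(s-1)\,\Gamma(s/2)\,\zeta(s)$ (removable singularities removed; $\Xi(0)=\Xi(1)=1$). For every such $v$: the series converges absolutely for $\operatorname{Re}\sigma>\tfrac12$ and $\mathcal Z(\sigma,v)$ extends to a meromorphic function of $\sigma\in\mathbb C$; the product $\Delta$ converges for every $z\in\mathbb C$; $\log\Delta(z\mid\{\tau_k^2+v\})$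 has an asymptotic expansion $\sum_{n\ge0}(\tilde a_{\mu_n}\log z+a_{\mu_n})z^{\mu_n}$ as $z\to+\infty$, with real exponents $\mu_n$ strictly decreasing to $-\infty$, one of which is $0$; let $a_0(v)$ be the coefficient of $z^0$ in it. The continuation is holomorphic at $\sigma=0$, the number $\Xi(\tfrac12\pm v^{1/2})$ is real and positive, and $$\partial_\sigma\mathcal Z(\sigma,v)\big|_{\sigma=0}=a_0(v)=a_0(\tfrac14)-\log\Delta\bigl(v-\tfrac14\mid\{\tau_k^2+\tfrac14\}\bigr)=\tfrac14\log 8\pi-\log\Xi\bigl(\tfrac12\pm v^{1/2}\bigr),$$ for either choice of the square root of $v$ (equivalently, this is minus the logarithm of the zeta-regularized determinant of the sequence $\{\tau_k^2+v\}$). In particular (the values $v=0$ and $v=\tfrac14$ being allowed) $$\mathcal Z(0)=Z(0)=\tfrac78,\qquad \mathcal Z'(0)=Z'(0)-\log\Xi(\tfrac12)=\log\Bigl[2^{11/4}\,\pi^{1/2}\,\Gamma(\tfrac14)^{-1}\,|\zeta(\tfrac12)|^{-1}\Bigr].$$ -/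

import Mathlib

noncomputable section

namespace ZetaZeros

/-- The numbers `τ` with positive real part such that `1/2 + iτ` is a zero of the Riemann zeta
function. As `1/2 + iτ` then has positive imaginary part, it is a nontrivial zero; the nontrivial
zeros are the `1/2 ± iτ`. -/
def tauSet : Set ℂ :=
  {τ : ℂ | 0 < τ.re ∧ riemannZeta (1 / 2 + Complex.I * τ) = 0}

/-- The multiplicity of the zero `1/2 + iτ` of the Riemann zeta function. -/
def mult (τ : ℂ) : ℕ :=
  analyticOrderNatAt riemannZeta (1 / 2 + Complex.I * τ)

/-- `v > -τ₁²`, where `τ₁` is a `τ` of least real part (it is known to be real). -/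
def Admissible (v : ℝ) : Prop :=
  ∀ τ ∈ tauSet, -(τ.re ^ 2) < v

/-- The terms of `∑ₖ (τₖ² + v)^(-σ)`, equal terms being collected with their multiplicity. -/
def zetaTerm (v : ℝ) (σ : ℂ) (τ : tauSet) : ℂ :=
  (mult τ : ℂ) * ((τ : ℂ) ^ 2 + (v : ℂ)) ^ (-σ)

/-- `F` is the meromorphic continuation to the whole plane (with its removable singularities
removed, and with the value `0` at its poles) of the convergent series
`∑ₖ (τₖ² + v)^(-σ)`, `Re σ > 1/2`. -/
def IsContinuation (v : ℝ) (F : ℂ → ℂ) : Prop :=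
  MeromorphicNFOn F Set.univ ∧
    ∀ σ : ℂ, 1 / 2 < σ.re → HasSum (zetaTerm v σ) (F σ)

/-- There is at most one continuation. -/
theorem IsContinuation.unique {v : ℝ} {F G : ℂ → ℂ}
    (hF : IsContinuation v F) (hG : IsContinuation v G) : F = G := by
  have hm : MeromorphicOn (F - G) Set.univ := fun z hz =>
    (hF.1 hz).meromorphicAt.sub (hG.1 hz).meromorphicAt
  have h1 : meromorphicOrderAt (F - G) 1 = ⊤ := by
    rw [meromorphicOrderAt_eq_top_iff]
    have hopen : IsOpen {σ : ℂ | 1 / 2 < σ.re} :=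
      isOpen_lt continuous_const Complex.continuous_re
    have hmem : {σ : ℂ | 1 / 2 < σ.re} ∈ nhds (1 : ℂ) :=
      hopen.mem_nhds (show (1 / 2 : ℝ) < (1 : ℂ).re by norm_num)
    filter_upwards [nhdsWithin_le_nhds hmem] with σ hσ
    simpa [sub_eq_zero] using (hF.2 σ hσ).unique (hG.2 σ hσ)
  funext z
  have hz : meromorphicOrderAt (F - G) z = ⊤ := by
    by_contra hne
    exact hm.meromorphicOrderAt_ne_top_of_isPreconnected isPreconnected_univ
      (Set.mem_univ z) (Set.mem_univ 1) hne h1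
  rw [meromorphicOrderAt_eq_top_iff] at hz
  have he : F =ᶠ[nhdsWithin z {z}ᶜ] G := by
    filter_upwards [hz] with w hw
    simpa [sub_eq_zero] using hw
  exact ((MeromorphicNFAt.eventuallyEq_nhdsNE_iff_eventuallyEq_nhds
    (hF.1 (Set.mem_univ z)) (hG.1 (Set.mem_univ z))).1 he).eq_of_nhds

/-- The generalized zeta function `σ ↦ 𝒵(σ, v)` of the Riemann zeros, as a meromorphic function
on the whole plane. -/
def bigZ (v : ℝ) : ℂ → ℂ :=
  Classical.epsilon (IsContinuation v)

/-- The factors of the product `∏ₖ (1 + z / (τₖ² + v))`, equal factors being collected. -/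
def deltaFactor (v : ℝ) (z : ℂ) (τ : tauSet) : ℂ :=
  (1 + z / ((τ : ℂ) ^ 2 + (v : ℂ))) ^ mult τ

/-- The Delta function `Δ(z | {τₖ² + v}) = ∏ₖ (1 + z / (τₖ² + v))`. -/
def Delta (v : ℝ) (z : ℂ) : ℂ :=
  ∏' τ : tauSet, deltaFactor v z τ

/-- A generalized Stirling expansion `L(z) ∼ ∑ₙ (bₙ log z + aₙ) z^(μₙ)`, `z → +∞`, with real
exponents `μₙ` decreasing strictly to `-∞`. -/
structure HasStirlingExpansion (L : ℝ → ℂ) (μ : ℕ → ℝ) (b a : ℕ → ℂ) : Prop where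
  strictAnti : StrictAnti μ
  tendsto_atBot : Filter.Tendsto μ Filter.atTop Filter.atBot
  isLittleO : ∀ N : ℕ, Asymptotics.IsLittleO Filter.atTop
    (fun z : ℝ => L z - ∑ n ∈ Finset.range (N + 1),
      (b n * (Real.log z : ℂ) + a n) * ((z ^ μ n : ℝ) : ℂ))
    (fun z : ℝ => z ^ μ N)

/-- `c` is the coefficient `a₀` of `z^0` in a generalized Stirling expansion of `L`. -/
def IsStirlingConstant (L : ℝ → ℂ) (c : ℂ) : Prop :=
  ∃ (μ : ℕ → ℝ) (b a : ℕ → ℂ) (n : ℕ),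
    HasStirlingExpansion L μ b a ∧ μ n = 0 ∧ a n = c

/-- `log Δ(z | {τₖ² + v})` for `z > 0`. -/
def logDelta (v : ℝ) (z : ℝ) : ℂ :=
  Complex.log (Delta v (z : ℂ))

/-- The coefficient `a₀(v)` of `z^0` in the large-`z` expansion of `log Δ(z | {τₖ² + v})`. -/
def aZero (v : ℝ) : ℂ :=
  Classical.epsilon (IsStirlingConstant (logDelta v))

/-- `F(s) = π^(s/2) / (s (s - 1) Γ(s/2))`. -/
def bigF (s : ℂ) : ℂ :=
  (Real.pi : ℂ) ^ (s / 2) / (s * (s - 1) * Complex.Gamma (s / 2))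

/-- The entire function `Ξ(s) = ζ(s) / F(s)`, with its removable singularities removed; see
`Xi_eq_div` and `differentiable_Xi`. -/
def Xi (s : ℂ) : ℂ :=
  s * (s - 1) * completedRiemannZeta₀ s + 1

theorem differentiable_Xi : Differentiable ℂ Xi :=
  ((differentiable_id.mul (differentiable_id.sub_const 1)).mul
    differentiable_completedZeta₀).add_const 1

theorem Xi_eq_div {s : ℂ} (h1 : s ≠ 1) (h : ∀ n : ℕ, s ≠ -(2 * n)) :
    Xi s = riemannZeta s / bigF s := by
  have h0 : s ≠ 0 := by simpa using h 0
  have h1' : s - 1 ≠ 0 := sub_ne_zero.2 h1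
  have h1'' : 1 - s ≠ 0 := sub_ne_zero.2 h1.symm
  have hG : Complex.Gammaℝ s ≠ 0 := by
    rw [Ne, Complex.Gammaℝ_eq_zero_iff]
    rintro ⟨n, hn⟩
    exact h n hn
  have hF : bigF s = (s * (s - 1) * Complex.Gammaℝ s)⁻¹ := by
    rw [bigF, Complex.Gammaℝ_def, neg_div, Complex.cpow_neg]
    simp only [div_eq_mul_inv, mul_inv, inv_inv]
    ring
  rw [hF, riemannZeta_def_of_ne_zero h0, completedRiemannZeta_eq, Xi]
  field_simp
  ring

end ZetaZeros

end

namespace ZetaZeros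

open Complex Filter Topology Set MeasureTheory

/-! The core is a single Mellin transform. For l off the negative real axis and 0 < Re σ < 1, the
integral of log(1 + t/l) t^(-σ-1) over t > 0 equals π/(σ sin πσ) · l^(-σ)
(`mellin_log_one_add_div`). Summing over l = τ² + v gives, for 1/2 < Re σ < 1, that 𝒵(σ,v) is σ
sin(πσ)/π times the Mellin transform of log Δ at -σ. A term (b log z + a) z^μ of the expansion of
log Δ, cut off at z = 1, has transform b/(σ-μ)² + a/(σ-μ); subtracting these terms continues 𝒵 to
the plane. Since σ sin(πσ)/π = σ² + O(σ⁴), the term with μ = 0 contributes b + aσ near σ = 0, and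
the others contribute O(σ²). Hence 𝒵(0,v) = b and 𝒵'(0,v) = a, whichever expansion is used
(`sin_pi_mul_div_mul_mellinContinuation`, `exists_continuation`).

The expansion comes from the product Ξ(1/2 + w) = Ξ(1/2) ∏(1 + w²/τ²), which yields Δ(z) = Ξ(1/2 +
√(z+v)) / Ξ(1/2 + √v). Stirling's series for Γ and the exponential decay of ζ - 1 expand log Ξ(1/2 +
√(z+v)) in powers z^((1-n)/2), with z^0 term (7/8) log z + (1/4) log 8π for every v
(`exists_log_norm_Xi_expansion`). Subtracting log Ξ(1/2 + √v) gives a₀(v), and Ξ(1) = 1 gives the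
comparison with v = 1/4.

The product formula is Hadamard's. The function Λ₀ is the Mellin transform of a nonnegative
function, so its size in the plane is controlled on the real axis and Ξ has order at most 1
(`exists_norm_Xi_le`). Jensen's formula then bounds the number of zeros, so the product over τ²
converges. The quotient of Ξ by the product is exp h; growth makes h affine and evenness makes it
constant (`eq_mul_tprod_of_even`).

The τ need not be real. As |Im τ| ≤ 1/2, all but finitely many τ² + v lie in the right half-plane,
so the whole family lies in a sector avoiding the negative axis, where all estimates are uniform. -/

/-! ### The completed zeta function as a Mellin transform of a nonnegative function -/

theorem one_le_cosKernel_zero {t : ℝ} (ht : 0 < t) : 1 ≤ HurwitzZeta.cosKernel 0 t := by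
  have h := HurwitzZeta.hasSum_nat_cosKernel₀ 0 ht
  have := h.nonneg fun n => by simp; positivity
  simpa using this

/-- With θ = `cosKernel 0`, the modified kernel is θ(t) - 1 for t > 1 and θ(t) - t^(-1/2) =
t^(-1/2)(θ(1/t) - 1) for t < 1, and θ ≥ 1. Nonnegativity lets values on the real axis bound all the
others. -/
theorem exists_completedRiemannZeta₀_eq_mellin :
    ∃ φ : ℝ → ℝ, (∀ t, 0 < t → 0 ≤ φ t) ∧ ∀ s : ℂ,
      MellinConvergent (fun t => (φ t : ℂ)) (s / 2) ∧
      completedRiemannZeta₀ s = mellin (fun t => (φ t : ℂ)) (s / 2) / 2 := by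
  set P := HurwitzZeta.hurwitzEvenFEPair 0 with hP
  have key : ∀ t : ℝ, 0 < t → 0 ≤ (P.f_modif t).re ∧ (P.f_modif t).im = 0 := by
    intro t ht
    rcases lt_trichotomy t 1 with h | h | h
    · have h1 : P.f_modif t =
          ((HurwitzZeta.evenKernel 0 t - t ^ (-(1 / 2 : ℝ)) : ℝ) : ℂ) := by
        simp [WeakFEPair.f_modif, h, ht, hP, HurwitzZeta.hurwitzEvenFEPair, h.le]
      rw [h1]
      refine ⟨?_, ofReal_im _⟩
      rw [ofReal_re, HurwitzZeta.evenKernel_functional_equation, Real.rpow_neg ht.le, one_div]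
      have h2 := one_le_cosKernel_zero (one_div_pos.2 ht)
      have h3 : 0 < (t ^ (1 / 2 : ℝ))⁻¹ := by positivity
      nlinarith
    · simp [WeakFEPair.f_modif, h]
    · have h1 : P.f_modif t = ((HurwitzZeta.cosKernel 0 t - 1 : ℝ) : ℂ) := by
        simp [WeakFEPair.f_modif, h, hP, HurwitzZeta.hurwitzEvenFEPair, h.le,
          HurwitzZeta.evenKernel_eq_cosKernel_of_zero]
      rw [h1]
      refine ⟨?_, ofReal_im _⟩
      rw [ofReal_re]
      linarith [one_le_cosKernel_zero ht]
  refine ⟨fun t => (P.f_modif t).re, fun t ht => (key t ht).1, fun s => ?_⟩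
  have heq : EqOn P.f_modif (fun t => ((P.f_modif t).re : ℂ)) (Ioi 0) := fun t ht =>
    Complex.ext (by simp) (by simp [(key t ht).2])
  have hm := (P.isStrongFEPair_toStrongFEPair.hasMellin (s / 2)).1
  have hcongr : EqOn (fun t : ℝ => (t : ℂ) ^ (s / 2 - 1) • P.f_modif t)
      (fun t : ℝ => (t : ℂ) ^ (s / 2 - 1) • ((P.f_modif t).re : ℂ)) (Ioi 0) := fun t ht => by
    have := heq ht
    simp only at this
    simp only [← this]
  constructor
  · exact (integrableOn_congr_fun hcongr measurableSet_Ioi).1 hm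
  · change P.Λ₀ (s / 2) / 2 = _
    rw [WeakFEPair.Λ₀, mellin, mellin, setIntegral_congr_fun measurableSet_Ioi hcongr]

theorem completedRiemannZeta₀_conj (s : ℂ) :
    completedRiemannZeta₀ (starRingEnd ℂ s) = starRingEnd ℂ (completedRiemannZeta₀ s) := by
  obtain ⟨φ, -, h⟩ := exists_completedRiemannZeta₀_eq_mellin
  have h2 : starRingEnd ℂ 2 = 2 := map_ofNat _ 2
  rw [(h _).2, (h _).2, map_div₀, mellin, mellin, ← integral_conj]
  congr 1
  · refine setIntegral_congr_fun measurableSet_Ioi fun t ht => ?_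
    have : arg (t : ℂ) ≠ Real.pi := by
      rw [arg_ofReal_of_nonneg (le_of_lt ht)]; exact Real.pi_pos.ne
    simp only [smul_eq_mul, map_mul, conj_ofReal]
    rw [show starRingEnd ℂ s / 2 - 1 = starRingEnd ℂ (s / 2 - 1) by simp [h2],
      cpow_conj _ _ this, conj_ofReal]
  · exact h2.symm

/-- The integrand has absolute value t^(Re s/2 - 1) φ(t), and a power of t between two others is at
most their sum. -/
theorem norm_completedRiemannZeta₀_add_le {s : ℂ} {a b : ℝ} (ha : a ≤ s.re) (hb : s.re ≤ b) :
    ‖completedRiemannZeta₀ s‖ ≤ (completedRiemannZeta₀ a).re + (completedRiemannZeta₀ b).re := by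
  obtain ⟨φ, hφ, h⟩ := exists_completedRiemannZeta₀_eq_mellin
  have hre : ∀ x : ℝ, IntegrableOn (fun t => t ^ (x / 2 - 1) * φ t) (Ioi 0) ∧
      (completedRiemannZeta₀ x).re = (∫ t in Ioi 0, t ^ (x / 2 - 1) * φ t) / 2 := by
    intro x
    have hcongr : EqOn (fun t : ℝ => (t : ℂ) ^ ((x : ℂ) / 2 - 1) • (φ t : ℂ))
        (fun t : ℝ => ((t ^ (x / 2 - 1) * φ t : ℝ) : ℂ)) (Ioi 0) := fun t ht => by
      simp only [smul_eq_mul, ofReal_mul]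
      rw [ofReal_cpow (le_of_lt ht)]
      push_cast; rfl
    have h1 := (integrableOn_congr_fun hcongr measurableSet_Ioi).1 (h x).1
    refine ⟨by simpa only [IntegrableOn, RCLike.re_to_complex, ofReal_re] using h1.re, ?_⟩
    rw [(h x).2, mellin, setIntegral_congr_fun measurableSet_Ioi hcongr, integral_complex_ofReal]
    rw [show (2 : ℂ) = ((2 : ℝ) : ℂ) by norm_num, ← ofReal_div, ofReal_re]
  rw [(hre a).2, (hre b).2, ← add_div, ← integral_add (hre a).1 (hre b).1, (h s).2, norm_div]
  simp only [norm_ofNat]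
  gcongr
  rw [mellin]
  refine norm_integral_le_of_norm_le ((hre a).1.add (hre b).1) ?_
  filter_upwards [ae_restrict_mem measurableSet_Ioi] with t ht
  have ht0 : 0 < t := ht
  rw [norm_smul, norm_cpow_eq_rpow_re_of_pos ht0, norm_real, Real.norm_of_nonneg (hφ t ht),
    ← add_mul]
  refine mul_le_mul_of_nonneg_right ?_ (hφ t ht)
  have hs : (s / 2 - 1).re = s.re / 2 - 1 := by simp
  rw [hs]
  rcases le_total t 1 with h1 | h1
  · have := Real.rpow_le_rpow_of_exponent_ge ht0 h1 (show a / 2 - 1 ≤ s.re / 2 - 1 by linarith)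
    have := Real.rpow_nonneg ht0.le (b / 2 - 1)
    linarith
  · have := Real.rpow_le_rpow_of_exponent_le h1 (show s.re / 2 - 1 ≤ b / 2 - 1 by linarith)
    have := Real.rpow_nonneg ht0.le (a / 2 - 1)
    linarith

/-! ### Symmetries and zeros of Ξ -/

theorem Xi_one_sub (s : ℂ) : Xi (1 - s) = Xi s := by
  rw [Xi, Xi, completedRiemannZeta₀_one_sub]; ring

theorem Xi_half_sub (w : ℂ) : Xi (1 / 2 - w) = Xi (1 / 2 + w) := by
  rw [← Xi_one_sub]; congr 1; ring

theorem Xi_conj (s : ℂ) : Xi (starRingEnd ℂ s) = starRingEnd ℂ (Xi s) := by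
  simp [Xi, completedRiemannZeta₀_conj]

theorem Xi_one : Xi 1 = 1 := by simp [Xi]

theorem Xi_ofReal_im (x : ℝ) : (Xi x).im = 0 := by
  rw [← conj_eq_iff_im, ← Xi_conj, conj_ofReal]

/-- Here Ξ(x) = 1 - x(1-x) Λ₀(x) with x(1-x) ≤ 1/4, so Λ₀(x) < 4 suffices. This follows from Λ₀(x) ≤
Λ₀(0) + Λ₀(1) = 2Λ₀(0) and Λ₀(0) = 1 + (γ - log 4π)/2 < 2. -/
theorem Xi_ofReal_re_pos_of_mem_Icc {x : ℝ} (hx : x ∈ Icc (0 : ℝ) 1) : 0 < (Xi x).re := by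
  have h1 := norm_completedRiemannZeta₀_add_le (s := x) (a := 0) (b := 1) (by simpa using hx.1)
    (by simpa using hx.2)
  have h2 : (completedRiemannZeta₀ (0 : ℝ)).re < 2 := by
    rw [ofReal_zero, completedRiemannZeta₀_zero]
    rw [show (4 * Real.pi : ℂ) = ((4 * Real.pi : ℝ) : ℂ) by push_cast; rfl,
      ← ofReal_log (by positivity), ← ofReal_sub]
    rw [show (((Real.eulerMascheroniConstant - Real.log (4 * Real.pi) : ℝ) : ℂ) / 2 + 1)
      = (((Real.eulerMascheroniConstant - Real.log (4 * Real.pi)) / 2 + 1 : ℝ) : ℂ) by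
        push_cast; rfl, ofReal_re]
    have h3 : 0 ≤ Real.log (4 * Real.pi) := Real.log_nonneg (by nlinarith [Real.pi_gt_three])
    have h4 := Real.eulerMascheroniConstant_lt_two_thirds
    linarith
  have h2' : (completedRiemannZeta₀ (1 : ℝ)).re < 2 := by
    have := completedRiemannZeta₀_one_sub 1
    simp only [ofReal_one, ofReal_zero] at h2 ⊢
    rw [← this, sub_self]; exact h2
  have h3 : (completedRiemannZeta₀ x).re < 4 := by
    have := (completedRiemannZeta₀ x).re_le_norm
    linarith
  have h4 : (Xi x).re = 1 - x * (1 - x) * (completedRiemannZeta₀ x).re := by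
    have : (x : ℂ) * (x - 1) = ((x * (x - 1) : ℝ) : ℂ) := by push_cast; ring
    rw [Xi, this, add_re, re_ofReal_mul, one_re]; ring
  rw [h4]
  have h5 : 0 ≤ x * (1 - x) := mul_nonneg hx.1 (by linarith [hx.2])
  have h6 : x * (1 - x) ≤ 1 / 4 := by nlinarith [sq_nonneg (x - 1 / 2)]
  rcases le_total (completedRiemannZeta₀ x).re 0 with h7 | h7 <;> nlinarith

theorem ne_neg_two_mul_nat {s : ℂ} (hs : 0 < s.re ∨ s.im ≠ 0) (n : ℕ) : s ≠ -(2 * n) := by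
  rintro rfl
  rcases hs with hs | hs
  · have : (0 : ℝ) ≤ n := n.cast_nonneg
    simp at hs; linarith
  · simp at hs

theorem bigF_inv_ne_zero {s : ℂ} (h1 : s ≠ 1) (hs : 0 < s.re ∨ s.im ≠ 0) : (bigF s)⁻¹ ≠ 0 := by
  have h0 : s ≠ 0 := by simpa using ne_neg_two_mul_nat hs 0
  refine inv_ne_zero (div_ne_zero ?_ ?_)
  · simp [cpow_eq_zero_iff, Real.pi_ne_zero]
  · refine mul_ne_zero (mul_ne_zero h0 (sub_ne_zero.2 h1)) (Complex.Gamma_ne_zero fun m hm => ?_)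
    exact ne_neg_two_mul_nat hs m (by linear_combination 2 * hm)

theorem Xi_eq_zero_iff {s : ℂ} (h1 : s ≠ 1) (hs : 0 < s.re ∨ s.im ≠ 0) :
    Xi s = 0 ↔ riemannZeta s = 0 := by
  rw [Xi_eq_div h1 (ne_neg_two_mul_nat hs), div_eq_mul_inv, mul_eq_zero]
  simp [bigF_inv_ne_zero h1 hs]

theorem Xi_ne_zero_of_one_le_re {s : ℂ} (hs : 1 ≤ s.re) : Xi s ≠ 0 := by
  rcases eq_or_ne s 1 with rfl | h
  · simp [Xi_one]
  · rw [Ne, Xi_eq_zero_iff h (Or.inl (by linarith))]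
    exact riemannZeta_ne_zero_of_one_le_re hs

theorem Xi_ne_zero_of_re_nonpos {s : ℂ} (hs : s.re ≤ 0) : Xi s ≠ 0 := by
  rw [← Xi_one_sub]
  exact Xi_ne_zero_of_one_le_re (by simpa using hs)

/-- Outside 0 < Re s < 1 this is nonvanishing of ζ on Re s ≥ 1 and the functional equation. As no
zero is real, every zero of Ξ is 1/2 ± iτ with Re τ > 0. -/
theorem Xi_ne_zero_of_im_eq_zero {s : ℂ} (hs : s.im = 0) : Xi s ≠ 0 := by
  rcases le_total s.re 0 with h | h
  · exact Xi_ne_zero_of_re_nonpos h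
  rcases le_total 1 s.re with h' | h'
  · exact Xi_ne_zero_of_one_le_re h'
  have : s = (s.re : ℂ) := Complex.ext (by simp) (by simp [hs])
  rw [this]
  intro h0
  have := Xi_ofReal_re_pos_of_mem_Icc ⟨h, h'⟩
  rw [h0] at this
  simp at this

theorem analyticAt_Xi (s : ℂ) : AnalyticAt ℂ Xi s := differentiable_Xi.analyticAt s

/-- Off the real axis 1/F is analytic and has no zeros. -/
theorem analyticOrderAt_Xi {s : ℂ} (hs : s.im ≠ 0) :
    analyticOrderAt Xi s = analyticOrderAt riemannZeta s := by
  have h1 : ∀ {z : ℂ}, z.im ≠ 0 → z ≠ 1 := fun {z} hz h => hz (by simp [h])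
  have hopen : {z : ℂ | z.im ≠ 0} ∈ 𝓝 s :=
    (isOpen_ne_fun continuous_im continuous_const).mem_nhds hs
  have hz : AnalyticAt ℂ riemannZeta s := analyticOn_riemannZeta s (h1 hs)
  have hg : AnalyticAt ℂ (fun z => (bigF z)⁻¹) s := by
    refine DifferentiableOn.analyticAt (s := {z : ℂ | z.im ≠ 0}) (fun z hz => ?_) hopen
    have hz' : ∀ m : ℕ, z / 2 ≠ -m := fun m hm =>
      ne_neg_two_mul_nat (Or.inr hz) m (by linear_combination 2 * hm)
    have : DifferentiableAt ℂ (fun z => (z * (z - 1) * Complex.Gamma (z / 2)) /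
        (Real.pi : ℂ) ^ (z / 2)) z := by
      refine DifferentiableAt.div ?_ ?_ ?_
      · refine DifferentiableAt.mul (by fun_prop) ?_
        exact (Complex.differentiableAt_Gamma _ hz').comp z (by fun_prop)
      · exact (differentiableAt_id.div_const 2).const_cpow (Or.inl (by simp [Real.pi_ne_zero]))
      · simp [cpow_eq_zero_iff, Real.pi_ne_zero]
    simpa [bigF] using this.differentiableWithinAt
  have hev : Xi =ᶠ[𝓝 s] riemannZeta * (fun z => (bigF z)⁻¹) := by
    filter_upwards [hopen] with z hz
    rw [Xi_eq_div (h1 hz) (ne_neg_two_mul_nat (Or.inr hz)), Pi.mul_apply, div_eq_mul_inv]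
  rw [analyticOrderAt_congr hev, analyticOrderAt_mul hz hg,
    (hg.analyticOrderAt_eq_zero).2 (bigF_inv_ne_zero (h1 hs) (Or.inr hs)), add_zero]

theorem analyticOrderAt_Xi_ne_top (s : ℂ) : analyticOrderAt Xi s ≠ ⊤ := by
  intro h
  have h1 : AnalyticOnNhd ℂ Xi univ := fun z _ => analyticAt_Xi z
  have h2 := h1.eqOn_zero_of_preconnected_of_eventuallyEq_zero isPreconnected_univ (mem_univ s)
    (analyticOrderAt_eq_top.1 h)
  have := h2 (mem_univ 1)
  rw [Xi_one] at this
  simp at this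

/-! ### Stirling's formula for log Γ -/

/-- The Stirling approximation of `log Γ(x)`. -/
noncomputable def stirlingMain (x : ℝ) : ℝ :=
  (x - 1 / 2) * Real.log x - x + 1 / 2 * Real.log (2 * Real.pi)

/-- The remainder in the Stirling approximation of `log Γ(x)`. -/
noncomputable def stirlingRem (x : ℝ) : ℝ :=
  Real.log (Real.Gamma x) - stirlingMain x

theorem log_Gamma_eq (x : ℝ) : Real.log (Real.Gamma x) =
    (x - 1 / 2) * Real.log x - x + 1 / 2 * Real.log (2 * Real.pi) + stirlingRem x := by
  simp [stirlingRem, stirlingMain]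

theorem stirlingRem_sub_add_one {x : ℝ} (hx : 0 < x) :
    stirlingRem x - stirlingRem (x + 1) = (x + 1 / 2) * Real.log (1 + 1 / x) - 1 := by
  have h1 : 1 + 1 / x = (x + 1) / x := by field_simp
  rw [h1, Real.log_div (by positivity) hx.ne', stirlingRem, stirlingRem, stirlingMain,
    stirlingMain, Real.Gamma_add_one hx.ne', Real.log_mul hx.ne' (Real.Gamma_pos_of_pos hx).ne']
  ring

theorem log_Gamma_add_nat {x : ℝ} (hx : 0 < x) (n : ℕ) :
    Real.log (Real.Gamma (x + n)) =
      Real.log (Real.Gamma x) + ∑ m ∈ Finset.range n, Real.log (x + m) := by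
  induction n with
  | zero => simp
  | succ n ih =>
    rw [Nat.cast_succ, ← add_assoc, Real.Gamma_add_one (by positivity),
      Real.log_mul (by positivity) (Real.Gamma_pos_of_pos (by positivity)).ne', ih,
      Finset.sum_range_succ]
    ring

/-- Euler's limit for Γ(x) reduces the claim to Stirling's formula for n!, whose constant √π
supplies the term (1/2) log 2π. -/
theorem tendsto_stirlingRem_add_nat {x : ℝ} (hx : 0 < x) :
    Tendsto (fun n : ℕ => stirlingRem (x + n)) atTop (𝓝 0) := by
  rw [← tendsto_add_atTop_iff_nat 1]
  have h1 : Tendsto (fun n : ℕ => Real.log (Real.Gamma x) - Real.BohrMollerup.logGammaSeq x n)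
      atTop (𝓝 0) := by
    simpa using (Real.BohrMollerup.tendsto_log_gamma hx).const_sub (Real.log (Real.Gamma x))
  have h2 : Tendsto (fun n : ℕ => Real.log (Stirling.stirlingSeq n)) atTop
      (𝓝 (Real.log (Real.sqrt Real.pi))) :=
    Stirling.tendsto_stirlingSeq_sqrt_pi.log (by positivity)
  have h3 : Tendsto (fun n : ℕ => (n : ℝ) * Real.log (1 + (x + 1) / n)) atTop (𝓝 (x + 1)) :=
    (Real.tendsto_mul_log_one_add_div_atTop (x + 1)).comp tendsto_natCast_atTop_atTop
  have h4 : Tendsto (fun n : ℕ => Real.log (1 + (x + 1) / n)) atTop (𝓝 0) := by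
    have : Tendsto (fun n : ℕ => 1 + (x + 1) / (n : ℝ)) atTop (𝓝 (1 + 0)) :=
      (tendsto_const_div_atTop_nhds_zero_nat (x + 1)).const_add 1
    simpa using this.log (by norm_num)
  have h5 := ((((h1.add h2).sub h3).sub (h4.const_mul (x + 1 / 2))).add_const
    (x + 1 + 1 / 2 * Real.log 2 - 1 / 2 * Real.log (2 * Real.pi)))
  have e : 0 + Real.log (Real.sqrt Real.pi) - (x + 1) - (x + 1 / 2) * 0 +
    (x + 1 + 1 / 2 * Real.log 2 - 1 / 2 * Real.log (2 * Real.pi)) = 0 := by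
    rw [Real.log_sqrt Real.pi_pos.le, Real.log_mul (by norm_num) Real.pi_ne_zero]
    ring
  rw [e] at h5
  refine h5.congr' ?_
  filter_upwards [eventually_gt_atTop 0] with n hn
  have hn' : (0 : ℝ) < n := by exact_mod_cast hn
  have e2 : 1 + (x + 1) / n = (x + (n + 1)) / n := by field_simp; ring
  rw [e2, Real.log_div (by positivity) hn'.ne', Stirling.log_stirlingSeq_formula,
    Real.BohrMollerup.logGammaSeq, stirlingRem, stirlingMain, log_Gamma_add_nat hx,
    Real.log_mul (by norm_num) hn'.ne', Real.log_div hn'.ne' (Real.exp_pos _).ne', Real.log_exp]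
  push_cast
  ring

/-! ### Asymptotic power series at 0 and the Stirling series -/

/-- `f` has an asymptotic expansion in nonnegative integral powers at `0` from the right. -/
def HasPowerAsymptotics (f : ℝ → ℝ) : Prop :=
  ∀ N : ℕ, ∃ p : Polynomial ℝ, (fun u => f u - p.eval u) =O[𝓝[>] 0] fun u => u ^ N

namespace HasPowerAsymptotics

variable {f g : ℝ → ℝ}

theorem congr (hf : HasPowerAsymptotics f) (h : f =ᶠ[𝓝[>] 0] g) : HasPowerAsymptotics g := by
  intro N
  obtain ⟨p, hp⟩ := hf N
  refine ⟨p, hp.congr' ?_ .rfl⟩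
  filter_upwards [h] with u hu
  rw [hu]

theorem add (hf : HasPowerAsymptotics f) (hg : HasPowerAsymptotics g) :
    HasPowerAsymptotics fun u => f u + g u := by
  intro N
  obtain ⟨p, hp⟩ := hf N
  obtain ⟨q, hq⟩ := hg N
  refine ⟨p + q, (hp.add hq).congr_left fun u => ?_⟩
  simp; ring

theorem id_mul (hf : HasPowerAsymptotics f) : HasPowerAsymptotics fun u => u * f u := by
  intro N
  obtain ⟨p, hp⟩ := hf N
  refine ⟨Polynomial.X * p, ((Asymptotics.isBigO_refl (fun u : ℝ => u) (𝓝[>] 0)).mul hp).trans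
    ?_ |>.congr_left fun u => ?_⟩
  · have : Tendsto (fun u : ℝ => u) (𝓝[>] 0) (𝓝 0) := tendsto_id.mono_left nhdsWithin_le_nhds
    have h := (this.isBigO_one ℝ).mul (Asymptotics.isBigO_refl (fun u : ℝ => u ^ N) (𝓝[>] 0))
    simpa using h
  · simp; ring

theorem of_isBigO (hf : ∀ N : ℕ, f =O[𝓝[>] 0] fun u => u ^ N) : HasPowerAsymptotics f :=
  fun N => ⟨0, by simpa using hf N⟩

theorem of_analyticAt (hf : AnalyticAt ℝ f 0) : HasPowerAsymptotics f := by
  intro N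
  obtain ⟨F, hF, h⟩ := hf.exists_eventuallyEq_sum_add_pow_mul N
  refine ⟨∑ i ∈ Finset.range N, Polynomial.C (iteratedDeriv i f 0 / i.factorial) *
    Polynomial.X ^ i, ?_⟩
  have h1 := (Asymptotics.isBigO_refl (fun u : ℝ => u ^ N) (𝓝[>] 0)).mul
    ((hF.continuousAt.tendsto.mono_left nhdsWithin_le_nhds).isBigO_one ℝ)
  refine h1.congr' ?_ (by simp)
  filter_upwards [nhdsWithin_le_nhds h] with u hu
  rw [hu, Polynomial.eval_finsetSum]
  simp only [smul_eq_mul, Polynomial.eval_mul, Polynomial.eval_C, Polynomial.eval_pow,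
    Polynomial.eval_X]
  rw [add_comm, add_sub_assoc, ← Finset.sum_sub_distrib, Finset.sum_eq_zero, add_zero]
  intro i _
  ring

theorem comp_analyticAt (hf : HasPowerAsymptotics f) {k : ℝ → ℝ} (hk : AnalyticAt ℝ k 0)
    (hk0 : k 0 = 0) (hkpos : ∀ᶠ u in 𝓝[>] 0, 0 < k u) : HasPowerAsymptotics fun u => f (k u) := by
  intro N
  obtain ⟨p, hp⟩ := hf N
  have hkt : Tendsto k (𝓝[>] 0) (𝓝[>] 0) :=
    tendsto_nhdsWithin_iff.2 ⟨by
      have := hk.continuousAt.tendsto.mono_left (nhdsWithin_le_nhds (s := Ioi 0))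
      rwa [hk0] at this, hkpos⟩
  have hkO : k =O[𝓝[>] 0] fun u => u := by
    have := hk.differentiableAt.isBigO_sub.mono (nhdsWithin_le_nhds (s := Ioi 0))
    simpa [hk0] using this
  obtain ⟨q, hq⟩ := of_analyticAt (f := fun u => p.eval (k u)) (by
    simpa using hk.aeval_polynomial p) N
  refine ⟨q, (((hp.comp_tendsto hkt).trans (hkO.pow N)).add hq).congr_left fun u => ?_⟩
  simp

end HasPowerAsymptotics

/-- With u = 1/x, the map u ↦ u/(1+u) is the shift x ↦ x + 1. The polynomial p is therefore a
truncated Stirling series: it solves the difference equation of `stirlingRem` up to an error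
O(u^(n+2)). -/
theorem exists_polynomial_difference (n : ℕ) : ∃ p : Polynomial ℝ, p.eval 0 = 0 ∧
    ∃ k : ℝ → ℝ, AnalyticAt ℝ k 0 ∧ ∀ᶠ u in 𝓝[>] 0, p.eval u - p.eval (u / (1 + u)) -
      ((1 / u + 1 / 2) * Real.log (1 + u) - 1) = u ^ (n + 2) * k u := by
  induction n with
  | zero =>
    have ha : AnalyticAt ℝ (fun u : ℝ => Real.log (1 + u)) 0 :=
      (analyticAt_const.add analyticAt_id).log (by simp)
    obtain ⟨F, hF, h⟩ := ha.exists_eventuallyEq_sum_add_pow_mul 3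
    refine ⟨0, by simp, fun u => 1 / 4 - (1 + u / 2) * F u, by fun_prop, ?_⟩
    filter_upwards [nhdsWithin_le_nhds h, self_mem_nhdsWithin] with u hu hu0
    have hu0' : u ≠ 0 := (mem_Ioi.1 hu0).ne'
    have d1 : deriv (fun u : ℝ => Real.log (1 + u)) = fun u => (1 + u)⁻¹ := by
      funext y
      rw [deriv_comp_const_add (f := Real.log), Real.deriv_log]
    have d2 : deriv (fun u : ℝ => (1 + u)⁻¹) 0 = -1 := by
      rw [deriv_comp_const_add (f := fun x => x⁻¹), deriv_inv]
      norm_num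
    rw [hu]
    simp only [Finset.sum_range_succ, Finset.sum_range_zero, iteratedDeriv_succ, iteratedDeriv_zero,
      d1, d2]
    simp
    field_simp
    ring
  | succ n ih =>
    obtain ⟨p, hp0, k, hk, h⟩ := ih
    -- The monomial u^(n+1) changes under the shift by u^(n+2) m(u) with m(0) = n + 1, so this
    -- multiple cancels the leading error.
    set c : ℝ := k 0 / (n + 1) with hc
    set m : ℝ → ℝ := fun u => ∑ i ∈ Finset.range (n + 1), (1 / (1 + u)) ^ (i + 1) with hm
    have hma : AnalyticAt ℝ m 0 := by
      refine Finset.analyticAt_fun_sum _ fun i _ => AnalyticAt.pow ?_ _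
      exact analyticAt_const.div (analyticAt_const.add analyticAt_id) (by simp)
    obtain ⟨k1, hk1, h1⟩ := (hk.sub
      (analyticAt_const (v := c) |>.mul hma)).exists_eventuallyEq_sum_add_pow_mul 1
    refine ⟨p - Polynomial.C c * Polynomial.X ^ (n + 1), by simp [hp0], k1, hk1, ?_⟩
    filter_upwards [h, nhdsWithin_le_nhds h1, self_mem_nhdsWithin] with u hu hu1 hu0
    have hu0' : 0 < u := hu0
    have e1 : u ^ (n + 1) - (u / (1 + u)) ^ (n + 1) = u ^ (n + 2) * m u := by
      have h3 := mul_neg_geom_sum (1 / (1 + u)) (n + 1)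
      have h4 : 1 - 1 / (1 + u) = u * (1 / (1 + u)) := by field_simp; ring
      rw [h4] at h3
      have h5 : m u = (1 / (1 + u)) * ∑ i ∈ Finset.range (n + 1), (1 / (1 + u)) ^ i := by
        rw [hm, Finset.mul_sum]
        exact Finset.sum_congr rfl fun i _ => by ring
      rw [h5, div_eq_mul_one_div u, mul_pow]
      linear_combination -u ^ (n + 1) * h3
    have e2 : k u - c * m u = u * k1 u := by
      have : k 0 - c * m 0 = 0 := by
        have : m 0 = n + 1 := by simp [hm]
        rw [this, hc]; field_simp; ring
      simpa [this] using hu1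
    simp only [Polynomial.eval_sub, Polynomial.eval_mul, Polynomial.eval_C, Polynomial.eval_pow,
      Polynomial.eval_X]
    linear_combination hu - c * e1 + u ^ (n + 2) * e2

/-- The difference D of the remainder and p has increments O(x^(-n-2)) and tends to 0 along x + ℕ.
Summing the increments gives D = O(x^(-n-1)). -/
theorem stirlingRem_isBigO (n : ℕ) : ∃ p : Polynomial ℝ, p.eval 0 = 0 ∧
    (fun u => stirlingRem (1 / u) - p.eval u) =O[𝓝[>] 0] fun u => u ^ (n + 1) := by
  obtain ⟨p, hp0, k, hk, h⟩ := exists_polynomial_difference n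
  refine ⟨p, hp0, ?_⟩
  obtain ⟨M, hM0, hM⟩ : ∃ M : ℝ, 0 ≤ M ∧ ∀ᶠ u in 𝓝[>] 0, |k u| ≤ M := by
    refine ⟨|k 0| + 1, by positivity, nhdsWithin_le_nhds ?_⟩
    exact (hk.continuousAt.abs.eventually_lt_const (lt_add_one _)).mono fun u hu => hu.le
  obtain ⟨δ, hδ, hδ'⟩ := mem_nhdsGT_iff_exists_Ioo_subset.1 (h.and hM)
  have hδ0 : 0 < δ := hδ
  set D : ℝ → ℝ := fun x => stirlingRem x - p.eval (1 / x) with hD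
  have hstep : ∀ x : ℝ, 1 ≤ x → 1 / δ < x → |D x - D (x + 1)| ≤ M * x⁻¹ ^ (n + 2) := by
    intro x hx1 hx
    have hx0 : 0 < x := by linarith
    have hu : x⁻¹ ∈ Ioo 0 δ := by
      refine ⟨by positivity, ?_⟩
      rwa [one_div, inv_lt_comm₀ hδ0 hx0] at hx
    obtain ⟨h1, h2⟩ := hδ' hu
    have h3 := stirlingRem_sub_add_one hx0
    have h4 : x⁻¹ / (1 + x⁻¹) = 1 / (x + 1) := by field_simp
    have e : D x - D (x + 1) = -(x⁻¹ ^ (n + 2) * k x⁻¹) := by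
      rw [h4] at h1
      simp only [hD]
      simp only [one_div, inv_inv] at *
      linear_combination h3 - h1
    rw [e, abs_neg, abs_mul, abs_of_nonneg (by positivity), mul_comm]
    gcongr
  have hsum : ∀ x : ℝ, 1 ≤ x → 1 / δ < x → ∀ m : ℕ,
      |D x - D (x + m)| ≤ 2 * M * x⁻¹ ^ n * (x⁻¹ - (x + m)⁻¹) := by
    intro x hx1 hx m
    have hx0 : 0 < x := by linarith
    induction m with
    | zero => simp
    | succ m ih =>
      have hm : (0 : ℝ) ≤ m := by positivity
      have h1 := hstep (x + m) (by linarith) (by linarith)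
      -- The sum over m is bounded by a telescoping one, since y⁻² ≤ 2(1/y - 1/(y+1)) for y ≥ 1.
      have h2 : (x + m)⁻¹ ^ (n + 2) ≤ 2 * x⁻¹ ^ n * ((x + m)⁻¹ - (x + m + 1)⁻¹) := by
        have h3 : (x + m)⁻¹ ^ n ≤ x⁻¹ ^ n := by gcongr; linarith
        have h4 : (x + m)⁻¹ ^ 2 ≤ 2 * ((x + m)⁻¹ - (x + m + 1)⁻¹) := by
          have hy : 1 ≤ x + m := by linarith
          set y := x + m
          have : y⁻¹ - (y + 1)⁻¹ = (y * (y + 1))⁻¹ := by field_simp; ring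
          rw [this, ← div_eq_mul_inv, inv_pow, inv_eq_one_div, div_le_div_iff₀ (by positivity)
            (by positivity)]
          nlinarith
        calc (x + m)⁻¹ ^ (n + 2) = (x + m)⁻¹ ^ n * (x + m)⁻¹ ^ 2 := pow_add _ _ _
          _ ≤ x⁻¹ ^ n * (2 * ((x + m)⁻¹ - (x + m + 1)⁻¹)) := by gcongr
          _ = _ := by ring
      have h5 : M * (x + m)⁻¹ ^ (n + 2) ≤ M * (2 * x⁻¹ ^ n * ((x + m)⁻¹ - (x + m + 1)⁻¹)) := by
        gcongr
      have h6 := abs_sub_le (D x) (D (x + m)) (D (x + m + 1))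
      rw [Nat.cast_succ, ← add_assoc]
      linarith
  have hlim : ∀ x : ℝ, 0 < x → Tendsto (fun m : ℕ => D (x + m)) atTop (𝓝 0) := by
    intro x hx
    have h1 : Tendsto (fun m : ℕ => 1 / (x + (m : ℝ))) atTop (𝓝 0) :=
      (tendsto_atTop_add_const_left _ x tendsto_natCast_atTop_atTop).const_div_atTop 1
    have h2 := (p.continuous.tendsto 0).comp h1
    rw [hp0] at h2
    simpa [hD] using (tendsto_stirlingRem_add_nat hx).sub h2
  refine Asymptotics.IsBigO.of_bound (2 * M) ?_
  have : Ioo 0 (min 1 δ) ∈ 𝓝[>] (0 : ℝ) := Ioo_mem_nhdsGT (by positivity)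
  filter_upwards [this] with u hu
  have hu0 : 0 < u := hu.1
  have hu1 : 1 ≤ 1 / u := by
    rw [le_div_iff₀ hu0]; linarith [hu.2.le.trans (min_le_left _ _)]
  have hu2 : 1 / δ < 1 / u := one_div_lt_one_div_of_lt hu0 (hu.2.trans_le (min_le_right _ _))
  have h1 : Tendsto (fun m : ℕ => |D (1 / u) - D (1 / u + m)|) atTop (𝓝 |D (1 / u) - 0|) :=
    ((hlim _ (by positivity)).const_sub _).abs
  have h2 : |D (1 / u) - 0| ≤ 2 * M * u ^ (n + 1) := by
    refine le_of_tendsto' h1 fun m => (hsum _ hu1 hu2 m).trans ?_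
    have h3 : 0 ≤ 2 * M * u ^ n := by positivity
    have h4 : 0 ≤ (u⁻¹ + (m : ℝ))⁻¹ := by positivity
    rw [one_div, inv_inv]
    calc _ ≤ 2 * M * u ^ n * u := by gcongr; linarith
      _ = _ := by ring
  simp only [hD, one_div_one_div, sub_zero] at h2
  rw [Real.norm_eq_abs, Real.norm_eq_abs, abs_of_nonneg (a := u ^ (n + 1)) (by positivity)]
  exact h2

theorem hasPowerAsymptotics_stirlingRem : HasPowerAsymptotics fun u => stirlingRem (1 / u) := by
  intro N
  obtain ⟨p, _, hp⟩ := stirlingRem_isBigO N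
  refine ⟨p, hp.trans ?_⟩
  have : Tendsto (fun u : ℝ => u) (𝓝[>] 0) (𝓝 0) := tendsto_id.mono_left nhdsWithin_le_nhds
  have h := (this.isBigO_one ℝ).mul (Asymptotics.isBigO_refl (fun u : ℝ => u ^ N) (𝓝[>] 0))
  simpa [pow_succ'] using h

theorem stirlingRem_one_div_isBigO :
    (fun u => stirlingRem (1 / u)) =O[𝓝[>] 0] fun u => u := by
  obtain ⟨p, hp0, hp⟩ := stirlingRem_isBigO 0
  have h1 : (fun u => p.eval u) =O[𝓝[>] 0] fun u : ℝ => u := by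
    have := (p.differentiable.differentiableAt (x := 0)).isBigO_sub.mono
      (nhdsWithin_le_nhds (s := Ioi 0))
    simpa [hp0] using this
  simpa using hp.add (h1.trans (by simpa using Asymptotics.isBigO_refl _ _))

theorem isBigO_nhdsGT_pow_of_le {m n : ℕ} (h : m ≤ n) :
    (fun u : ℝ => u ^ n) =O[𝓝[>] 0] fun u => u ^ m := by
  have h1 : Tendsto (fun u : ℝ => u ^ (n - m)) (𝓝[>] 0) (𝓝 (0 ^ (n - m))) :=
    ((continuous_pow (n - m)).tendsto 0).mono_left nhdsWithin_le_nhds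
  have h2 := (h1.isBigO_one ℝ).mul (Asymptotics.isBigO_refl (fun u : ℝ => u ^ m) (𝓝[>] 0))
  simpa [← pow_add, Nat.sub_add_cancel h] using h2

theorem polynomial_coeff_eq_zero_of_isBigO {N : ℕ} : ∀ {p : Polynomial ℝ},
    (fun u => p.eval u) =O[𝓝[>] 0] (fun u : ℝ => u ^ N) → ∀ n < N, p.coeff n = 0 := by
  induction N with
  | zero => intro p _ n hn; omega
  | succ N ih =>
    intro p hp n hn
    have h0 : p.coeff 0 = 0 := by
      have h1 : Tendsto (fun u : ℝ => u ^ (N + 1)) (𝓝[>] 0) (𝓝 0) := by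
        simpa using ((continuous_pow (N + 1)).tendsto (0 : ℝ)).mono_left nhdsWithin_le_nhds
      have h2 := hp.trans_tendsto h1
      have h3 : Tendsto (fun u => p.eval u) (𝓝[>] 0) (𝓝 (p.eval 0)) :=
        (p.continuous.tendsto 0).mono_left nhdsWithin_le_nhds
      rw [Polynomial.coeff_zero_eq_eval_zero]
      exact tendsto_nhds_unique h3 h2
    cases n with
    | zero => exact h0
    | succ n =>
      rw [← Polynomial.coeff_divX]
      refine ih ?_ n (by omega)
      have h4 := hp.mul (Asymptotics.isBigO_refl (fun u : ℝ => u⁻¹) (𝓝[>] 0))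
      refine h4.congr' ?_ ?_
      · filter_upwards [self_mem_nhdsWithin] with u hu
        have hu : u ≠ 0 := (mem_Ioi.1 hu).ne'
        have : p.eval u = (p.divX * Polynomial.X + Polynomial.C (p.coeff 0)).eval u := by
          rw [Polynomial.divX_mul_X_add]
        rw [this, h0]
        simp [hu]
      · filter_upwards [self_mem_nhdsWithin] with u hu
        have hu : u ≠ 0 := (mem_Ioi.1 hu).ne'
        field_simp
        ring

theorem polynomial_eval_isBigO_of_coeff {N : ℕ} {p : Polynomial ℝ} (hp : ∀ n < N, p.coeff n = 0) :
    (fun u => p.eval u) =O[𝓝[>] 0] (fun u : ℝ => u ^ N) := by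
  obtain ⟨q, rfl⟩ := Polynomial.X_pow_dvd_iff.2 hp
  have h1 : Tendsto (fun u => q.eval u) (𝓝[>] 0) (𝓝 (q.eval 0)) :=
    (q.continuous.tendsto 0).mono_left nhdsWithin_le_nhds
  simpa using (Asymptotics.isBigO_refl (fun u : ℝ => u ^ N) (𝓝[>] 0)).mul (h1.isBigO_one ℝ)

/-- The polynomial may a priori change with N; a polynomial that is O(u^N) has no coefficients below
N, so the choices are coherent. -/
theorem HasPowerAsymptotics.exists_coeff {f : ℝ → ℝ} (hf : HasPowerAsymptotics f) :
    ∃ c : ℕ → ℝ, ∀ N : ℕ,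
      (fun u => f u - ∑ n ∈ Finset.range N, c n * u ^ n) =O[𝓝[>] 0] fun u => u ^ N := by
  choose p hp using hf
  have hcomp : ∀ m n N, n < m → n < N → (p m).coeff n = (p N).coeff n := by
    intro m n N hm hN
    have h1 : (fun u => (p N - p m).eval u) =O[𝓝[>] 0] (fun u : ℝ => u ^ (n + 1)) := by
      refine (((hp m).trans (isBigO_nhdsGT_pow_of_le hm)).sub
        ((hp N).trans (isBigO_nhdsGT_pow_of_le hN))).congr_left fun u => ?_
      simp
    have := polynomial_coeff_eq_zero_of_isBigO h1 n (by omega)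
    rw [Polynomial.coeff_sub] at this
    linarith
  refine ⟨fun n => (p (n + 1)).coeff n, fun N => ?_⟩
  set q := p N - ∑ n ∈ Finset.range N, Polynomial.C ((p (n + 1)).coeff n) * Polynomial.X ^ n with hq
  have h1 : (fun u => q.eval u) =O[𝓝[>] 0] (fun u : ℝ => u ^ N) := by
    refine polynomial_eval_isBigO_of_coeff fun n hn => ?_
    rw [hq, Polynomial.coeff_sub, Polynomial.finsetSum_coeff]
    simp only [Polynomial.coeff_C_mul_X_pow]
    rw [Finset.sum_ite_eq, if_pos (Finset.mem_range.2 hn), hcomp (n + 1) n N (by omega) hn,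
        sub_self]
  refine ((hp N).add h1).congr_left fun u => ?_
  simp [hq, Polynomial.eval_finsetSum]

/-- Only the coefficient of u is ever needed explicitly: with u = z^(-1/2) and an overall factor
1/u, it becomes the coefficient of z^0. -/
theorem coeff_one_eq_of_isBigO {f : ℝ → ℝ} {c : ℕ → ℝ} (hc : ∀ N : ℕ,
      (fun u => f u - ∑ n ∈ Finset.range N, c n * u ^ n) =O[𝓝[>] 0] fun u => u ^ N)
    {a b : ℝ} (h : (fun u => f u - (a + b * u)) =O[𝓝[>] 0] fun u => u ^ 2) : c 1 = b := by
  have h1 : (fun u => (Polynomial.C (c 0 - a) + Polynomial.C (c 1 - b) * Polynomial.X).eval u)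
      =O[𝓝[>] 0] (fun u : ℝ => u ^ 2) := by
    refine (h.sub (hc 2)).congr_left fun u => ?_
    simp [Finset.sum_range_succ]; ring
  have := polynomial_coeff_eq_zero_of_isBigO h1 1 (by norm_num)
  simp [Polynomial.coeff_C] at this
  linarith

theorem _root_.AnalyticAt.sub_linear_isBigO {f : ℝ → ℝ} (hf : AnalyticAt ℝ f 0) {f' : ℝ}
    (hd : HasDerivAt f f' 0) :
    (fun u => f u - (f 0 + f' * u)) =O[𝓝[>] 0] fun u => u ^ 2 := by
  obtain ⟨F, hF, h⟩ := hf.exists_eventuallyEq_sum_add_pow_mul 2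
  have h1 := (Asymptotics.isBigO_refl (fun u : ℝ => u ^ 2) (𝓝[>] 0)).mul
    ((hF.continuousAt.tendsto.mono_left nhdsWithin_le_nhds).isBigO_one ℝ)
  refine h1.congr' ?_ (by simp)
  filter_upwards [nhdsWithin_le_nhds h] with u hu
  rw [hu]
  simp [Finset.sum_range_succ, iteratedDeriv_one, hd.deriv]
  ring

/-! ### The expansion of log |Ξ(1/2 + √(z + v))| -/

/-- For s ≥ 2 and m ≥ 2 one has m^(-s) = m^(-(s-2)) m^(-2) ≤ 4 · 2^(-s) m^(-2), which is summable in
m. -/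
theorem norm_riemannZeta_sub_one_isBigO :
    (fun s : ℝ => riemannZeta s - 1) =O[atTop] fun s : ℝ => (2 : ℝ) ^ (-s) := by
  refine Asymptotics.IsBigO.of_bound (4 * ∑' n : ℕ, ((n : ℝ) + 2) ^ (-2 : ℝ)) ?_
  filter_upwards [eventually_ge_atTop 2] with s hs
  have hsum : Summable fun n : ℕ => ((n : ℝ) + 2) ^ (-2 : ℝ) := by
    have := (summable_nat_add_iff 2).2 (Real.summable_nat_rpow.2 (show (-2 : ℝ) < -1 by norm_num))
    simpa using this
  have hb : ∀ n : ℕ, ‖1 / ((n + 2 : ℕ) : ℂ) ^ (s : ℂ)‖ ≤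
      4 * (2 : ℝ) ^ (-s) * ((n : ℝ) + 2) ^ (-2 : ℝ) := by
    intro n
    rw [norm_div, norm_one, norm_natCast_cpow_of_pos (by omega), ofReal_re, one_div,
      ← Real.rpow_neg (by positivity), Nat.cast_add, Nat.cast_ofNat]
    have e : -s = -(s - 2) + -2 := by ring
    have h4 : (4 : ℝ) = 2 ^ (2 : ℝ) := by norm_num
    rw [h4, ← Real.rpow_add (by norm_num), e, Real.rpow_add (by positivity),
      show (2 : ℝ) + (-(s - 2) + -2) = -(s - 2) by ring]
    gcongr ?_ * _
    exact Real.rpow_le_rpow_of_nonpos (by norm_num) (by linarith [Nat.cast_nonneg (α := ℝ) n])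
      (by linarith)
  have hs1 : Summable fun n : ℕ => 1 / ((n + 2 : ℕ) : ℂ) ^ (s : ℂ) :=
    Summable.of_norm_bounded (hsum.mul_left _) hb
  have hz : riemannZeta s - 1 = ∑' n : ℕ, 1 / ((n + 2 : ℕ) : ℂ) ^ (s : ℂ) := by
    have hs2 : Summable fun n : ℕ => 1 / (n : ℂ) ^ (s : ℂ) := (summable_nat_add_iff 2).1 hs1
    rw [zeta_eq_tsum_one_div_nat_cpow (by simp; linarith), ← hs2.sum_add_tsum_nat_add 2]
    have : (s : ℂ) ≠ 0 := by exact_mod_cast (by linarith : s ≠ 0)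
    simp [Finset.sum_range_succ, this]
  rw [hz, Real.norm_of_nonneg (by positivity)]
  calc _ ≤ ∑' n : ℕ, 4 * (2 : ℝ) ^ (-s) * ((n : ℝ) + 2) ^ (-2 : ℝ) :=
        tsum_of_norm_bounded (hsum.mul_left _).hasSum hb
    _ = _ := by rw [tsum_mul_left]; ring

theorem log_norm_riemannZeta_isBigO :
    (fun s : ℝ => Real.log ‖riemannZeta s‖) =O[atTop] fun s : ℝ => (2 : ℝ) ^ (-s) := by
  refine Asymptotics.IsBigO.trans (Asymptotics.IsBigO.of_bound (3 / 2) ?_)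
    norm_riemannZeta_sub_one_isBigO
  have h1 : Tendsto (fun s : ℝ => riemannZeta s - 1) atTop (𝓝 0) := by
    refine norm_riemannZeta_sub_one_isBigO.trans_tendsto ?_
    refine (tendsto_rpow_atTop_of_base_lt_one (1 / 2) (by norm_num) (by norm_num)).congr fun s => ?_
    rw [one_div, Real.inv_rpow (by norm_num), Real.rpow_neg (by norm_num)]
  filter_upwards [h1.norm.eventually_le_const (show ‖(0 : ℂ)‖ < 1 / 2 by simp)] with s hs
  have h2 := norm_log_one_add_half_le_self hs
  rw [add_sub_cancel] at h2
  rw [← log_re]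
  exact (abs_re_le_norm _).trans h2

theorem log_norm_Xi {s : ℝ} (hs : 1 < s) : Real.log ‖Xi s‖ =
    Real.log ‖riemannZeta s‖ + Real.log (s * (s - 1)) - s / 2 * Real.log Real.pi +
      Real.log (Real.Gamma (s / 2)) := by
  have hs0 : 0 < s := by linarith
  have hζ : riemannZeta s ≠ 0 := riemannZeta_ne_zero_of_one_le_re (by simpa using hs.le)
  have hG := Real.Gamma_pos_of_pos (half_pos hs0)
  have hs1 : 0 < s - 1 := by linarith
  have h1 : ‖Xi s‖ = ‖riemannZeta s‖ * (s * (s - 1)) * Real.Gamma (s / 2) /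
      Real.pi ^ (s / 2) := by
    rw [Xi_eq_div (by exact_mod_cast hs.ne') (ne_neg_two_mul_nat (Or.inl (by simpa using hs0))),
      bigF, norm_div, norm_div, norm_mul, norm_mul,
      norm_cpow_eq_rpow_re_of_pos Real.pi_pos,
      show ((s : ℂ) / 2) = ((s / 2 : ℝ) : ℂ) by push_cast; ring, Complex.Gamma_ofReal,
      show ((s : ℂ) - 1) = ((s - 1 : ℝ) : ℂ) by push_cast; ring, norm_real, norm_real, norm_real,
      Real.norm_of_nonneg hs0.le, Real.norm_of_nonneg hs1.le, Real.norm_of_nonneg hG.le, ofReal_re]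
    field_simp
  have hζ' : 0 < ‖riemannZeta s‖ := norm_pos_iff.2 hζ
  rw [h1, Real.log_div (by positivity) (by positivity), Real.log_mul (by positivity) hG.ne',
    Real.log_mul hζ'.ne' (by positivity), Real.log_rpow Real.pi_pos]
  ring

/-- `√(1 + v u²) + u / 2`, written so as to be visibly analytic. -/
noncomputable def expansionPoint (v u : ℝ) : ℝ :=
  Real.exp (Real.log (1 + v * u ^ 2) / 2) + u / 2

theorem analyticAt_expansionPoint (v : ℝ) : AnalyticAt ℝ (expansionPoint v) 0 := by
  have h1 : AnalyticAt ℝ (fun u : ℝ => Real.log (1 + v * u ^ 2)) 0 :=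
    AnalyticAt.log (by fun_prop) (by simp)
  unfold expansionPoint
  fun_prop

theorem expansionPoint_zero (v : ℝ) : expansionPoint v 0 = 1 := by simp [expansionPoint]

theorem hasDerivAt_expansionPoint (v : ℝ) : HasDerivAt (expansionPoint v) (1 / 2) 0 := by
  have h0 : HasDerivAt (fun u : ℝ => 1 + v * u ^ 2) 0 0 := by
    simpa using ((hasDerivAt_pow 2 (0 : ℝ)).const_mul v).const_add 1
  have h := (((h0.log (by simp)).div_const 2).exp).add ((hasDerivAt_id (0 : ℝ)).div_const 2)
  refine h.congr_deriv ?_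
  simp

theorem eventually_expansionPoint_gt (v : ℝ) : ∀ᶠ u in 𝓝[>] 0, 1 / 2 < expansionPoint v u :=
  nhdsWithin_le_nhds ((analyticAt_expansionPoint v).continuousAt.eventually_const_lt
    (by rw [expansionPoint_zero]; norm_num))

/-- Here u stands for z^(-1/2): half-integral powers of z become integral powers of u, and the
argument of Ξ becomes an analytic function of u divided by u. -/
theorem half_add_sqrt_eq {v u : ℝ} (hu : 0 < u) (h : 0 < 1 + v * u ^ 2) :
    1 / 2 + √(1 / u ^ 2 + v) = expansionPoint v u / u := by
  have h1 : Real.exp (Real.log (1 + v * u ^ 2) / 2) = √(1 + v * u ^ 2) := by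
    rw [Real.sqrt_eq_rpow, Real.rpow_def_of_pos h]; ring_nf
  have h2 : 1 / u ^ 2 + v = (1 + v * u ^ 2) / u ^ 2 := by field_simp
  rw [expansionPoint, h1, h2, Real.sqrt_div h.le, Real.sqrt_sq hu.le]
  field_simp
  ring

theorem eventually_one_add_mul_sq_pos (v : ℝ) : ∀ᶠ u in 𝓝[>] 0, 0 < 1 + v * u ^ 2 :=
  nhdsWithin_le_nhds ((by fun_prop : Continuous fun u : ℝ =>
    1 + v * u ^ 2).continuousAt.eventually_const_lt
    (by simp))

/-- The part of the expansion of `u log ‖Ξ(1/2 + √(u⁻² + v))‖` that is analytic at `u = 0`. -/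
noncomputable def analyticPart (v u : ℝ) : ℝ :=
  -(expansionPoint v u / 2) * Real.log Real.pi + u * Real.log (1 + (v - 1 / 4) * u ^ 2) +
    (expansionPoint v u / 2 - u / 2) * (Real.log (expansionPoint v u) - Real.log 2) -
    expansionPoint v u / 2 + u / 2 * Real.log (2 * Real.pi)

theorem analyticAt_analyticPart (v : ℝ) : AnalyticAt ℝ (analyticPart v) 0 := by
  have h := analyticAt_expansionPoint v
  have h1 : AnalyticAt ℝ (fun u : ℝ => Real.log (1 + (v - 1 / 4) * u ^ 2)) 0 :=
    AnalyticAt.log (by fun_prop) (by simp)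
  have h2 : AnalyticAt ℝ (fun u : ℝ => Real.log (expansionPoint v u)) 0 :=
    h.log (by simp [expansionPoint_zero])
  unfold analyticPart
  fun_prop

/-- This is the origin of the constant (1/4) log 8π; it is independent of v because `expansionPoint
v` is 1 + u/2 to first order. -/
theorem hasDerivAt_analyticPart (v : ℝ) :
    HasDerivAt (analyticPart v) (1 / 4 * Real.log (8 * Real.pi)) 0 := by
  have h := hasDerivAt_expansionPoint v
  have h0 : HasDerivAt (fun u : ℝ => 1 + (v - 1 / 4) * u ^ 2) 0 0 := by
    simpa using ((hasDerivAt_pow 2 (0 : ℝ)).const_mul (v - 1 / 4)).const_add 1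
  have hid := hasDerivAt_id (0 : ℝ)
  have H := (((((h.div_const 2).neg.mul_const (Real.log Real.pi)).add
    (hid.mul (h0.log (by simp)))).add (((h.div_const 2).sub (hid.div_const 2)).mul
    ((h.log (by simp [expansionPoint_zero])).sub_const (Real.log 2)))).sub (h.div_const 2)).add
    ((hid.div_const 2).mul_const (Real.log (2 * Real.pi)))
  refine H.congr_deriv ?_
  have e8 : Real.log (8 * Real.pi) = 3 * Real.log 2 + Real.log Real.pi := by
    rw [Real.log_mul (by norm_num) Real.pi_ne_zero, show (8 : ℝ) = 2 ^ 3 by norm_num, Real.log_pow]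
    norm_num
  rw [e8, Real.log_mul (by norm_num) Real.pi_ne_zero]
  simp [expansionPoint_zero]
  ring

/-- With s = 1/2 + √(u⁻² + v), s(s-1) = u⁻² + v - 1/4. The coefficient of log(1/u) collects 2u from
s(s-1) and (E - u)/2 from Stirling's formula for Γ(s/2), where E = `expansionPoint v u`. -/
theorem mul_log_norm_Xi_eq {v u : ℝ} (hu : 0 < u) (hu1 : u < 1 / 2) (h : 0 < 1 + v * u ^ 2)
    (hp : 1 / 2 < expansionPoint v u) (h14 : 0 < 1 + (v - 1 / 4) * u ^ 2) :
    u * Real.log ‖Xi ((1 / 2 + √(1 / u ^ 2 + v) : ℝ) : ℂ)‖ =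
      (3 * u / 2 + expansionPoint v u / 2) * Real.log (1 / u) + (analyticPart v u +
        u * (stirlingRem (expansionPoint v u / u / 2) +
          Real.log ‖riemannZeta ((expansionPoint v u / u : ℝ) : ℂ)‖)) := by
  have hsq : 0 ≤ 1 / u ^ 2 + v := by
    have : 1 / u ^ 2 + v = (1 + v * u ^ 2) / u ^ 2 := by field_simp
    rw [this]; positivity
  have e1 : expansionPoint v u / u * (expansionPoint v u / u - 1) =
      (1 + (v - 1 / 4) * u ^ 2) * (1 / u) ^ 2 := by
    rw [← half_add_sqrt_eq hu h]
    have := Real.sq_sqrt hsq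
    field_simp
    field_simp at this
    nlinarith
  have hy : 1 < expansionPoint v u / u := by
    rw [lt_div_iff₀ hu]; linarith
  have hp0 : 0 < expansionPoint v u := by linarith
  have e2 : Real.log (expansionPoint v u / u / 2) =
      Real.log (expansionPoint v u) - Real.log u - Real.log 2 := by
    rw [Real.log_div (by positivity) (by norm_num), Real.log_div hp0.ne' hu.ne']
  have e3 : Real.log (1 / u) = -Real.log u := by rw [one_div, Real.log_inv]
  rw [half_add_sqrt_eq hu h, log_norm_Xi hy, e1,
    Real.log_mul h14.ne' (pow_ne_zero 2 (one_div_ne_zero hu.ne')),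
    Real.log_pow, log_Gamma_eq, analyticPart, e2, e3]
  push_cast
  field_simp
  ring

/-- The large-`z` expansion of `log ‖Ξ(1/2 + √(z + v))‖`. -/
theorem exists_log_norm_Xi_expansion (v : ℝ) : ∃ A B : ℕ → ℝ, A 1 = 7 / 8 ∧
    B 1 = 1 / 4 * Real.log (8 * Real.pi) ∧ ∀ N : ℕ,
      (fun z : ℝ => Real.log ‖Xi ((1 / 2 + √(z + v) : ℝ) : ℂ)‖ -
        ∑ n ∈ Finset.range (N + 1), (A n * Real.log z + B n) * z ^ ((1 - n) / 2 : ℝ)) =o[atTop]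
      fun z : ℝ => z ^ ((1 - N) / 2 : ℝ) := by
  have hE := analyticAt_expansionPoint v
  have hE1 := eventually_expansionPoint_gt v
  have hA : AnalyticAt ℝ (fun u => 3 * u / 2 + expansionPoint v u / 2) 0 := by fun_prop
  have hAd : HasDerivAt (fun u => 3 * u / 2 + expansionPoint v u / 2) (7 / 4) 0 := by
    refine ((((hasDerivAt_id (0 : ℝ)).const_mul 3).div_const 2).add
      ((hasDerivAt_expansionPoint v).div_const 2)).congr_deriv ?_
    norm_num
  obtain ⟨c, hc⟩ := (HasPowerAsymptotics.of_analyticAt hA).exists_coeff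
  have hc1 := coeff_one_eq_of_isBigO hc (hA.sub_linear_isBigO hAd)
  -- This is 1/(s/2), the variable in which the Stirling remainder is expanded.
  set k : ℝ → ℝ := fun u => 2 * u / expansionPoint v u with hk
  have hka : AnalyticAt ℝ k 0 :=
    AnalyticAt.div (by fun_prop) hE (by simp [expansionPoint_zero])
  have hk0 : k 0 = 0 := by simp [hk]
  have hkpos : ∀ᶠ u in 𝓝[>] 0, 0 < k u := by
    filter_upwards [hE1, self_mem_nhdsWithin] with u h1 h2
    have : 0 < u := h2
    have : 0 < expansionPoint v u := by linarith
    positivity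
  have hkt : Tendsto k (𝓝[>] 0) (𝓝[>] 0) :=
    tendsto_nhdsWithin_iff.2 ⟨by
      have := hka.continuousAt.tendsto.mono_left (nhdsWithin_le_nhds (s := Ioi 0))
      rwa [hk0] at this, hkpos⟩
  have hkO : k =O[𝓝[>] 0] fun u => u := by
    have := hka.differentiableAt.isBigO_sub.mono (nhdsWithin_le_nhds (s := Ioi 0))
    simpa [hk0] using this
  have hkinv : ∀ u, 1 / k u = expansionPoint v u / u / 2 := fun u => by
    rw [hk, one_div_div]; ring
  have hζ : ∀ N : ℕ, (fun u => Real.log ‖riemannZeta ((expansionPoint v u / u : ℝ) : ℂ)‖)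
      =O[𝓝[>] 0] fun u => u ^ N := by
    intro N
    have h1 : (fun s : ℝ => (2 : ℝ) ^ (-s)) =O[atTop] fun s : ℝ => (s⁻¹) ^ N := by
      have := (isLittleO_exp_neg_mul_rpow_atTop (Real.log_pos one_lt_two) (-(N : ℝ))).isBigO
      refine this.congr' (Eventually.of_forall fun s => ?_) ?_
      · simp only [Real.rpow_def_of_pos zero_lt_two]; ring_nf
      · filter_upwards [eventually_gt_atTop 0] with s hs
        rw [Real.rpow_neg hs.le, Real.rpow_natCast, inv_pow]
    have h2 : Tendsto (fun u => expansionPoint v u / u) (𝓝[>] 0) atTop := by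
      have := (tendsto_inv_nhdsGT_zero.comp hkt).const_mul_atTop (show (0 : ℝ) < 2 by norm_num)
      refine this.congr fun u => ?_
      rw [Function.comp_apply, ← one_div, hkinv]; ring
    have h3 := (log_norm_riemannZeta_isBigO.trans h1).comp_tendsto h2
    refine h3.trans ?_
    have h4 : (fun u => (expansionPoint v u / u)⁻¹) =O[𝓝[>] 0] fun u => u := by
      refine (hkO.const_mul_left (1 / 2)).congr_left fun u => ?_
      simp only [hk]
      rw [inv_div]; ring
    exact h4.pow N
  have hRO : (fun u => stirlingRem (expansionPoint v u / u / 2)) =O[𝓝[>] 0] fun u => u := by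
    refine ((stirlingRem_one_div_isBigO.comp_tendsto hkt).trans hkO).congr_left fun u => ?_
    rw [Function.comp_apply, hkinv]
  have hRT : HasPowerAsymptotics fun u => stirlingRem (expansionPoint v u / u / 2) := by
    refine (hasPowerAsymptotics_stirlingRem.comp_analyticAt hka hk0 hkpos).congr
      (Eventually.of_forall fun u => ?_)
    simp only [hkinv]
  set Bf : ℝ → ℝ := fun u => analyticPart v u + u * (stirlingRem (expansionPoint v u / u / 2) +
    Real.log ‖riemannZeta ((expansionPoint v u / u : ℝ) : ℂ)‖) with hBf
  obtain ⟨d, hd⟩ := ((HasPowerAsymptotics.of_analyticAt (analyticAt_analyticPart v)).add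
    (hRT.add (HasPowerAsymptotics.of_isBigO hζ)).id_mul).exists_coeff
  have hd1 : d 1 = 1 / 4 * Real.log (8 * Real.pi) := by
    refine coeff_one_eq_of_isBigO hd (a := analyticPart v 0) ?_
    have h1 := (analyticAt_analyticPart v).sub_linear_isBigO (hasDerivAt_analyticPart v)
    have h2 := (Asymptotics.isBigO_refl (fun u : ℝ => u) (𝓝[>] 0)).mul
      (hRO.add (by simpa using hζ 1))
    refine (h1.add (h2.trans (Asymptotics.isBigO_of_le _ fun u => by rw [sq]))).congr_left
      fun u => ?_
    push_cast
    ring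
  -- The coefficients of log(1/u) = (1/2) log z are halved, so 7/4 becomes 7/8.
  refine ⟨fun n => c n / 2, d, by simp only [hc1]; norm_num, hd1, fun N => ?_⟩
  have hu : Tendsto (fun z : ℝ => z ^ (-(1 / 2) : ℝ)) atTop (𝓝[>] 0) :=
    tendsto_nhdsWithin_iff.2 ⟨tendsto_rpow_neg_atTop (by norm_num),
      (eventually_gt_atTop 0).mono fun z hz => Real.rpow_pos_of_pos hz _⟩
  have hlog : (fun z : ℝ => 1 / 2 * Real.log z) =o[atTop] fun z : ℝ => z ^ (1 / 2 : ℝ) :=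
    (isLittleO_log_rpow_atTop (by norm_num)).const_mul_left _
  have hone : (fun _ : ℝ => (1 : ℝ)) =o[atTop] fun z : ℝ => z ^ (1 / 2 : ℝ) := by
    rw [Asymptotics.isLittleO_const_left]
    exact Or.inr (tendsto_norm_atTop_atTop.comp (tendsto_rpow_atTop (by norm_num)))
  -- The remainder is O(u^(N+1) log z) · z^(1/2); bounding the logarithm by o(z^(1/2)) leaves
  -- exactly o(z^((1-N)/2)).
  have h1 := ((hc (N + 1)).comp_tendsto hu).mul_isLittleO hlog
  have h2 := ((hd (N + 1)).comp_tendsto hu).mul_isLittleO hone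
  have h3 := (h1.add h2).mul_isBigO (Asymptotics.isBigO_refl (fun z : ℝ => z ^ (1 / 2 : ℝ)) atTop)
  refine h3.congr' ?_ ?_
  · filter_upwards [eventually_gt_atTop 0, hu.eventually hE1,
      hu.eventually (eventually_one_add_mul_sq_pos v),
      hu.eventually (eventually_one_add_mul_sq_pos (v - 1 / 4)),
      hu.eventually (Ioo_mem_nhdsGT (show (0 : ℝ) < 1 / 2 by norm_num))] with z hz g1 g2 g3 g4
    set u := z ^ (-(1 / 2) : ℝ) with hudef
    have hu0 : 0 < u := g4.1
    have hinv : z ^ (1 / 2 : ℝ) = 1 / u := by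
      rw [hudef, Real.rpow_neg hz.le, one_div (z ^ _)⁻¹, inv_inv]
    have hz1 : z = 1 / u ^ 2 := by
      rw [← one_div_pow, ← hinv, ← Real.rpow_natCast, ← Real.rpow_mul hz.le]; norm_num
    have hlz : Real.log (1 / u) = 1 / 2 * Real.log z := by
      rw [← hinv, Real.log_rpow hz]
    have hpow : ∀ n : ℕ, z ^ ((1 - n) / 2 : ℝ) = u ^ n * (1 / u) := by
      intro n
      rw [← hinv, hudef, ← Real.rpow_natCast, ← Real.rpow_mul hz.le, ← Real.rpow_add hz]
      congr 1; ring
    have key := mul_log_norm_Xi_eq hu0 g4.2 g2 g1 g3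
    rw [← hz1, hlz] at key
    simp only [Function.comp_apply, ← hudef]
    rw [hinv]
    have e1 : Real.log ‖Xi ((1 / 2 + √(z + v) : ℝ) : ℂ)‖ =
        ((3 * u / 2 + expansionPoint v u / 2) * (1 / 2 * Real.log z) + Bf u) * (1 / u) := by
      rw [hBf, ← key]; field_simp
    have e2 : ∑ n ∈ Finset.range (N + 1), (c n / 2 * Real.log z + d n) * z ^ ((1 - n) / 2 : ℝ) =
        ((∑ n ∈ Finset.range (N + 1), c n * u ^ n) * (1 / 2 * Real.log z) +
          ∑ n ∈ Finset.range (N + 1), d n * u ^ n) * (1 / u) := by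
      rw [Finset.sum_mul, ← Finset.sum_add_distrib, Finset.sum_mul]
      refine Finset.sum_congr rfl fun n _ => ?_
      rw [hpow]; ring
    rw [e1, e2, hBf]
    ring
  · filter_upwards [eventually_gt_atTop 0] with z hz
    have e : (z ^ (-(1 / 2) : ℝ)) ^ (N + 1) * z ^ (1 / 2 : ℝ) * z ^ (1 / 2 : ℝ) =
        z ^ ((1 - N) / 2 : ℝ) := by
      rw [← Real.rpow_natCast, ← Real.rpow_mul hz.le, ← Real.rpow_add hz, ← Real.rpow_add hz]
      congr 1; push_cast; ring
    exact e

/-! ### The order of Ξ -/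

/-- The leading term of the expansion with v = 0 is of size x log x, where z = x², and β > 1 absorbs
the logarithm. -/
theorem exists_log_norm_Xi_le {β : ℝ} (hβ : 1 < β) : ∃ C X : ℝ, 0 < C ∧ 2 ≤ X ∧
    ∀ x : ℝ, X ≤ x → ‖Xi ((1 / 2 + x : ℝ) : ℂ)‖ ≤ Real.exp (C * x ^ β) := by
  obtain ⟨A, B, -, -, h⟩ := exists_log_norm_Xi_expansion 0
  have h0 := h 0
  have hlog : (fun z : ℝ => Real.log z) =O[atTop] fun z : ℝ => z ^ ((β - 1) / 2 : ℝ) :=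
    (isLittleO_log_rpow_atTop (by linarith)).isBigO
  have hone : (fun _ : ℝ => (1 : ℝ)) =O[atTop] fun z : ℝ => z ^ ((β - 1) / 2 : ℝ) := by
    refine Asymptotics.IsBigO.of_bound 1 ?_
    filter_upwards [eventually_ge_atTop 1] with z hz
    rw [norm_one, one_mul, Real.norm_of_nonneg (by positivity)]
    exact Real.one_le_rpow hz (by linarith)
  have hr := Asymptotics.isBigO_refl (fun z : ℝ => z ^ (1 / 2 : ℝ)) atTop
  have e : ∀ᶠ z : ℝ in atTop, z ^ ((β - 1) / 2 : ℝ) * z ^ (1 / 2 : ℝ) = z ^ (β / 2) := by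
    filter_upwards [eventually_gt_atTop 0] with z hz
    rw [← Real.rpow_add hz]; congr 1; ring
  have h1 : (fun z : ℝ => (A 0 * Real.log z + B 0 * 1) * z ^ (1 / 2 : ℝ)) =O[atTop]
      fun z : ℝ => z ^ (β / 2) :=
    (((hlog.const_mul_left (A 0)).add (hone.const_mul_left (B 0))).mul hr).congr' .rfl e
  have h2 : (fun z : ℝ => z ^ (1 / 2 : ℝ)) =O[atTop] fun z : ℝ => z ^ (β / 2) :=
    (hone.mul hr).congr' (Eventually.of_forall fun z => one_mul _) e
  have h3 : (fun z : ℝ => Real.log ‖Xi ((1 / 2 + √z : ℝ) : ℂ)‖) =O[atTop]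
      fun z : ℝ => z ^ (β / 2) := by
    have h4 : (fun z : ℝ => z ^ ((1 - (0 : ℕ)) / 2 : ℝ)) = fun z : ℝ => z ^ (1 / 2 : ℝ) := by
      norm_num
    rw [h4] at h0
    refine ((h0.isBigO.trans h2).add h1).congr_left fun z => ?_
    simp
  have h5 := h3.comp_tendsto (tendsto_pow_atTop (α := ℝ) two_ne_zero)
  obtain ⟨C, hC, h6⟩ := h5.exists_pos
  obtain ⟨X, hX⟩ := eventually_atTop.1 h6.bound
  refine ⟨C, max X 2, hC, le_max_right _ _, fun x hx => ?_⟩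
  have hx2 : 2 ≤ x := (le_max_right _ _).trans hx
  have hx0 : 0 ≤ x := by linarith
  have h7 := hX x ((le_max_left _ _).trans hx)
  simp only [Function.comp_apply, Real.sqrt_sq hx0] at h7
  have h8 : ((x ^ 2) ^ (β / 2) : ℝ) = x ^ β := by
    rw [← Real.rpow_natCast, ← Real.rpow_mul hx0]; congr 1; push_cast; ring
  rw [h8, Real.norm_of_nonneg (r := x ^ β) (by positivity)] at h7
  have hne : Xi ((1 / 2 + x : ℝ) : ℂ) ≠ 0 := Xi_ne_zero_of_im_eq_zero (ofReal_im _)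
  rw [← Real.log_le_iff_le_exp (norm_pos_iff.2 hne)]
  exact (le_abs_self _).trans h7

/-- By the Mellin bound and the functional equation, |Λ₀(1/2 + w)| ≤ 2 Λ₀(1/2 + R) once R ≥ |w|, so
growth along the positive axis governs the plane. -/
theorem exists_norm_Xi_le {β : ℝ} (hβ : 1 < β) : ∃ C : ℝ, 0 < C ∧
    ∀ w : ℂ, ‖Xi (1 / 2 + w)‖ ≤ Real.exp (C * (1 + ‖w‖ ^ β)) := by
  obtain ⟨C, X, hC, hX, h⟩ := exists_log_norm_Xi_le hβ
  refine ⟨(4 + C) * 2 ^ β * (1 + X ^ β), by positivity, fun w => ?_⟩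
  -- Adding X puts R in the range of the real-axis bound; as X ≥ 2, also R² - 1/4 ≥ 1, which lets
  -- Ξ(1/2 + R) bound Λ₀(1/2 + R).
  set R := ‖w‖ + X with hR
  have hw := norm_nonneg w
  have hR2 : 2 ≤ R := by linarith
  have hre := abs_le.1 (abs_re_le_norm w)
  have h1 : ‖completedRiemannZeta₀ (1 / 2 + w)‖ ≤
      (completedRiemannZeta₀ ((1 / 2 - R : ℝ) : ℂ)).re +
        (completedRiemannZeta₀ ((1 / 2 + R : ℝ) : ℂ)).re := by
    refine norm_completedRiemannZeta₀_add_le ?_ ?_ <;> simp <;> linarith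
  have h2 : completedRiemannZeta₀ ((1 / 2 - R : ℝ) : ℂ) =
      completedRiemannZeta₀ ((1 / 2 + R : ℝ) : ℂ) := by
    rw [← completedRiemannZeta₀_one_sub]
    congr 1
    push_cast
    ring
  have h3 := h R (by linarith)
  set E := Real.exp (C * R ^ β) with hE
  have hE1 : 1 ≤ E := Real.one_le_exp (by positivity)
  have h4 : (completedRiemannZeta₀ ((1 / 2 + R : ℝ) : ℂ)).re ≤ E := by
    have h5 : (Xi ((1 / 2 + R : ℝ) : ℂ)).re =
        (R ^ 2 - 1 / 4) * (completedRiemannZeta₀ ((1 / 2 + R : ℝ) : ℂ)).re + 1 := by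
      have : ((1 / 2 + R : ℝ) : ℂ) * (((1 / 2 + R : ℝ) : ℂ) - 1) = ((R ^ 2 - 1 / 4 : ℝ) : ℂ) := by
        push_cast; ring
      rw [Xi, this, add_re, re_ofReal_mul, one_re]
    have h6 := (re_le_norm _).trans h3
    rw [h5] at h6
    by_contra! hlt
    have g0 : 1 ≤ R ^ 2 - 1 / 4 := by nlinarith
    nlinarith [mul_le_mul_of_nonneg_right g0 (show 0 ≤
      (completedRiemannZeta₀ ((1 / 2 + R : ℝ) : ℂ)).re by linarith)]
  rw [h2] at h1
  have h7 : ‖Xi (1 / 2 + w)‖ ≤ (R + 1) * (R + 1) * (2 * E) + 1 := by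
    refine (norm_add_le _ _).trans ?_
    rw [norm_mul, norm_mul, norm_one]
    have g1 : ‖1 / 2 + w‖ ≤ R + 1 := (norm_add_le _ _).trans (by norm_num; linarith)
    have g2 : ‖1 / 2 + w - 1‖ ≤ R + 1 := by
      have : 1 / 2 + w - 1 = w - 1 / 2 := by ring
      rw [this]
      exact (norm_sub_le _ _).trans (by norm_num; linarith)
    have g3 : ‖completedRiemannZeta₀ (1 / 2 + w)‖ ≤ 2 * E := by linarith
    gcongr
  have h8 : (R + 1) * (R + 1) * (2 * E) + 1 ≤ Real.exp (2 * (R + 1)) * E := by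
    have := Real.quadratic_le_exp_of_nonneg (x := 2 * (R + 1)) (by linarith)
    nlinarith
  refine h7.trans (h8.trans ?_)
  rw [hE, ← Real.exp_add, Real.exp_le_exp]
  have h9 : R ≤ R ^ β := by
    simpa using Real.rpow_le_rpow_of_exponent_le (show 1 ≤ R by linarith) hβ.le
  have h10 : R ^ β ≤ 2 ^ β * ((1 + X ^ β) * (1 + ‖w‖ ^ β)) := by
    have g0 : 0 ≤ ‖w‖ ^ β := by positivity
    have g1 : 0 ≤ X ^ β := by positivity
    have g2 : R ^ β ≤ 2 ^ β * max ‖w‖ X ^ β := by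
      rw [← Real.mul_rpow (by norm_num) (by positivity)]
      refine Real.rpow_le_rpow (by linarith) ?_ (by linarith)
      have := le_max_left ‖w‖ X
      have := le_max_right ‖w‖ X
      linarith
    refine g2.trans ?_
    gcongr
    rcases max_choice ‖w‖ X with hm | hm <;> rw [hm] <;> nlinarith
  have h11 : 2 * (R + 1) + C * R ^ β ≤ (4 + C) * R ^ β := by nlinarith
  calc _ ≤ (4 + C) * R ^ β := h11
    _ ≤ (4 + C) * (2 ^ β * ((1 + X ^ β) * (1 + ‖w‖ ^ β))) := by gcongr
    _ = _ := by ring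

/-! ### Canonical products of genus zero -/

section Product

variable {ι : Type*} {l : ι → ℂ}

theorem summable_norm_div (hl : Summable fun i => ‖l i‖⁻¹) (z : ℂ) :
    Summable fun i => ‖z / l i‖ := by
  simpa [div_eq_mul_inv] using hl.mul_left ‖z‖

theorem multipliable_one_add_div (hl : Summable fun i => ‖l i‖⁻¹) (z : ℂ) :
    Multipliable fun i => 1 + z / l i :=
  multipliable_one_add_of_summable (summable_norm_div hl z)

theorem differentiable_tprod_one_add_div (hl : Summable fun i => ‖l i‖⁻¹) :
    Differentiable ℂ fun z => ∏' i, (1 + z / l i) := by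
  intro z
  have hu : Summable fun i => (‖z‖ + 1) * ‖l i‖⁻¹ := hl.mul_left _
  have h := hu.hasProdLocallyUniformlyOn_one_add (f := fun i z => z / l i)
    (K := Metric.ball 0 (‖z‖ + 1)) Metric.isOpen_ball
    (Eventually.of_forall fun i x hx => by
      rw [norm_div, div_eq_mul_inv]
      gcongr
      exact (mem_ball_zero_iff.1 hx).le)
    (fun i => by fun_prop)
  have h2 := (hasProdLocallyUniformlyOn_iff_tendstoLocallyUniformlyOn.1 h).differentiableOn
    (Eventually.of_forall fun s => by fun_prop) Metric.isOpen_ball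
  exact h2.differentiableAt (Metric.isOpen_ball.mem_nhds (by simp))

theorem tprod_one_add_div_ne_zero (hl : Summable fun i => ‖l i‖⁻¹) {z : ℂ}
    (hz : ∀ i, 1 + z / l i ≠ 0) : ∏' i, (1 + z / l i) ≠ 0 :=
  tprod_one_add_ne_zero_of_summable hz (summable_norm_div hl z)

/-- Since 1/p ≥ 1, 1 + x ≤ (1 + x^p)^(1/p). This turns summability of |l|^(-p) into growth of order
p of the product. -/
theorem one_add_le_exp_rpow {x p : ℝ} (hx : 0 ≤ x) (hp : 0 < p) (hp1 : p ≤ 1) :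
    1 + x ≤ Real.exp (p⁻¹ * x ^ p) := by
  have h1 := Real.add_rpow_le_rpow_add zero_le_one (Real.rpow_nonneg hx p)
    ((one_le_inv₀ hp).2 hp1)
  rw [Real.one_rpow, ← Real.rpow_mul hx, mul_inv_cancel₀ hp.ne', Real.rpow_one] at h1
  refine h1.trans ?_
  have h2 : 1 + x ^ p ≤ Real.exp (x ^ p) := by
    rw [add_comm]; exact Real.add_one_le_exp _
  calc (1 + x ^ p) ^ p⁻¹ ≤ (Real.exp (x ^ p)) ^ p⁻¹ := by
        have := Real.rpow_nonneg hx p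
        gcongr
    _ = Real.exp (p⁻¹ * x ^ p) := by rw [← Real.exp_mul, mul_comm]

theorem norm_tprod_one_add_div_le (hl : Summable fun i => ‖l i‖⁻¹) {p : ℝ} (hp : 0 < p)
    (hp1 : p ≤ 1) (hlp : Summable fun i => ‖l i‖ ^ (-p)) (z : ℂ) :
    ‖∏' i, (1 + z / l i)‖ ≤ Real.exp (p⁻¹ * (∑' i, ‖l i‖ ^ (-p)) * ‖z‖ ^ p) := by
  have h := (multipliable_one_add_div hl z).hasProd.norm
  refine le_of_tendsto' h fun s => ?_
  calc ∏ i ∈ s, ‖1 + z / l i‖ ≤ ∏ i ∈ s, Real.exp (p⁻¹ * ‖z‖ ^ p * ‖l i‖ ^ (-p)) := by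
        refine Finset.prod_le_prod (fun _ _ => norm_nonneg _) fun i _ => ?_
        have h1 := one_add_le_exp_rpow (x := ‖z‖ / ‖l i‖) (by positivity) hp hp1
        rw [Real.div_rpow (norm_nonneg _) (norm_nonneg _), div_eq_mul_inv (‖z‖ ^ p),
          ← Real.rpow_neg (norm_nonneg _), ← mul_assoc] at h1
        refine le_trans ?_ h1
        simpa [norm_div] using norm_add_le (1 : ℂ) (z / l i)
    _ = Real.exp (p⁻¹ * ‖z‖ ^ p * ∑ i ∈ s, ‖l i‖ ^ (-p)) := by
        rw [← Real.exp_sum, Finset.mul_sum]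
    _ ≤ Real.exp (p⁻¹ * (∑' i, ‖l i‖ ^ (-p)) * ‖z‖ ^ p) := by
        rw [mul_right_comm]
        gcongr
        exact hlp.sum_le_tsum s fun i _ => by positivity

theorem finite_setOf_add_eq_zero (hl : Summable fun i => ‖l i‖⁻¹) (hl0 : ∀ i, l i ≠ 0) (z : ℂ) :
    {i | l i + z = 0}.Finite := by
  rcases eq_or_ne z 0 with rfl | hz
  · simp [hl0]
  have h1 : (0 : ℝ) < ‖z‖⁻¹ := by positivity
  have h2 := hl.tendsto_cofinite_zero.eventually (gt_mem_nhds h1)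
  refine h2.subset fun i hi => ?_
  have : l i = -z := eq_neg_of_add_eq_zero_left hi
  simp [this]

/-- The finitely many factors vanishing at w are (z-w)(z+w)/l. The second factor does not vanish at
z = w: w = 0 would force l = 0. The rest of the product is nonzero at w. -/
theorem analyticOrderAt_tprod_one_add_sq_div (hl : Summable fun i => ‖l i‖⁻¹)
    (hl0 : ∀ i, l i ≠ 0) (w : ℂ) :
    analyticOrderAt (fun z => ∏' i, (1 + z ^ 2 / l i)) w = {i | l i + w ^ 2 = 0}.ncard := by
  classical
  set S : Set ι := {i | l i + w ^ 2 = 0} with hS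
  have hfin : S.Finite := finite_setOf_add_eq_zero hl hl0 _
  have : Fintype S := hfin.fintype
  have hlc : Summable fun i : (Sᶜ : Set ι) => ‖l i‖⁻¹ := hl.comp_injective Subtype.val_injective
  have hdiff : Differentiable ℂ fun z => ∏' i, (1 + z ^ 2 / l i) :=
    (differentiable_tprod_one_add_div hl).comp (differentiable_pow 2)
  rw [(hdiff.analyticAt w).analyticOrderAt_eq_natCast]
  refine ⟨fun z => (∏ i : S, ((z + w) / l i)) * ∏' i : (Sᶜ : Set ι), (1 + z ^ 2 / l i),
    ?_, ?_, ?_⟩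
  · refine Differentiable.analyticAt ?_ w
    refine Differentiable.mul (by fun_prop) ?_
    exact (differentiable_tprod_one_add_div hlc).comp (differentiable_pow 2)
  · refine mul_ne_zero (Finset.prod_ne_zero_iff.2 fun i _ => ?_) ?_
    · refine div_ne_zero ?_ (hl0 i)
      intro h0
      have hw : w = 0 := by linear_combination h0 / 2
      have h3 : l i + w ^ 2 = 0 := i.2
      exact hl0 i (by simpa [hw] using h3)
    · refine tprod_one_add_div_ne_zero hlc fun i h0 => i.2 ?_
      have := hl0 i
      field_simp at h0
      simpa [hS] using h0
  · refine Eventually.of_forall fun z => ?_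
    have h1 := Multipliable.tprod_mul_tprod_compl (f := fun i => 1 + z ^ 2 / l i) (s := S)
      (hasProd_fintype _).multipliable (multipliable_one_add_div hlc (z ^ 2))
    rw [← h1, tprod_fintype, smul_eq_mul, ← mul_assoc]
    congr 1
    rw [Set.ncard_eq_toFinset_card', Set.toFinset_card, ← Finset.card_univ, ← Finset.prod_const,
      ← Finset.prod_mul_distrib]
    refine Finset.prod_congr rfl fun i _ => ?_
    have h3 : l i + w ^ 2 = 0 := i.2
    have := hl0 i
    field_simp
    linear_combination h3

end Product

/-! ### Hadamard factorization -/

theorem exists_nonvanishing_quotient {f g : ℂ → ℂ} (hf : Differentiable ℂ f)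
    (hg : Differentiable ℂ g) (hord : ∀ w, analyticOrderAt f w = analyticOrderAt g w)
    (htop : ∀ w, analyticOrderAt g w ≠ ⊤) :
    ∃ K : ℂ → ℂ, Differentiable ℂ K ∧ (∀ w, K w ≠ 0) ∧ ∀ w, f w = K w * g w := by
  have hm : MeromorphicOn (f / g) univ := fun w _ =>
    (hf.analyticAt w).meromorphicAt.div (hg.analyticAt w).meromorphicAt
  have h0 : ∀ w, meromorphicOrderAt (f / g) w = 0 := by
    intro w
    rw [meromorphicOrderAt_div (hf.analyticAt w).meromorphicAt (hg.analyticAt w).meromorphicAt,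
      (hf.analyticAt w).meromorphicOrderAt_eq, (hg.analyticAt w).meromorphicOrderAt_eq, hord w]
    obtain ⟨n, hn⟩ := ENat.ne_top_iff_exists.1 (htop w)
    rw [← hn]
    simp
  set K := toMeromorphicNFOn (f / g) univ with hK
  have hnf : ∀ w, MeromorphicNFAt K w := fun w => meromorphicNFOn_toMeromorphicNFOn _ _ (mem_univ w)
  have hK0 : ∀ w, meromorphicOrderAt K w = 0 := fun w => by
    rw [hK, meromorphicOrderAt_toMeromorphicNFOn hm (mem_univ w), h0]
  have hKa : ∀ w, AnalyticAt ℂ K w := fun w =>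
    (hnf w).meromorphicOrderAt_nonneg_iff_analyticAt.1 (hK0 w).ge
  refine ⟨K, fun w => (hKa w).differentiableAt,
    fun w => (hnf w).meromorphicOrderAt_eq_zero_iff.1 (hK0 w), fun w => ?_⟩
  have h1 : f =ᶠ[𝓝[≠] w] K * g := by
    have hne : ∀ᶠ z in 𝓝[≠] w, g z ≠ 0 := by
      rcases (hg.analyticAt w).eventually_eq_zero_or_eventually_ne_zero with h | h
      · exact absurd (analyticOrderAt_eq_top.2 h) (htop w)
      · exact h
    filter_upwards [hm.toMeromorphicNFOn_eq_self_on_nhdsNE (mem_univ w), hne] with z hz hz'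
    rw [Pi.mul_apply, hK, hz, Pi.div_apply, div_mul_cancel₀ _ hz']
  exact ((hf.continuous.continuousAt.eventuallyEq_nhds_iff_eventuallyEq_nhdsNE
    ((hKa w).continuousAt.mul hg.continuous.continuousAt)).1 h1).eq_of_nhds

/-- A primitive h of K'/K makes K exp(-h) constant. -/
theorem exists_entire_log {K : ℂ → ℂ} (hK : Differentiable ℂ K) (h0 : ∀ w, K w ≠ 0) :
    ∃ h : ℂ → ℂ, Differentiable ℂ h ∧ ∀ w, K w = exp (h w) := by
  have hd : Differentiable ℂ fun z => deriv K z / K z := hK.deriv.div hK h0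
  obtain ⟨h, hh0, hh⟩ := hd.isExactOn_univ.with_val_at 0 (log (K 0))
  have hh' : ∀ z, HasDerivAt h (deriv K z / K z) z := fun z => hh z (mem_univ z)
  have hc : ∀ z, K z * exp (-h z) = K 0 * exp (-h 0) := by
    intro z
    refine is_const_of_deriv_eq_zero (𝕜 := ℂ) (f := fun z => K z * exp (-h z)) ?_ ?_ z 0
    · exact hK.mul (fun z => ((hh' z).differentiableAt.neg.cexp))
    · intro z
      have := (hK z).hasDerivAt.mul ((hh' z).neg.cexp)
      refine this.deriv.trans ?_
      have := h0 z
      field_simp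
      simp
  refine ⟨h, fun z => (hh' z).differentiableAt, fun w => ?_⟩
  have h1 := hc w
  rw [hh0, exp_neg (log _), exp_log (h0 0), mul_inv_cancel₀ (h0 0), exp_neg,
    mul_inv_eq_one₀ (exp_ne_zero _)] at h1
  exact h1

/-- On the circle Re h = log|f| - log|g|, and no lower bound for |g| is at hand. Averaging against
the Poisson kernel replaces it by a lower bound for the mean of log|g|, which Jensen's formula
provides. -/
theorem re_le_of_exp_mul_eq {f g h : ℂ → ℂ} (hg : Differentiable ℂ g) (hh : Differentiable ℂ h)
    (hg0 : g 0 = 1) (hfg : ∀ w, f w = exp (h w) * g w) {R B : ℝ} (hR : 0 < R) (hB : 0 ≤ B)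
    (hfB : ∀ w, ‖w‖ = R → ‖f w‖ ≤ Real.exp B) (hgB : ∀ w, ‖w‖ = R → ‖g w‖ ≤ Real.exp B)
    {z : ℂ} (hz : ‖z‖ ≤ R / 2) : (h z).re ≤ 6 * B := by
  classical
  have habs : |R| = R := abs_of_pos hR
  have hgA : AnalyticOnNhd ℂ g univ := fun w _ => hg.analyticAt w
  have hharm : InnerProductSpace.HarmonicOnNhd (fun w => (h w).re) (Metric.closedBall 0 R) :=
    fun w _ => (hh.analyticAt w).harmonicAt_re
  have hpois := hharm.circleAverage_poissonKernel_smul (w := z)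
    (by simpa using lt_of_le_of_lt hz (by linarith))
  set F : ℂ → ℝ := poissonKernel 0 z • fun w => (h w).re with hF
  -- At a zero of g the convention log 0 = 0 would spoil the pointwise bound; changing the integrand
  -- on this discrete set leaves the average unchanged.
  set F1 : ℂ → ℝ := fun w => if g w = 0 then 0 else F w with hF1
  have hcod : F =ᶠ[codiscreteWithin (Metric.sphere 0 |R|)] F1 := by
    have h1 : g ⁻¹' {0}ᶜ ∈ codiscrete ℂ :=
      hgA.preimage_zero_mem_codiscrete (x := 0) (by simp [hg0])
    have h2 := codiscreteWithin_mono (subset_univ (Metric.sphere (0 : ℂ) |R|)) h1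
    filter_upwards [h2] with w hw
    have : g w ≠ 0 := hw
    simp [hF1, this]
  have hFc : CircleIntegrable F 0 R := by
    refine ContinuousOn.circleIntegrable hR.le ?_
    have : ∀ w ∈ Metric.sphere (0 : ℂ) R, ‖w - 0 - (z - 0)‖ ^ 2 ≠ 0 := by
      intro w hw h0
      have hw' : ‖w‖ = R := by simpa using hw
      have : w = z := by simpa [sub_eq_zero] using h0
      rw [this] at hw'
      linarith
    simp only [hF]
    refine ContinuousOn.smul ?_ (continuous_re.comp hh.continuous).continuousOn
    exact ContinuousOn.div (by fun_prop) (by fun_prop) this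
  have hF1c : CircleIntegrable F1 0 R := hFc.congr_codiscreteWithin hcod
  have hlog : CircleIntegrable (fun w => Real.log ‖g w‖) 0 R :=
    MeromorphicOn.circleIntegrable_log_norm fun w _ => (hg.analyticAt w).meromorphicAt
  have hU : CircleIntegrable (fun w => 3 * (2 * B - Real.log ‖g w‖)) 0 R :=
    (IntervalIntegrable.sub (by simp) hlog).const_mul 3
  -- Jensen: the mean of log|g| is log|g(0)| = 0 plus nonnegative contributions of the zeros.
  have hjen : 0 ≤ Real.circleAverage (fun w => Real.log ‖g w‖) 0 R := by
    rw [AnalyticOnNhd.circleAverage_log_norm hR.ne' (hgA.mono (subset_univ _)) (by simp [hg0]), hg0]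
    simp only [norm_one, Real.log_one, add_zero]
    refine finsum_nonneg fun u => ?_
    by_cases hu : u ∈ Metric.closedBall (0 : ℂ) |R|
    · refine mul_nonneg ?_ ?_
      · have : 0 ≤ MeromorphicOn.divisor g (Metric.closedBall 0 |R|) :=
          MeromorphicOn.AnalyticOnNhd.divisor_nonneg (hgA.mono (subset_univ _))
        exact_mod_cast this u
      · rcases eq_or_ne u 0 with rfl | hu0
        · simp
        · refine Real.log_nonneg ?_
          have h3 : ‖u‖ ≤ R := by simpa [habs] using hu
          have h4 : 0 < ‖u‖ := norm_pos_iff.2 hu0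
          rw [zero_sub, norm_neg, ← div_eq_mul_inv, one_le_div h4]
          exact h3
    · simp [Function.locallyFinsuppWithin.apply_eq_zero_of_notMem _ hu]
  have hle : ∀ w ∈ Metric.sphere (0 : ℂ) |R|, F1 w ≤ 3 * (2 * B - Real.log ‖g w‖) := by
    intro w hw
    have hw' : ‖w‖ = R := by simpa [habs] using hw
    by_cases hgw : g w = 0
    · simp [hF1, hgw]; linarith
    have hgpos : 0 < ‖g w‖ := norm_pos_iff.2 hgw
    have hlg : Real.log ‖g w‖ ≤ B := by
      rw [Real.log_le_iff_le_exp hgpos]; exact hgB w hw'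
    have hre : (h w).re ≤ B - Real.log ‖g w‖ := by
      have h1 : ‖f w‖ = Real.exp (h w).re * ‖g w‖ := by rw [hfg, norm_mul, norm_exp]
      have h2 := hfB w hw'
      rw [h1] at h2
      have h3 := Real.log_le_log (by positivity) h2
      rw [Real.log_mul (Real.exp_pos _).ne' hgpos.ne', Real.log_exp, Real.log_exp] at h3
      linarith
    have hk0 : 0 ≤ poissonKernel 0 z w := by
      rw [poissonKernel]
      refine div_nonneg ?_ (sq_nonneg _)
      simp only [sub_zero, hw']
      nlinarith [norm_nonneg z]
    -- The kernel is at most (R + |z|)/(R - |z|), and |z| ≤ R/2.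
    have hk3 : poissonKernel 0 z w ≤ 3 := by
      rw [poissonKernel]
      simp only [sub_zero, hw']
      have h5 : R - ‖z‖ ≤ ‖w - z‖ := by rw [← hw']; exact norm_sub_norm_le w z
      have h6 : 0 < R - ‖z‖ := by linarith
      rw [div_le_iff₀ (by nlinarith)]
      have h7 : (R - ‖z‖) ^ 2 ≤ ‖w - z‖ ^ 2 := by gcongr
      nlinarith [norm_nonneg z]
    simp only [hF1, hgw, if_false, hF, smul_eq_mul]
    calc poissonKernel 0 z w * (h w).re
        ≤ poissonKernel 0 z w * (2 * B - Real.log ‖g w‖) := by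
          gcongr; linarith
      _ ≤ 3 * (2 * B - Real.log ‖g w‖) := by
          gcongr; linarith
  calc (h z).re = Real.circleAverage F1 0 R := by
        rw [← hpois, Real.circleAverage_congr_codiscreteWithin hcod hR.ne']
    _ ≤ Real.circleAverage (fun w => 3 * (2 * B - Real.log ‖g w‖)) 0 R :=
        Real.circleAverage_mono hF1c hU hle
    _ = 3 * (2 * B - Real.circleAverage (fun w => Real.log ‖g w‖) 0 R) := by
        have e1 : (fun w => 3 * (2 * B - Real.log ‖g w‖)) =
            (3 : ℝ) • ((fun _ => 2 * B) - fun w => Real.log ‖g w‖) := by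
          ext w; simp
        rw [e1, Real.circleAverage_smul, Real.circleAverage_sub (by simp) hlog,
          Real.circleAverage_const, smul_eq_mul]
    _ ≤ 6 * B := by linarith

/-- Borel–Carathéodory bounds |h| by a multiple of R^q, and Cauchy's estimate on circles of radius R
→ ∞ kills the second derivative because q < 2. -/
theorem eq_add_mul_of_re_le {h : ℂ → ℂ} (hh : Differentiable ℂ h) {A q : ℝ} (hq0 : 0 ≤ q)
    (hq : q < 2) (hA : 0 < A) (hre : ∀ z, (h z).re ≤ A * (1 + ‖z‖ ^ q)) :
    ∃ a b : ℂ, ∀ z, h z = a + b * z := by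
  have hnorm : ∀ R : ℝ, 1 ≤ R → ∀ z, ‖z‖ ≤ R →
      ‖h z‖ ≤ (4 * A * 2 ^ q + 3 * ‖h 0‖) * R ^ q := by
    intro R hR z hz
    have hR0 : 0 < R := by linarith
    have h1 : 1 ≤ (2 * R) ^ q := Real.one_le_rpow (by linarith) hq0
    have h1' : 1 ≤ R ^ q := Real.one_le_rpow hR hq0
    have h2 := borelCaratheodory (f := h) (M := 2 * A * (2 * R) ^ q) (R := 2 * R) (z := z)
      (by positivity) hh.differentiableOn (fun w hw => by
        have hw' : ‖w‖ ≤ 2 * R := (mem_ball_zero_iff.1 hw).le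
        have h3 : ‖w‖ ^ q ≤ (2 * R) ^ q := Real.rpow_le_rpow (norm_nonneg _) hw' hq0
        have := hre w
        simp only [mem_ofPred_eq]
        nlinarith) (by linarith) (by simp; linarith)
    refine h2.trans ?_
    have h4 : 0 < 2 * R - ‖z‖ := by linarith
    have h5 : 2 * (2 * A * (2 * R) ^ q) * ‖z‖ / (2 * R - ‖z‖) ≤ 4 * A * (2 * R) ^ q := by
      rw [div_le_iff₀ h4]
      have : ‖z‖ ≤ 2 * R - ‖z‖ := by linarith
      have h7 : 0 ≤ 4 * A * (2 * R) ^ q := by positivity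
      nlinarith
    have h6 : ‖h 0‖ * (2 * R + ‖z‖) / (2 * R - ‖z‖) ≤ 3 * ‖h 0‖ := by
      rw [div_le_iff₀ h4]
      nlinarith [norm_nonneg (h 0)]
    rw [Real.mul_rpow (by norm_num) hR0.le] at h5 ⊢
    nlinarith [norm_nonneg (h 0)]
  set D := 4 * A * 2 ^ q + 3 * ‖h 0‖ with hD
  have hD0 : 0 ≤ D := by positivity
  have h2 : ∀ z, iteratedDeriv 2 h z = 0 := by
    intro z
    have hlim : Tendsto (fun R : ℝ => 2 * (D * 2 ^ q) * R ^ (q - 2)) atTop (𝓝 0) := by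
      have := (tendsto_rpow_neg_atTop (show 0 < 2 - q by linarith)).const_mul (2 * (D * 2 ^ q))
      simpa using this
    rw [← norm_le_zero_iff]
    refine ge_of_tendsto hlim ?_
    filter_upwards [eventually_ge_atTop (max 1 ‖z‖)] with R hR
    have hR1 : 1 ≤ R := (le_max_left _ _).trans hR
    have hRz : ‖z‖ ≤ R := (le_max_right _ _).trans hR
    have hR0 : 0 < R := by linarith
    have h3 := norm_iteratedDeriv_le_of_forall_mem_sphere_norm_le (f := h) (c := z)
      (C := D * (2 * R) ^ q) 2 hR0 hh.diffContOnCl (fun w hw => by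
        refine hnorm (2 * R) (by linarith) w ?_
        have : ‖w - z‖ = R := by simpa [dist_eq_norm] using hw
        calc ‖w‖ = ‖(w - z) + z‖ := by ring_nf
          _ ≤ ‖w - z‖ + ‖z‖ := norm_add_le _ _
          _ ≤ 2 * R := by linarith)
    refine h3.trans (le_of_eq ?_)
    rw [Real.mul_rpow (by norm_num) hR0.le, Real.rpow_sub hR0]
    simp
    ring
  have h3 : ∀ z, deriv h z = deriv h 0 := by
    intro z
    refine is_const_of_deriv_eq_zero (𝕜 := ℂ) hh.deriv (fun w => ?_) z 0
    have := h2 w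
    rwa [iteratedDeriv_succ, iteratedDeriv_one] at this
  refine ⟨h 0, deriv h 0, fun z => ?_⟩
  have h4 : ∀ z, h z - deriv h 0 * z = h 0 - deriv h 0 * 0 := by
    intro z
    refine is_const_of_deriv_eq_zero (𝕜 := ℂ) (f := fun z => h z - deriv h 0 * z)
      (by fun_prop) (fun w => ?_) z 0
    have := (hh w).hasDerivAt.sub ((hasDerivAt_id w).const_mul (deriv h 0))
    refine this.deriv.trans ?_
    rw [h3 w]; simp
  linear_combination h4 z

/-- Hadamard factorization of an even entire function of order less than `2`. -/
theorem eq_mul_tprod_of_even {ι : Type*} {l : ι → ℂ} {H : ℂ → ℂ} (hH : Differentiable ℂ H)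
    (heven : ∀ w, H (-w) = H w) {p C : ℝ} (hp : 0 < p) (hp1 : p < 1) (hC : 0 < C)
    (hgrowth : ∀ w, ‖H w‖ ≤ Real.exp (C * (1 + ‖w‖ ^ (2 * p))))
    (hl : Summable fun i => ‖l i‖⁻¹) (hlp : Summable fun i => ‖l i‖ ^ (-p)) (hl0 : ∀ i, l i ≠ 0)
    (hord : ∀ w, analyticOrderAt H w = {i | l i + w ^ 2 = 0}.ncard) (w : ℂ) :
    H w = H 0 * ∏' i, (1 + w ^ 2 / l i) := by
  set P : ℂ → ℂ := fun w => ∏' i, (1 + w ^ 2 / l i) with hP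
  have hPd : Differentiable ℂ P := (differentiable_tprod_one_add_div hl).comp (differentiable_pow 2)
  have hP0 : P 0 = 1 := by simp [hP]
  have hPord := analyticOrderAt_tprod_one_add_sq_div hl hl0
  obtain ⟨K, hK, hK0, hHK⟩ := exists_nonvanishing_quotient hH hPd
    (fun w => (hord w).trans (hPord w).symm) (fun w => by rw [hPord w]; exact ENat.natCast_ne_top _)
  obtain ⟨h, hh, hhK⟩ := exists_entire_log hK hK0
  set S := ∑' i, ‖l i‖ ^ (-p) with hS
  have hS0 : 0 ≤ S := tsum_nonneg fun i => by positivity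
  set E := C + p⁻¹ * S with hE
  have hE0 : 0 < E := by positivity
  have hre : ∀ z, (h z).re ≤ 6 * E * (2 * 4 ^ (2 * p)) * (1 + ‖z‖ ^ (2 * p)) := by
    intro z
    -- This radius satisfies |z| ≤ R/2, as the Poisson estimate requires, and is comparable to 1 +
    -- |z|.
    have hR : 0 < 2 * (‖z‖ + 1) := by positivity
    have h1 := re_le_of_exp_mul_eq (f := H) hPd hh hP0 (fun w => by rw [hHK, hhK]) hR
      (B := E * (1 + (2 * (‖z‖ + 1)) ^ (2 * p))) (by positivity)
      (fun w hw => (hgrowth w).trans (by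
        rw [hw]
        have : 0 ≤ p⁻¹ * S := by positivity
        gcongr; linarith))
      (fun w hw => (norm_tprod_one_add_div_le hl hp hp1.le hlp (w ^ 2)).trans (by
        rw [norm_pow, hw, ← Real.rpow_natCast (2 * (‖z‖ + 1)) 2, ← Real.rpow_mul (by positivity),
          Nat.cast_ofNat, ← hS]
        have h3 : 0 ≤ (2 * (‖z‖ + 1)) ^ (2 * p) := by positivity
        have h4 : 0 ≤ p⁻¹ * S := by positivity
        gcongr
        · linarith
        · linarith))
      (z := z) (by linarith)
    refine h1.trans ?_
    have h5 : (2 * (‖z‖ + 1)) ^ (2 * p) + 1 ≤ 2 * 4 ^ (2 * p) * (1 + ‖z‖ ^ (2 * p)) := by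
      have h7 : (1 : ℝ) ≤ 4 ^ (2 * p) := Real.one_le_rpow (by norm_num) (by positivity)
      have h8 : 0 ≤ ‖z‖ ^ (2 * p) := by positivity
      rcases le_total ‖z‖ 1 with hz | hz
      · have h6 : (2 * (‖z‖ + 1)) ^ (2 * p) ≤ 4 ^ (2 * p) :=
          Real.rpow_le_rpow (by positivity) (by linarith) (by positivity)
        nlinarith
      · have h6 : (2 * (‖z‖ + 1)) ^ (2 * p) ≤ (4 * ‖z‖) ^ (2 * p) :=
          Real.rpow_le_rpow (by positivity) (by linarith) (by positivity)
        rw [Real.mul_rpow (by norm_num) (norm_nonneg _)] at h6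
        nlinarith
    nlinarith
  obtain ⟨a, b, hab⟩ := eq_add_mul_of_re_le hh (by positivity) (by linarith) (by positivity) hre
  -- H and P are even, hence so is exp(a + bz) near 0, where P does not vanish; comparing
  -- derivatives at 0 gives b = -b.
  have hKe : ∀ z, K (-z) * P z = K z * P z := by
    intro z
    rw [← hHK, ← heven, hHK]; simp [hP]
  have hb : b = 0 := by
    have hev : (fun z => exp (b * z)) =ᶠ[𝓝 0] fun z => exp (-(b * z)) := by
      have : ∀ᶠ z in 𝓝 (0 : ℂ), P z ≠ 0 :=
        hPd.continuous.continuousAt.eventually_ne (by simp [hP0])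
      filter_upwards [this] with z hz
      have h1 := mul_right_cancel₀ hz (hKe z)
      rw [hhK, hhK, hab, hab, exp_add, exp_add] at h1
      have h2 := mul_left_cancel₀ (exp_ne_zero a) h1
      rw [← h2]; ring_nf
    have h1 := hev.deriv_eq
    have d1 : HasDerivAt (fun z => exp (b * z)) (exp (b * 0) * (b * 1)) 0 :=
      ((hasDerivAt_id (0 : ℂ)).const_mul b).cexp
    have d2 : HasDerivAt (fun z => exp (-(b * z))) (exp (-(b * 0)) * (-(b * 1))) 0 :=
      ((hasDerivAt_id (0 : ℂ)).const_mul b).neg.cexp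
    rw [d1.deriv, d2.deriv] at h1
    simp at h1
    linear_combination h1 / 2
  rw [hHK w, hHK 0, hhK w, hhK 0, hab w, hab 0, hb, hP0]
  simp [hP]

/-! ### The zeros of Ξ: multiplicities, counting, and the product formula -/

/-- Index set of the zeros, repeated according to multiplicity. -/
abbrev ZeroIndex : Type := Σ τ : tauSet, Fin (mult τ)

/-- The number `τ` of an index. -/
def tau (i : ZeroIndex) : ℂ := i.1

theorem tau_mem (i : ZeroIndex) : tau i ∈ tauSet := i.1.2

theorem tau_re_pos (i : ZeroIndex) : 0 < (tau i).re := (tau_mem i).1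

theorem half_add_I_mul_im (τ : ℂ) : (1 / 2 + I * τ).im = τ.re := by simp

theorem Xi_eq_zero_of_mem_tauSet {τ : ℂ} (h : τ ∈ tauSet) : Xi (1 / 2 + I * τ) = 0 := by
  have him : (1 / 2 + I * τ).im ≠ 0 := by rw [half_add_I_mul_im]; exact h.1.ne'
  exact (Xi_eq_zero_iff (fun h1 => him (by rw [h1, one_im])) (Or.inr him)).2 h.2

theorem abs_im_le_of_mem_tauSet {τ : ℂ} (h : τ ∈ tauSet) : |τ.im| ≤ 1 / 2 := by
  have h0 := Xi_eq_zero_of_mem_tauSet h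
  have hre : (1 / 2 + I * τ).re = 1 / 2 - τ.im := by simp; ring
  rw [abs_le]
  constructor
  · by_contra! hlt
    exact Xi_ne_zero_of_one_le_re (by rw [hre]; linarith) h0
  · by_contra! hlt
    exact Xi_ne_zero_of_re_nonpos (by rw [hre]; linarith) h0

theorem analyticOrderAt_Xi_half_add (w : ℂ) :
    analyticOrderAt (fun w => Xi (1 / 2 + w)) w = analyticOrderAt Xi (1 / 2 + w) := by
  have h1 : HasDerivAt (fun w : ℂ => 1 / 2 + w) 1 w := (hasDerivAt_id w).const_add _
  exact analyticOrderAt_comp_of_deriv_ne_zero (f := Xi) (g := fun w => 1 / 2 + w) (by fun_prop)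
    (by rw [h1.deriv]; exact one_ne_zero)

theorem analyticOrderAt_Xi_half_add_neg (w : ℂ) :
    analyticOrderAt (fun w => Xi (1 / 2 + w)) (-w) =
      analyticOrderAt (fun w => Xi (1 / 2 + w)) w := by
  have h1 : HasDerivAt (fun w : ℂ => -w) (-1) w := (hasDerivAt_id w).neg
  have h2 := analyticOrderAt_comp_of_deriv_ne_zero (f := fun w => Xi (1 / 2 + w)) (g := fun w => -w)
    (z₀ := w) (by fun_prop) (by rw [h1.deriv]; exact neg_ne_zero.2 one_ne_zero)
  rw [← h2]
  congr 1
  funext z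
  simp only [Function.comp_apply, ← sub_eq_add_neg, Xi_half_sub]

theorem cast_mult_eq {τ : ℂ} (h : τ.re ≠ 0) :
    (mult τ : ℕ∞) = analyticOrderAt (fun w => Xi (1 / 2 + w)) (I * τ) := by
  have him : (1 / 2 + I * τ).im ≠ 0 := by rwa [half_add_I_mul_im]
  have h1 := analyticOrderAt_Xi him
  rw [mult, Nat.cast_analyticOrderNatAt (by rw [← h1]; exact analyticOrderAt_Xi_ne_top _), ← h1,
    analyticOrderAt_Xi_half_add]

theorem ncard_setOf_tau_eq (τ : ℂ) (h : 0 < τ.re) : {i : ZeroIndex | tau i = τ}.ncard = mult τ := by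
  by_cases hτ : τ ∈ tauSet
  · have : {i : ZeroIndex | tau i = τ} =
        (fun k : Fin (mult τ) => (⟨⟨τ, hτ⟩, k⟩ : ZeroIndex)) '' univ := by
      ext ⟨⟨σ, hσ⟩, k⟩
      constructor
      · intro h
        have h' : σ = τ := h
        subst h'
        exact ⟨k, trivial, rfl⟩
      · rintro ⟨k', -, h⟩
        rw [← h]
        rfl
    rw [this, Set.ncard_image_of_injective _ (fun a b hab => by simpa using hab), Set.ncard_univ,
      Nat.card_eq_fintype_card, Fintype.card_fin]
  · have : {i : ZeroIndex | tau i = τ} = ∅ := by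
      ext i
      simp only [mem_ofPred_eq, mem_empty_iff_false, iff_false]
      intro h
      exact hτ (h ▸ tau_mem i)
    rw [this, Set.ncard_empty]
    have him : (1 / 2 + I * τ).im ≠ 0 := by rw [half_add_I_mul_im]; exact h.ne'
    have h0 : Xi (1 / 2 + I * τ) ≠ 0 := fun h0 =>
      hτ ⟨h, (Xi_eq_zero_iff (fun h1 => him (by rw [h1, one_im])) (Or.inr him)).1 h0⟩
    have h1 := cast_mult_eq h.ne'
    rw [analyticOrderAt_Xi_half_add, (analyticAt_Xi _).analyticOrderAt_eq_zero.2 h0] at h1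
    exact_mod_cast h1.symm

/-- If Im w > 0, then τ² = -w² together with Re τ > 0 selects τ = -iw. The lower half-plane follows
by evenness, and on the real axis both sides are 0. -/
theorem analyticOrderAt_Xi_half_add_eq_ncard (w : ℂ) :
    analyticOrderAt (fun w => Xi (1 / 2 + w)) w =
      {i : ZeroIndex | tau i ^ 2 + w ^ 2 = 0}.ncard := by
  have key : ∀ w : ℂ, 0 < w.im → analyticOrderAt (fun w => Xi (1 / 2 + w)) w =
      {i : ZeroIndex | tau i ^ 2 + w ^ 2 = 0}.ncard := by
    intro w hw
    have hre : (-I * w).re = w.im := by simp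
    have hset : {i : ZeroIndex | tau i ^ 2 + w ^ 2 = 0} = {i | tau i = -I * w} := by
      ext i
      simp only [mem_ofPred_eq]
      constructor
      · intro h
        have h1 : (tau i - -I * w) * (tau i - I * w) = 0 := by
          linear_combination h - w ^ 2 * I_sq
        rcases mul_eq_zero.1 h1 with h2 | h2
        · exact sub_eq_zero.1 h2
        · have h3 := tau_re_pos i
          rw [sub_eq_zero.1 h2] at h3
          simp at h3
          linarith
      · intro h
        rw [h]
        linear_combination w ^ 2 * I_sq
    rw [hset, ncard_setOf_tau_eq _ (by rw [hre]; exact hw),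
        cast_mult_eq (by rw [hre]; exact hw.ne')]
    congr 1
    linear_combination w * I_sq
  rcases lt_trichotomy w.im 0 with h | h | h
  · have := key (-w) (by simpa using h)
    rwa [analyticOrderAt_Xi_half_add_neg, neg_sq] at this
  · have h1 : Xi (1 / 2 + w) ≠ 0 := Xi_ne_zero_of_im_eq_zero (by simpa using h)
    rw [analyticOrderAt_Xi_half_add, (analyticAt_Xi _).analyticOrderAt_eq_zero.2 h1]
    have : {i : ZeroIndex | tau i ^ 2 + w ^ 2 = 0} = ∅ := by
      ext i
      simp only [mem_ofPred_eq, mem_empty_iff_false, iff_false]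
      intro h2
      have h3 : (tau i - -I * w) * (tau i - I * w) = 0 := by
        linear_combination h2 - w ^ 2 * I_sq
      have h4 := tau_re_pos i
      rcases mul_eq_zero.1 h3 with h5 | h5 <;> rw [sub_eq_zero.1 h5] at h4 <;> simp [h] at h4
    simp [this]
  · exact key w h

theorem summable_rpow_neg_of_card_le {ι : Type*} {t : ι → ℝ} (ht : ∀ i, 1 ≤ t i) {K β c : ℝ}
    (hβ : 0 ≤ β) (hβc : β < c) (hK : ∀ r : ℝ, 1 ≤ r → ∀ S : Finset ι, (∀ i ∈ S, t i ≤ r) →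
      (S.card : ℝ) ≤ K * r ^ β) : Summable fun i => t i ^ (-c) := by
  classical
  have hK0 : 0 ≤ K := by simpa using hK 1 le_rfl ∅ (by simp)
  -- Dyadic blocks 2^m ≤ t ≤ 2^(m+1): each has at most K 2^((m+1)β) members, and the block sums are
  -- dominated by a geometric series of ratio 2^(β-c).
  set m : ι → ℕ := fun i => Nat.log 2 ⌊t i⌋₊ with hm
  have hm1 : ∀ i, (2 : ℝ) ^ m i ≤ t i := by
    intro i
    have h1 : 1 ≤ ⌊t i⌋₊ := Nat.le_floor (by simpa using ht i)
    have h2 : 2 ^ m i ≤ ⌊t i⌋₊ := Nat.pow_log_le_self 2 (by omega)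
    calc (2 : ℝ) ^ m i ≤ (⌊t i⌋₊ : ℝ) := by exact_mod_cast h2
      _ ≤ t i := Nat.floor_le (by linarith [ht i])
  have hm2 : ∀ i, t i ≤ 2 ^ (m i + 1) := by
    intro i
    have h2 : ⌊t i⌋₊ < 2 ^ (m i + 1) := Nat.lt_pow_succ_log_self (by norm_num) _
    have := (Nat.floor_lt (by linarith [ht i])).1 h2
    exact_mod_cast this.le
  have hgeo : Summable fun n : ℕ => K * 2 ^ β * ((2 : ℝ) ^ (β - c)) ^ n := by
    refine Summable.mul_left _ (summable_geometric_of_lt_one (by positivity) ?_)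
    exact Real.rpow_lt_one_of_one_lt_of_neg (by norm_num) (by linarith)
  refine summable_of_sum_le (c := ∑' n : ℕ, K * 2 ^ β * ((2 : ℝ) ^ (β - c)) ^ n)
    (fun i => Real.rpow_nonneg (by linarith [ht i]) _) fun S => ?_
  rw [← Finset.sum_fiberwise_of_maps_to (g := m) (t := S.image m)
    (fun i hi => Finset.mem_image_of_mem _ hi)]
  refine (Finset.sum_le_sum fun n _ => ?_).trans
    (hgeo.sum_le_tsum (S.image m) fun n _ => by positivity)
  have h1 : ∀ i ∈ S.filter (fun i => m i = n), t i ^ (-c) ≤ ((2 : ℝ) ^ n) ^ (-c) := by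
    intro i hi
    rw [← (Finset.mem_filter.1 hi).2]
    exact Real.rpow_le_rpow_of_nonpos (by positivity) (hm1 i) (by linarith)
  refine (Finset.sum_le_card_nsmul _ _ _ h1).trans ?_
  rw [nsmul_eq_mul]
  have h2 := hK (2 ^ (n + 1)) (one_le_pow₀ (by norm_num)) (S.filter (fun i => m i = n))
    (fun i hi => by rw [← (Finset.mem_filter.1 hi).2]; exact hm2 i)
  calc _ ≤ K * (2 ^ (n + 1)) ^ β * ((2 : ℝ) ^ n) ^ (-c) := by gcongr
    _ = K * 2 ^ β * ((2 : ℝ) ^ (β - c)) ^ n := by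
      rw [← Real.rpow_natCast, ← Real.rpow_natCast, ← Real.rpow_natCast,
          ← Real.rpow_mul (by norm_num),
        ← Real.rpow_mul (by norm_num), ← Real.rpow_mul (by norm_num), mul_assoc, mul_assoc,
        ← Real.rpow_add (by norm_num), ← Real.rpow_add (by norm_num)]
      congr 2
      push_cast
      ring

theorem exists_card_le {β : ℝ} (hβ : 1 < β) : ∃ K : ℝ, ∀ r : ℝ, 1 ≤ r → ∀ S : Finset ZeroIndex,
    (∀ i ∈ S, 1 + ‖tau i‖ ≤ r) → (S.card : ℝ) ≤ K * r ^ β := by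
  classical
  obtain ⟨C, hC, hg⟩ := exists_norm_Xi_le hβ
  set H : ℂ → ℂ := fun w => Xi (1 / 2 + w) with hH
  have hHd : Differentiable ℂ H := differentiable_Xi.comp (by fun_prop)
  have hH0 : H 0 ≠ 0 := Xi_ne_zero_of_im_eq_zero (by simp)
  refine ⟨(C * (1 + 2 ^ β) + |Real.log ‖H 0‖|) / Real.log 2, fun r hr S hS => ?_⟩
  have hr0 : 0 < r := by linarith
  have hlog2 := Real.log_pos one_lt_two
  have hA : AnalyticOnNhd ℂ H (Metric.closedBall 0 |r|) := fun w _ => hHd.analyticAt w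
  set D := MeromorphicOn.divisor H (Metric.closedBall 0 |r|) with hD
  -- Jensen's inequality with radii r and 2r: each zero within r costs at least log 2 of the growth
  -- on the larger circle.
  have hjen := AnalyticOnNhd.sum_divisor_le (c := 0) (r := r) (R := 2 * r)
    (M := Real.exp (C * (1 + (2 * r) ^ β))) (f := H) (abs_pos.2 hr0.ne')
    (by rw [abs_of_pos hr0, abs_of_pos (by linarith)]; linarith) (Real.one_le_exp (by positivity))
    (fun w _ => hHd.analyticAt w) hH0 (fun z hz => by
      have hz' : ‖z‖ = 2 * r := by simpa [abs_of_pos hr0] using hz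
      have := hg z
      rwa [hz'] at this)
  have hDapp : ∀ i ∈ S, D (I * tau i) = mult (tau i) := by
    intro i hi
    have hmem : I * tau i ∈ Metric.closedBall (0 : ℂ) |r| := by
      simp [abs_of_pos hr0]
      linarith [hS i hi]
    rw [hD, MeromorphicOn.AnalyticOnNhd.divisor_apply hA hmem, hH,
        ← cast_mult_eq (tau_re_pos i).ne']
    simp
  have hcard : (S.card : ℤ) ≤ ∑ᶠ u, D u := by
    have hfin : (Function.support D).Finite := D.finiteSupport (isCompact_closedBall _ _)
    have hnn : 0 ≤ D := MeromorphicOn.AnalyticOnNhd.divisor_nonneg hA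
    set T := S.image (fun i => I * tau i) with hT
    rw [finsum_eq_sum_of_support_subset (s := hfin.toFinset ∪ T) _ (by simp)]
    refine le_trans ?_ (Finset.sum_le_sum_of_subset_of_nonneg Finset.subset_union_right
      (fun u _ _ => hnn u))
    rw [Finset.card_eq_sum_card_image (fun i => I * tau i) S, Nat.cast_sum]
    refine Finset.sum_le_sum fun u hu => ?_
    obtain ⟨j, hj, rfl⟩ := Finset.mem_image.1 hu
    rw [hDapp j hj, ← ncard_setOf_tau_eq _ (tau_re_pos j)]
    have hfin' : {i : ZeroIndex | tau i = tau j}.Finite := by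
      refine Set.finite_of_ncard_ne_zero ?_
      rw [ncard_setOf_tau_eq _ (tau_re_pos j)]
      exact (lt_of_le_of_lt (Nat.zero_le _) j.2.2).ne'
    rw [← Set.ncard_coe_finset]
    refine Nat.cast_le.2 (Set.ncard_le_ncard (fun i hi => ?_) hfin')
    have := (Finset.mem_filter.1 (Finset.mem_coe.1 hi)).2
    exact mul_left_cancel₀ I_ne_zero this
  have hcard' : (S.card : ℝ) ≤ ((∑ᶠ u, D u : ℤ) : ℝ) := by exact_mod_cast hcard
  refine hcard'.trans (hjen.trans ?_)
  have h2 : 2 * r / r = 2 := by field_simp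
  rw [h2, Real.log_div (Real.exp_pos _).ne' (norm_ne_zero_iff.2 hH0), Real.log_exp,
      div_mul_eq_mul_div]
  gcongr
  have h3 : 1 ≤ r ^ β := Real.one_le_rpow hr (by linarith)
  have h4 := neg_abs_le (Real.log ‖H 0‖)
  rw [Real.mul_rpow (by norm_num) hr0.le]
  have h5 : 0 ≤ |Real.log ‖H 0‖| := abs_nonneg _
  nlinarith

theorem summable_one_add_norm_tau_rpow {c : ℝ} (hc : 1 < c) :
    Summable fun i => (1 + ‖tau i‖) ^ (-c) := by
  -- Any exponent strictly between 1 and c serves.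
  obtain ⟨K, hK⟩ := exists_card_le (β := (1 + c) / 2) (by linarith)
  exact summable_rpow_neg_of_card_le (fun i => by linarith [norm_nonneg (tau i)])
    (by linarith) (by linarith) hK

theorem tendsto_norm_tau : Tendsto (fun i => ‖tau i‖) cofinite atTop := by
  have h1 := (summable_one_add_norm_tau_rpow one_lt_two).tendsto_cofinite_zero
  refine tendsto_atTop.2 fun r => ?_
  have hr : 0 < (1 + max r 0) ^ (-2 : ℝ) := Real.rpow_pos_of_pos (by positivity) _
  filter_upwards [h1.eventually_lt_const hr] with i hi
  by_contra! hlt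
  have : (1 + max r 0) ^ (-2 : ℝ) ≤ (1 + ‖tau i‖) ^ (-2 : ℝ) :=
    Real.rpow_le_rpow_of_nonpos (by positivity) (by gcongr; exact hlt.le.trans (le_max_left _ _))
      (by norm_num)
  linarith

theorem eventually_norm_tau_sq_add_ge (v : ℝ) :
    ∀ᶠ i in cofinite, (1 + ‖tau i‖) ^ 2 / 8 ≤ ‖tau i ^ 2 + (v : ℂ)‖ := by
  filter_upwards [tendsto_norm_tau.eventually_ge_atTop (1 + 2 * |v|)] with i hi
  have h1 : ‖tau i‖ ^ 2 - |v| ≤ ‖tau i ^ 2 + (v : ℂ)‖ := by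
    have := norm_sub_norm_le (tau i ^ 2) (-(v : ℂ))
    rwa [sub_neg_eq_add, norm_neg, norm_pow, norm_real, Real.norm_eq_abs] at this
  nlinarith [abs_nonneg v]

theorem summable_norm_tau_sq_add_rpow (v : ℝ) {q : ℝ} (hq : 1 / 2 < q) :
    Summable fun i => ‖tau i ^ 2 + (v : ℂ)‖ ^ (-q) := by
  refine Summable.of_norm_bounded_eventually
    ((summable_one_add_norm_tau_rpow (c := 2 * q) (by linarith)).mul_left ((1 / 8) ^ (-q))) ?_
  filter_upwards [eventually_norm_tau_sq_add_ge v] with i hi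
  rw [Real.norm_of_nonneg (by positivity)]
  refine (Real.rpow_le_rpow_of_nonpos (by positivity) hi (by linarith)).trans (le_of_eq ?_)
  rw [div_eq_mul_one_div, mul_comm, Real.mul_rpow (by norm_num) (by positivity),
    ← Real.rpow_natCast, ← Real.rpow_mul (by positivity)]
  congr 2
  push_cast
  ring

theorem summable_norm_tau_sq_add_inv (v : ℝ) : Summable fun i => ‖tau i ^ 2 + (v : ℂ)‖⁻¹ := by
  simpa [Real.rpow_neg_one] using summable_norm_tau_sq_add_rpow v (q := 1) (by norm_num)

/-- The product formula for `Ξ` over its zeros. -/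
theorem Xi_half_add_eq_tprod (w : ℂ) :
    Xi (1 / 2 + w) = Xi (1 / 2) * ∏' i, (1 + w ^ 2 / tau i ^ 2) := by
  -- Any p in (1/2, 1) serves: p > 1/2 for the growth bound and the sum of |τ²|^(-p), p < 1 for
  -- Hadamard's theorem.
  obtain ⟨C, hC, hg⟩ := exists_norm_Xi_le (β := 2 * (3 / 4)) (by norm_num)
  have h := eq_mul_tprod_of_even (l := fun i => tau i ^ 2) (H := fun w => Xi (1 / 2 + w))
    (differentiable_Xi.comp (by fun_prop)) (fun w => by rw [← sub_eq_add_neg, Xi_half_sub])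
    (p := 3 / 4) (by norm_num) (by norm_num) hC hg
    (by simpa using summable_norm_tau_sq_add_inv 0)
    (by simpa using summable_norm_tau_sq_add_rpow 0 (q := 3 / 4) (by norm_num))
    (fun i => pow_ne_zero 2 fun h => by simpa [h] using tau_re_pos i)
    analyticOrderAt_Xi_half_add_eq_ncard w
  simpa using h

/-! ### The Mellin transform of log(1 + t/l) -/

/-- A non-real τ has Im τ² = 2 Re τ Im τ ≠ 0; for a real τ the bound on v makes τ² + v positive. -/
theorem Admissible.mem_slitPlane {v : ℝ} (hv : Admissible v) {τ : ℂ} (hτ : τ ∈ tauSet) :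
    τ ^ 2 + (v : ℂ) ∈ slitPlane := by
  rw [mem_slitPlane_iff]
  have h1 := hτ.1
  have h2 := hv τ hτ
  by_cases h : τ.im = 0
  · left
    simp [sq, h]
    nlinarith
  · right
    simp [sq]
    intro h3
    have : τ.re * τ.im = 0 := by linarith
    rcases mul_eq_zero.1 this with h4 | h4
    · exact h1.ne' h4
    · exact h h4

theorem admissible_of_nonneg {v : ℝ} (hv : 0 ≤ v) : Admissible v := fun τ hτ => by
  have := hτ.1
  nlinarith

theorem one_add_ofReal_div_mem_slitPlane {l : ℂ} (hl : l ∈ slitPlane) {z : ℝ} (hz : 0 ≤ z) :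
    1 + (z : ℂ) / l ∈ slitPlane := by
  rcases hz.eq_or_lt with rfl | hz
  · simp
  have h0 : 0 < normSq l := normSq_pos.2 (slitPlane_ne_zero hl)
  rw [mem_slitPlane_iff] at hl ⊢
  rw [div_eq_mul_inv, add_re, add_im, re_ofReal_mul, im_ofReal_mul, inv_re, inv_im, one_re, one_im]
  rcases hl with h | h
  · left
    positivity
  · right
    rw [zero_add]
    exact mul_ne_zero hz.ne' (div_ne_zero (neg_ne_zero.2 h) h0.ne')

theorem add_ofReal_ne_zero {l : ℂ} (hl : l ∈ slitPlane) {z : ℝ} (hz : 0 ≤ z) : l + z ≠ 0 := by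
  have h := slitPlane_ne_zero (one_add_ofReal_div_mem_slitPlane hl hz)
  have h0 := slitPlane_ne_zero hl
  intro h1
  apply h
  rw [one_add_div h0, h1, zero_div]

/-- A lower bound for `‖l + x‖` in a sector avoiding the negative axis. -/
theorem norm_add_ofReal_ge {l : ℂ} {c x : ℝ} (hc : 0 ≤ c) (hc1 : c < 1) (hl : -(c * ‖l‖) ≤ l.re)
    (hx : 0 ≤ x) : √((1 - c) / 2) * (‖l‖ + x) ≤ ‖l + x‖ := by
  refine abs_le_of_sq_le_sq' ?_ (norm_nonneg _) |>.2
  rw [mul_pow, Real.sq_sqrt (by linarith)]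
  have h1 : ‖l + x‖ ^ 2 = ‖l‖ ^ 2 + 2 * x * l.re + x ^ 2 := by
    rw [← normSq_eq_norm_sq, ← normSq_eq_norm_sq, normSq_apply, normSq_apply]
    simp
    ring
  rw [h1]
  have h2 := mul_le_mul_of_nonneg_left hl hx
  nlinarith [mul_nonneg hc (sq_nonneg (‖l‖ - x)), mul_nonneg (sub_nonneg.2 hc1.le)
    (sq_nonneg (‖l‖ - x))]

/-- The inequality is strict so that the same c serves for all nearby l. -/
theorem exists_neg_mul_norm_lt_re {l : ℂ} (hl : l ∈ slitPlane) :
    ∃ c : ℝ, 0 ≤ c ∧ c < 1 ∧ -(c * ‖l‖) < l.re := by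
  have h0 : 0 < ‖l‖ := norm_pos_iff.2 (slitPlane_ne_zero hl)
  have h1 : -‖l‖ < l.re := by
    have h2 := (abs_le.1 (abs_re_le_norm l)).1
    refine lt_of_le_of_ne h2 fun h3 => ?_
    have h4 : l.re ≤ 0 := by linarith
    have h5 : l.im = 0 := by
      rw [← abs_re_eq_norm, ← h3, abs_neg, abs_norm]
    rcases mem_slitPlane_iff.1 hl with h | h
    · linarith
    · exact h h5
  refine ⟨max 0 ((1 - l.re / ‖l‖) / 2), le_max_left _ _, max_lt one_pos ?_, ?_⟩
  · have : -1 < l.re / ‖l‖ := by rw [lt_div_iff₀ h0]; linarith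
    linarith
  · have h2 := le_max_right 0 ((1 - l.re / ‖l‖) / 2)
    have h3 : (1 - l.re / ‖l‖) / 2 * ‖l‖ = (‖l‖ - l.re) / 2 := by field_simp
    nlinarith

theorem hasDerivAt_log_one_add_div {l : ℂ} (hl : l ∈ slitPlane) {z : ℝ} (hz : 0 ≤ z) :
    HasDerivAt (fun t : ℝ => log (1 + (t : ℂ) / l)) (l + z)⁻¹ z := by
  have h1 := (((hasDerivAt_id (z : ℂ)).div_const l).const_add 1).clog
    (one_add_ofReal_div_mem_slitPlane hl hz)
  have h2 := h1.comp_ofReal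
  refine h2.congr_deriv ?_
  have h0 := slitPlane_ne_zero hl
  have h3 := add_ofReal_ne_zero hl hz
  have h4 := slitPlane_ne_zero (one_add_ofReal_div_mem_slitPlane hl hz)
  simp only [id]
  field_simp

/-- Both sides vanish at z = 0, and the sector inequality compares the derivatives 1/(l+x) and
κ⁻¹/(‖l‖+x). The bound depends on z/‖l‖ only, so its Mellin integral scales as a power of ‖l‖. -/
theorem norm_log_one_add_div_le {l : ℂ} (hl : l ∈ slitPlane) {κ : ℝ} (hκ : 0 < κ)
    (h : ∀ x : ℝ, 0 ≤ x → κ * (‖l‖ + x) ≤ ‖l + x‖) {z : ℝ} (hz : 0 ≤ z) :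
    ‖log (1 + (z : ℂ) / l)‖ ≤ κ⁻¹ * Real.log (1 + z / ‖l‖) := by
  have h0 : 0 < ‖l‖ := norm_pos_iff.2 (slitPlane_ne_zero hl)
  have hB : ∀ x : ℝ, 0 ≤ x → HasDerivAt (fun x => κ⁻¹ * Real.log (1 + x / ‖l‖))
      (κ⁻¹ * (‖l‖ + x)⁻¹) x := by
    intro x hx
    refine (((((hasDerivAt_id x).div_const ‖l‖).const_add 1).log
      (by simp only [id]; positivity)).const_mul
      κ⁻¹).congr_deriv ?_
    simp only [id]
    field_simp
  refine image_norm_le_of_norm_deriv_right_le_deriv_boundary' (a := 0) (b := z)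
    (f := fun t : ℝ => log (1 + (t : ℂ) / l)) (f' := fun x => (l + x)⁻¹)
    (B' := fun x => κ⁻¹ * (‖l‖ + x)⁻¹)
    (fun x hx => (hasDerivAt_log_one_add_div hl hx.1).continuousAt.continuousWithinAt)
    (fun x hx => (hasDerivAt_log_one_add_div hl hx.1).hasDerivWithinAt) (by simp)
    (fun x hx => (hB x hx.1).continuousAt.continuousWithinAt)
    (fun x hx => (hB x hx.1).hasDerivWithinAt) (fun x hx => ?_) ⟨hz, le_rfl⟩
  have hx0 : 0 ≤ x := hx.1
  rw [norm_inv, ← mul_inv]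
  exact inv_anti₀ (by positivity) (h x hx0)

theorem log_one_add_le_rpow {x p : ℝ} (hx : 0 ≤ x) (hp : 0 < p) (hp1 : p ≤ 1) :
    Real.log (1 + x) ≤ p⁻¹ * x ^ p := by
  rw [Real.log_le_iff_le_exp (by positivity)]
  exact one_add_le_exp_rpow hx hp hp1

theorem norm_log_one_add_div_le_rpow {l : ℂ} (hl : l ∈ slitPlane) {κ : ℝ} (hκ : 0 < κ)
    (h : ∀ x : ℝ, 0 ≤ x → κ * (‖l‖ + x) ≤ ‖l + x‖) {z p : ℝ} (hz : 0 ≤ z) (hp : 0 < p)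
    (hp1 : p ≤ 1) : ‖log (1 + (z : ℂ) / l)‖ ≤ κ⁻¹ * p⁻¹ * ‖l‖ ^ (-p) * z ^ p := by
  refine (norm_log_one_add_div_le hl hκ h hz).trans ?_
  have h1 := log_one_add_le_rpow (x := z / ‖l‖) (by positivity) hp hp1
  rw [Real.div_rpow hz (norm_nonneg _), div_eq_mul_inv (z ^ p),
      ← Real.rpow_neg (norm_nonneg _)] at h1
  calc _ ≤ κ⁻¹ * (p⁻¹ * (z ^ p * ‖l‖ ^ (-p))) := by gcongr
    _ = _ := by ring

theorem exists_sector_const {l : ℂ} (hl : l ∈ slitPlane) :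
    ∃ κ : ℝ, 0 < κ ∧ ∀ x : ℝ, 0 ≤ x → κ * (‖l‖ + x) ≤ ‖l + x‖ := by
  obtain ⟨c, hc, hc1, h⟩ := exists_neg_mul_norm_lt_re hl
  exact ⟨√((1 - c) / 2), Real.sqrt_pos.2 (by linarith), fun x hx =>
    norm_add_ofReal_ge hc hc1 h.le hx⟩

/-- A function bounded by multiples of `z` and of small powers of `z` has a Mellin transform in the
strip `-1 < Re s < 0`. -/
theorem mellinConvergent_of_norm_le_rpow {f : ℝ → ℂ} (hf : ContinuousOn f (Ioi 0))
    {p q : ℝ} {A B : ℝ} (hA : ∀ z : ℝ, 0 < z → ‖f z‖ ≤ A * z ^ p)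
    (hB : ∀ z : ℝ, 0 < z → ‖f z‖ ≤ B * z ^ q) {s : ℂ} (hp : s.re < -p) (hq : -q < s.re) :
    MellinConvergent f s := by
  refine mellinConvergent_of_isBigO_rpow (a := -p) (b := -q)
    (hf.locallyIntegrableOn measurableSet_Ioi) ?_ hp ?_ hq
  · refine Asymptotics.IsBigO.of_bound A ?_
    filter_upwards [eventually_gt_atTop 0] with z hz
    rw [neg_neg, Real.norm_of_nonneg (r := z ^ p) (by positivity)]
    exact hA z hz
  · refine Asymptotics.IsBigO.of_bound B ?_
    filter_upwards [self_mem_nhdsWithin] with z hz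
    have hz : 0 < z := hz
    rw [neg_neg, Real.norm_of_nonneg (r := z ^ q) (by positivity)]
    exact hB z hz

theorem continuousOn_log_one_add_div {l : ℂ} (hl : l ∈ slitPlane) :
    ContinuousOn (fun t : ℝ => log (1 + (t : ℂ) / l)) (Ioi 0) := fun _ ht =>
  (hasDerivAt_log_one_add_div hl (le_of_lt ht)).continuousAt.continuousWithinAt

theorem mellinConvergent_log_one_add_div {l : ℂ} (hl : l ∈ slitPlane) {σ : ℂ} (h0 : 0 < σ.re)
    (h1 : σ.re < 1) : MellinConvergent (fun t : ℝ => log (1 + (t : ℂ) / l)) (-σ) := by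
  obtain ⟨κ, hκ, h⟩ := exists_sector_const hl
  exact mellinConvergent_of_norm_le_rpow (continuousOn_log_one_add_div hl) (p := σ.re / 2) (q := 1)
    (fun z hz => norm_log_one_add_div_le_rpow hl hκ h hz.le (by linarith) (by linarith))
    (fun z hz => norm_log_one_add_div_le_rpow hl hκ h hz.le one_pos le_rfl)
    (by simp; linarith) (by simp; linarith)

theorem hasDerivAt_mellin_log_one_add_div {l₀ : ℂ} (hl : l₀ ∈ slitPlane) {σ : ℂ} (h0 : 0 < σ.re)
    (h1 : σ.re < 1) : HasDerivAt (fun l => mellin (fun t : ℝ => log (1 + (t : ℂ) / l)) (-σ))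
      (∫ t : ℝ in Ioi 0, (t : ℂ) ^ (-σ - 1) • (-(t : ℂ) / (l₀ * (l₀ + t)))) l₀ := by
  obtain ⟨c, hc, hc1, h⟩ := exists_neg_mul_norm_lt_re hl
  set κ := √((1 - c) / 2) with hκ
  have hκ0 : 0 < κ := Real.sqrt_pos.2 (by linarith)
  set m := ‖l₀‖ / 2 with hm
  have hm0 : 0 < m := half_pos (norm_pos_iff.2 (slitPlane_ne_zero hl))
  -- On this neighbourhood of l₀ both the sector constant and the lower bound for |l| are uniform,
  -- which gives one dominating function for the derivatives.
  set S : Set ℂ := slitPlane ∩ ({l | -(c * ‖l‖) < l.re} ∩ {l | m < ‖l‖}) with hS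
  have hSo : S ∈ 𝓝 l₀ := by
    refine inter_mem (isOpen_slitPlane.mem_nhds hl) (inter_mem ?_ ?_)
    · exact (isOpen_lt (by fun_prop) continuous_re).mem_nhds h
    · exact (isOpen_lt continuous_const continuous_norm).mem_nhds
        (show ‖l₀‖ / 2 < ‖l₀‖ by linarith)
  have hpow : ContinuousOn (fun t : ℝ => (t : ℂ) ^ (-σ - 1)) (Ioi 0) := fun t ht =>
    (continuousAt_ofReal_cpow_const _ _ (Or.inr (ne_of_gt ht))).continuousWithinAt
  have hmeas : ∀ l ∈ slitPlane, AEStronglyMeasurable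
      (fun t : ℝ => (t : ℂ) ^ (-σ - 1) • log (1 + (t : ℂ) / l)) (volume.restrict (Ioi 0)) :=
    fun l hl => (hpow.smul (continuousOn_log_one_add_div hl)).aestronglyMeasurable
      measurableSet_Ioi
  refine (hasDerivAt_integral_of_dominated_loc_of_deriv_le (s := S)
    (bound := fun t : ℝ => t ^ ((1 - σ.re) - 1) * ((m * κ)⁻¹ * (m + t)⁻¹))
    (F := fun l t => (t : ℂ) ^ (-σ - 1) • log (1 + (t : ℂ) / l))
    (F' := fun l t => (t : ℂ) ^ (-σ - 1) • (-(t : ℂ) / (l * (l + t)))) hSo ?_ ?_ ?_ ?_ ?_ ?_).2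
  · filter_upwards [hSo] with l hlS
    exact hmeas l hlS.1
  · exact mellinConvergent_log_one_add_div hl h0 h1
  · refine ContinuousOn.aestronglyMeasurable (hpow.smul (ContinuousOn.div (by fun_prop)
      (by fun_prop) fun t ht => ?_)) measurableSet_Ioi
    exact mul_ne_zero (slitPlane_ne_zero hl) (add_ofReal_ne_zero hl (le_of_lt ht))
  · refine (ae_restrict_iff' measurableSet_Ioi).2 (Eventually.of_forall fun t ht l hlS => ?_)
    have ht : 0 < t := ht
    have g1 : κ * (m + t) ≤ ‖l + t‖ := by
      refine le_trans ?_ (norm_add_ofReal_ge hc hc1 (le_of_lt hlS.2.1) ht.le)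
      have : m < ‖l‖ := hlS.2.2
      gcongr
    have g2 : m ≤ ‖l‖ := le_of_lt hlS.2.2
    rw [norm_smul, norm_cpow_eq_rpow_re_of_pos ht, norm_div, norm_neg, norm_mul, norm_real,
      Real.norm_of_nonneg ht.le, sub_re, neg_re, one_re]
    have e : t ^ (-σ.re - 1) * t = t ^ ((1 - σ.re) - 1) := by
      rw [← Real.rpow_add_one ht.ne']; congr 1; ring
    rw [← mul_div_assoc, e, div_eq_mul_inv]
    gcongr
    rw [← mul_inv]
    refine inv_anti₀ (by positivity) ?_
    calc m * κ * (m + t) = m * (κ * (m + t)) := by ring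
      _ ≤ ‖l‖ * ‖l + t‖ := by gcongr
  · have hcont : ContinuousOn (fun t : ℝ => (m * κ)⁻¹ * (m + t)⁻¹) (Ioi 0) :=
      continuousOn_const.mul (ContinuousOn.inv₀ (by fun_prop) fun t ht => by
        have : 0 < t := ht
        positivity)
    refine mellin_convergent_of_isBigO_scalar (a := 1) (b := 0)
      (hcont.locallyIntegrableOn measurableSet_Ioi) ?_ (by linarith) ?_ (by linarith)
    · refine Asymptotics.IsBigO.of_bound ((m * κ)⁻¹) ?_
      filter_upwards [eventually_gt_atTop 0] with t ht
      rw [Real.rpow_neg_one, Real.norm_of_nonneg (by positivity),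
          Real.norm_of_nonneg (by positivity)]
      gcongr
      linarith
    · refine Asymptotics.IsBigO.of_bound ((m * κ)⁻¹ * m⁻¹) ?_
      filter_upwards [self_mem_nhdsWithin] with t ht
      have ht : 0 < t := ht
      rw [neg_zero, Real.rpow_zero, norm_one, mul_one, Real.norm_of_nonneg (by positivity)]
      gcongr
      linarith
  · refine (ae_restrict_iff' measurableSet_Ioi).2 (Eventually.of_forall fun t ht l hlS => ?_)
    have ht : 0 < t := ht
    have hl0 := slitPlane_ne_zero hlS.1
    have g1 := ((hasDerivAt_inv hl0).const_mul (t : ℂ)).const_add 1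
    have g2 := one_add_ofReal_div_mem_slitPlane hlS.1 ht.le
    have g3 := g1.clog (by rw [← div_eq_mul_inv]; exact g2)
    have g4 := add_ofReal_ne_zero hlS.1 ht.le
    have g5 := slitPlane_ne_zero g2
    refine ((g3.const_mul ((t : ℂ) ^ (-σ - 1))).congr_deriv ?_).congr_of_eventuallyEq
      (Eventually.of_forall fun l => by simp [div_eq_mul_inv])
    rw [smul_eq_mul]
    congr 1
    field_simp

/-- The substitution x = t/(1+t) turns the beta integral B(1-σ, σ) into this one, and the reflection
formula evaluates it. -/
theorem mellin_inv_one_add {σ : ℂ} (h0 : 0 < σ.re) (h1 : σ.re < 1) :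
    ∫ t : ℝ in Ioi 0, (t : ℂ) ^ (-σ - 1) • ((t : ℂ) / (1 * (1 + t))) =
      Real.pi / sin (Real.pi * σ) := by
  have hbeta := Gamma_mul_Gamma_eq_betaIntegral (s := 1 - σ) (t := σ) (by simp; linarith) h0
  rw [sub_add_cancel, Complex.Gamma_one, one_mul, mul_comm, Gamma_mul_Gamma_one_sub] at hbeta
  rw [hbeta, betaIntegral, intervalIntegral.integral_of_le zero_le_one,
      integral_Ioc_eq_integral_Ioo]
  have himg : (fun t : ℝ => t / (1 + t)) '' Ioi 0 = Ioo 0 1 := by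
    ext x
    constructor
    · rintro ⟨t, ht, rfl⟩
      have ht : 0 < t := ht
      refine ⟨by positivity, ?_⟩
      simp only
      rw [div_lt_one (by positivity)]
      linarith
    · rintro ⟨hx0, hx1⟩
      have : 0 < 1 - x := by linarith
      refine ⟨x / (1 - x), div_pos hx0 this, ?_⟩
      field_simp
      ring
  have hder : ∀ t ∈ Ioi (0 : ℝ), HasDerivWithinAt (fun t : ℝ => t / (1 + t)) ((1 + t)⁻¹ ^ 2)
      (Ioi 0) t := by
    intro t ht
    have ht : 0 < t := ht
    refine (((hasDerivAt_id t).div ((hasDerivAt_id t).const_add 1) (by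
      simp only [id]; positivity)).congr_deriv ?_).hasDerivWithinAt
    simp only [id]
    field_simp
    ring
  have hinj : InjOn (fun t : ℝ => t / (1 + t)) (Ioi 0) := by
    intro a ha b hb hab
    have ha : 0 < a := ha
    have hb : 0 < b := hb
    simp only at hab
    field_simp at hab
    linarith
  rw [← himg, integral_image_eq_integral_abs_deriv_smul measurableSet_Ioi hder hinj]
  refine setIntegral_congr_fun measurableSet_Ioi fun t ht => ?_
  have ht : 0 < t := ht
  have h1t : 0 < 1 + t := by linarith
  have e1 : (1 : ℂ) - ((t / (1 + t) : ℝ) : ℂ) = (((1 + t)⁻¹ : ℝ) : ℂ) := by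
    rw [← ofReal_one, ← ofReal_sub]
    congr 1
    field_simp
    ring
  rw [e1, abs_of_nonneg (by positivity), div_eq_mul_inv t, ofReal_mul,
    mul_cpow_ofReal_nonneg ht.le (by positivity), real_smul, smul_eq_mul, one_mul,
    mul_assoc, ← cpow_add _ _ (by exact_mod_cast (inv_pos.2 h1t).ne'),
    show 1 - σ - 1 + (σ - 1) = -1 by ring, cpow_neg_one, show 1 - σ - 1 = -σ - 1 + 1 by ring,
    cpow_add _ _ (by exact_mod_cast ht.ne'), cpow_one]
  push_cast
  have : (1 + (t : ℂ)) ≠ 0 := by exact_mod_cast h1t.ne'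
  field_simp

theorem sin_pi_mul_ne_zero {σ : ℂ} (h0 : 0 < σ.re) (h1 : σ.re < 1) : sin (Real.pi * σ) ≠ 0 := by
  rw [sin_ne_zero_iff]
  intro k hk
  have hπ : (Real.pi : ℂ) ≠ 0 := by exact_mod_cast Real.pi_ne_zero
  have h2 : σ = k := by
    have : (Real.pi : ℂ) * σ = Real.pi * k := by rw [hk]; ring
    exact mul_left_cancel₀ hπ this
  rw [h2] at h0 h1
  simp only [intCast_re] at h0 h1
  have h3 : 0 < k := by exact_mod_cast h0
  have h4 : k < 1 := by exact_mod_cast h1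
  omega

/-- For l > 0, scaling t gives Φ(l) = Φ(1) l^(-σ), and the identity theorem extends this to the slit
plane. Differentiating at l = 1 gives σ Φ(1) as the integral of t^(-σ)/(1+t). -/
theorem mellin_log_one_add_div {l : ℂ} (hl : l ∈ slitPlane) {σ : ℂ} (h0 : 0 < σ.re)
    (h1 : σ.re < 1) : mellin (fun t : ℝ => log (1 + (t : ℂ) / l)) (-σ) =
      Real.pi / (σ * sin (Real.pi * σ)) * l ^ (-σ) := by
  set Φ : ℂ → ℂ := fun l => mellin (fun t : ℝ => log (1 + (t : ℂ) / l)) (-σ) with hΦ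
  have hσ : σ ≠ 0 := fun h => by simp [h] at h0
  have hd : DifferentiableOn ℂ Φ slitPlane := fun l hl =>
    (hasDerivAt_mellin_log_one_add_div hl h0 h1).differentiableAt.differentiableWithinAt
  have hdc : ∀ l ∈ slitPlane, HasDerivAt (fun l : ℂ => Φ 1 * l ^ (-σ))
      (Φ 1 * (-σ * l ^ (-σ - 1))) l := fun l hl =>
    (((hasStrictDerivAt_id l).cpow_const hl).hasDerivAt.congr_deriv (by simp)).const_mul (Φ 1)
  have hreal : ∀ a : ℝ, 0 < a → Φ a = Φ 1 * (a : ℂ) ^ (-σ) := by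
    intro a ha
    have := mellin_comp_mul_left (fun t : ℝ => log (1 + (t : ℂ) / 1)) (-σ) (inv_pos.2 ha)
    simp only [hΦ]
    rw [smul_eq_mul, mul_comm, neg_neg, ofReal_inv, inv_cpow _ _ (by
      rw [arg_ofReal_of_nonneg ha.le]; exact Real.pi_pos.ne), ← cpow_neg] at this
    rw [← this]
    congr 1
    funext t
    congr 1
    push_cast
    rw [div_one, div_eq_mul_inv, mul_comm]
  have heq : EqOn Φ (fun l => Φ 1 * l ^ (-σ)) slitPlane := by
    refine AnalyticOnNhd.eqOn_of_preconnected_of_frequently_eq (z₀ := 1)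
      (hd.analyticOnNhd isOpen_slitPlane)
      (DifferentiableOn.analyticOnNhd (fun l hl =>
        (hdc l hl).differentiableAt.differentiableWithinAt)
        isOpen_slitPlane) ?_ one_mem_slitPlane ?_
    · exact (starConvex_one_slitPlane.isPathConnected one_mem_slitPlane).isConnected.isPreconnected
    · have ht : Tendsto (fun a : ℝ => (a : ℂ)) (𝓝[≠] 1) (𝓝[≠] 1) := by
        refine tendsto_nhdsWithin_iff.2 ⟨?_, ?_⟩
        · exact (continuous_ofReal.tendsto' 1 1 ofReal_one).mono_left nhdsWithin_le_nhds
        · filter_upwards [self_mem_nhdsWithin] with a ha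
          simpa using ha
      refine ht.frequently (Eventually.frequently ?_)
      filter_upwards [nhdsWithin_le_nhds (lt_mem_nhds (show (0 : ℝ) < 1 by norm_num))] with a ha
      exact hreal a ha
  have hΦ1 : σ * Φ 1 = Real.pi / sin (Real.pi * σ) := by
    have d1 := hasDerivAt_mellin_log_one_add_div one_mem_slitPlane h0 h1
    have d2 := (hdc 1 one_mem_slitPlane).congr_of_eventuallyEq
      (heq.eventuallyEq_of_mem (isOpen_slitPlane.mem_nhds one_mem_slitPlane))
    have d3 := d1.unique d2
    rw [one_cpow] at d3
    rw [← mellin_inv_one_add h0 h1]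
    have : ∀ t : ℝ, (t : ℂ) ^ (-σ - 1) • (-(t : ℂ) / (1 * (1 + t))) =
        -((t : ℂ) ^ (-σ - 1) • ((t : ℂ) / (1 * (1 + t)))) := fun t => by
      rw [neg_div, smul_neg]
    simp only [this, integral_neg] at d3
    linear_combination d3
  have h2 := heq hl
  simp only at h2
  change Φ l = _
  rw [h2]
  have hs := sin_pi_mul_ne_zero h0 h1
  congr 1
  field_simp
  rw [eq_div_iff hs] at hΦ1
  linear_combination hΦ1

/-! ### Sums over a sectorial family -/

/-- A family of numbers in a sector avoiding the negative axis, with `∑ ‖lᵢ‖^(-q) < ∞` for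
`q > 1/2`. -/
structure IsSectorialFamily {ι : Type*} (l : ι → ℂ) (κ : ℝ) : Prop where
  mem_slitPlane : ∀ i, l i ∈ slitPlane
  pos : 0 < κ
  sector : ∀ i, ∀ x : ℝ, 0 ≤ x → κ * (‖l i‖ + x) ≤ ‖l i + x‖
  summable : ∀ q : ℝ, 1 / 2 < q → Summable fun i => ‖l i‖ ^ (-q)

/-- `∑ᵢ log (1 + z / lᵢ)`. -/
noncomputable def logSum {ι : Type*} (l : ι → ℂ) (z : ℝ) : ℂ :=
  ∑' i, log (1 + (z : ℂ) / l i)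

theorem norm_cpow_neg_le {z : ℂ} (hz : z ≠ 0) (σ : ℂ) :
    ‖z ^ (-σ)‖ ≤ ‖z‖ ^ (-σ.re) * Real.exp (Real.pi * |σ.im|) := by
  rw [norm_cpow_of_ne_zero hz, neg_re, neg_im, div_eq_mul_inv, ← Real.exp_neg]
  gcongr
  have h1 := abs_arg_le_pi z
  calc -(arg z * -σ.im) ≤ |arg z| * |σ.im| := by
        rw [← abs_mul, mul_neg, neg_neg]
        exact le_abs_self (arg z * σ.im)
    _ ≤ _ := by gcongr

namespace IsSectorialFamily

variable {ι : Type*} {l : ι → ℂ} {κ : ℝ}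

theorem norm_pos (h : IsSectorialFamily l κ) (i : ι) : 0 < ‖l i‖ :=
  norm_pos_iff.2 (slitPlane_ne_zero (h.mem_slitPlane i))

theorem summable_inv (h : IsSectorialFamily l κ) : Summable fun i => ‖l i‖⁻¹ := by
  simpa [Real.rpow_neg_one] using h.summable 1 (by norm_num)

theorem countable (h : IsSectorialFamily l κ) : Countable ι := by
  have h1 := h.summable_inv.countable_support
  have h2 : Function.support (fun i => ‖l i‖⁻¹) = univ := by
    ext i
    simpa using slitPlane_ne_zero (h.mem_slitPlane i)
  rw [h2] at h1
  exact countable_univ_iff.1 h1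

theorem norm_log_le (h : IsSectorialFamily l κ) (i : ι) {z p : ℝ} (hz : 0 ≤ z) (hp : 0 < p)
    (hp1 : p ≤ 1) : ‖log (1 + (z : ℂ) / l i)‖ ≤ κ⁻¹ * p⁻¹ * ‖l i‖ ^ (-p) * z ^ p :=
  norm_log_one_add_div_le_rpow (h.mem_slitPlane i) h.pos (h.sector i) hz hp hp1

theorem summable_log (h : IsSectorialFamily l κ) {z : ℝ} (hz : 0 ≤ z) :
    Summable fun i => log (1 + (z : ℂ) / l i) :=
  Summable.of_norm_bounded (((h.summable 1 (by norm_num)).mul_left _).mul_right _)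
    fun i => h.norm_log_le i hz one_pos le_rfl

theorem norm_logSum_le (h : IsSectorialFamily l κ) {z p : ℝ} (hz : 0 ≤ z) (hp : 1 / 2 < p)
    (hp1 : p ≤ 1) : ‖logSum l z‖ ≤ κ⁻¹ * p⁻¹ * (∑' i, ‖l i‖ ^ (-p)) * z ^ p := by
  rw [← tsum_mul_left, ← tsum_mul_right]
  exact tsum_of_norm_bounded (((h.summable p hp).mul_left _).mul_right _).hasSum
    fun i => h.norm_log_le i hz (by linarith) hp1

theorem exp_logSum (h : IsSectorialFamily l κ) {z : ℝ} (hz : 0 ≤ z) :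
    exp (logSum l z) = ∏' i, (1 + (z : ℂ) / l i) :=
  (cexp_tsum_eq_tprod (fun i => slitPlane_ne_zero
    (one_add_ofReal_div_mem_slitPlane (h.mem_slitPlane i) hz)) (h.summable_log hz))

theorem continuousOn_logSum (h : IsSectorialFamily l κ) : ContinuousOn (logSum l) (Ici 0) := by
  intro z hz
  have hz : 0 ≤ z := hz
  have h1 : ContinuousOn (logSum l) (Icc 0 (z + 1)) := by
    refine continuousOn_tsum (u := fun i => κ⁻¹ * 1⁻¹ * ‖l i‖ ^ (-1 : ℝ) * (z + 1) ^ (1 : ℝ))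
      (fun i t ht => (hasDerivAt_log_one_add_div (h.mem_slitPlane i)
        ht.1).continuousAt.continuousWithinAt)
      (((h.summable 1 (by norm_num)).mul_left _).mul_right _) fun i t ht => ?_
    refine (h.norm_log_le i ht.1 one_pos le_rfl).trans ?_
    have := ht.1
    have := h.pos
    gcongr
    exact ht.2
  refine (h1 z ⟨hz, by linarith⟩).mono_of_mem_nhdsWithin ?_
  exact mem_nhdsWithin.2 ⟨Iio (z + 1), isOpen_Iio, by simp, fun t ht => ⟨ht.2, le_of_lt ht.1⟩⟩

theorem summable_cpow (h : IsSectorialFamily l κ) {σ : ℂ} (hσ : 1 / 2 < σ.re) :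
    Summable fun i => l i ^ (-σ) := by
  refine Summable.of_norm_bounded ((h.summable σ.re hσ).mul_right (Real.exp (Real.pi * |σ.im|)))
    fun i => norm_cpow_neg_le (slitPlane_ne_zero (h.mem_slitPlane i)) σ

/-- The hypothesis for exchanging sum and integral: by scaling, the i-th integral is at most a
constant times ‖lᵢ‖^(-Re σ). -/
theorem summable_integral_norm (h : IsSectorialFamily l κ) {σ : ℂ} (h0 : 1 / 2 < σ.re)
    (h1 : σ.re < 1) : Summable fun i =>
      ∫ t : ℝ in Ioi 0, ‖(t : ℂ) ^ (-σ - 1) • log (1 + (t : ℂ) / l i)‖ := by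
  set g : ℝ → ℝ := fun t => t ^ (-σ.re - 1) * Real.log (1 + t) with hg
  have hnorm : ∀ a : ℝ, 0 < a → ∀ t ∈ Ioi (0 : ℝ),
      ‖(t : ℂ) ^ (-σ - 1) • log (1 + (t : ℂ) / a)‖ =
        t ^ (-σ.re - 1) * Real.log (1 + t / a) := by
    intro a ha t ht
    have ht : 0 < t := ht
    have e : (1 + (t : ℂ) / a) = ((1 + t / a : ℝ) : ℂ) := by push_cast; ring
    rw [norm_smul, norm_cpow_eq_rpow_re_of_pos ht, e, ← ofReal_log (by positivity), norm_real,
      Real.norm_of_nonneg (Real.log_nonneg (by simp; positivity))]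
    simp
  have hint : ∀ a : ℝ, 0 < a →
      IntegrableOn (fun t : ℝ => t ^ (-σ.re - 1) * Real.log (1 + t / a)) (Ioi 0) := fun a ha =>
    IntegrableOn.congr_fun (mellinConvergent_log_one_add_div (l := (a : ℂ))
      (Or.inl (by simpa using ha)) (by linarith) h1).norm (hnorm a ha) measurableSet_Ioi
  have hscale : ∀ a : ℝ, 0 < a → ∫ t : ℝ in Ioi 0, t ^ (-σ.re - 1) * Real.log (1 + t / a) =
      a ^ (-σ.re) * ∫ t : ℝ in Ioi 0, g t := by
    intro a ha
    have := integral_comp_mul_left_Ioi g 0 (inv_pos.2 ha)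
    rw [mul_zero, inv_inv, smul_eq_mul] at this
    have e : ∀ t ∈ Ioi (0 : ℝ), t ^ (-σ.re - 1) * Real.log (1 + t / a) =
        a ^ (-σ.re - 1) * g (a⁻¹ * t) := by
      intro t ht
      have ht : 0 < t := ht
      rw [hg]
      simp only
      rw [Real.mul_rpow (by positivity) ht.le, Real.inv_rpow ha.le, div_eq_inv_mul, ← mul_assoc,
        mul_inv_cancel_left₀ (by positivity)]
    rw [setIntegral_congr_fun measurableSet_Ioi e, integral_const_mul, this, ← mul_assoc,
      ← Real.rpow_add_one ha.ne', sub_add_cancel]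
  refine Summable.of_nonneg_of_le (fun i => integral_nonneg fun t => norm_nonneg _) (fun i => ?_)
    ((h.summable σ.re h0).mul_left (κ⁻¹ * ∫ t : ℝ in Ioi 0, g t))
  have hpos := h.norm_pos i
  calc ∫ t : ℝ in Ioi 0, ‖(t : ℂ) ^ (-σ - 1) • log (1 + (t : ℂ) / l i)‖
      ≤ ∫ t : ℝ in Ioi 0, κ⁻¹ * (t ^ (-σ.re - 1) * Real.log (1 + t / ‖l i‖)) := by
        refine setIntegral_mono_on
          (mellinConvergent_log_one_add_div (h.mem_slitPlane i) (by linarith) h1).norm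
          ((hint _ hpos).const_mul _) measurableSet_Ioi fun t ht => ?_
        have ht : 0 < t := ht
        rw [norm_smul, norm_cpow_eq_rpow_re_of_pos ht]
        have := norm_log_one_add_div_le (h.mem_slitPlane i) h.pos (h.sector i) ht.le
        calc _ ≤ t ^ (-σ - 1).re * (κ⁻¹ * Real.log (1 + t / ‖l i‖)) := by gcongr
          _ = _ := by simp; ring
    _ = κ⁻¹ * (∫ t : ℝ in Ioi 0, g t) * ‖l i‖ ^ (-σ.re) := by
        rw [integral_const_mul, hscale _ hpos]; ring

theorem mellin_logSum (h : IsSectorialFamily l κ) {σ : ℂ} (h0 : 1 / 2 < σ.re)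
    (h1 : σ.re < 1) :
    mellin (logSum l) (-σ) = Real.pi / (σ * sin (Real.pi * σ)) * ∑' i, l i ^ (-σ) := by
  have := h.countable
  have hs := hasSum_integral_of_summable_integral_norm
    (fun i => mellinConvergent_log_one_add_div (h.mem_slitPlane i) (σ := σ) (by linarith) h1)
    (h.summable_integral_norm h0 h1)
  have e : ∫ t : ℝ in Ioi 0, ∑' i, (t : ℂ) ^ (-σ - 1) • log (1 + (t : ℂ) / l i) =
      mellin (logSum l) (-σ) := by
    rw [mellin]
    refine setIntegral_congr_fun measurableSet_Ioi fun t ht => ?_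
    simp only [logSum]
    rw [tsum_const_smul'']
  rw [e] at hs
  rw [← hs.tsum_eq, ← tsum_mul_left]
  exact tsum_congr fun i => mellin_log_one_add_div (h.mem_slitPlane i) (by linarith) h1

end IsSectorialFamily

theorem exists_pos_forall_of_cofinite {ι : Type*} {P : ℝ → ι → Prop}
    (hP : ∀ i, ∀ a b : ℝ, a ≤ b → P b i → P a i) {κ₀ : ℝ} (h0 : 0 < κ₀)
    (hco : ∀ᶠ i in cofinite, P κ₀ i) (hex : ∀ i, ∃ κ : ℝ, 0 < κ ∧ P κ i) :
    ∃ κ : ℝ, 0 < κ ∧ ∀ i, P κ i := by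
  have key : ∀ s : Set ι, s.Finite → ∃ κ : ℝ, 0 < κ ∧ ∀ i ∈ s, P κ i := by
    intro s hs
    induction s, hs using Set.Finite.induction_on with
    | empty => exact ⟨1, one_pos, by simp⟩
    | @insert a s _ _ ih =>
      obtain ⟨κ, hκ, h⟩ := ih
      obtain ⟨κ', hκ', h'⟩ := hex a
      refine ⟨min κ κ', lt_min hκ hκ', fun i hi => ?_⟩
      rcases mem_insert_iff.1 hi with rfl | hi
      · exact hP _ _ _ (min_le_right _ _) h'
      · exact hP _ _ _ (min_le_left _ _) (h i hi)
  obtain ⟨κ, hκ, h⟩ := key _ hco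
  refine ⟨min κ κ₀, lt_min hκ h0, fun i => ?_⟩
  by_cases hi : P κ₀ i
  · exact hP _ _ _ (min_le_right _ _) hi
  · exact hP _ _ _ (min_le_left _ _) (h i hi)

/-- Since |Im τ| ≤ 1/2, Re τ² ≥ |τ|² - 1/2, which tends to infinity along the zeros. -/
theorem eventually_re_tau_sq_add_nonneg (v : ℝ) :
    ∀ᶠ i in cofinite, 0 ≤ (tau i ^ 2 + (v : ℂ)).re := by
  filter_upwards [tendsto_norm_tau.eventually_ge_atTop (1 + |v|)] with i hi
  have h1 := abs_le.1 (abs_im_le_of_mem_tauSet (tau_mem i))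
  have h2 : ‖tau i‖ ^ 2 = (tau i).re ^ 2 + (tau i).im ^ 2 := by
    rw [← normSq_eq_norm_sq, normSq_apply]; ring
  have h3 : (tau i).im ^ 2 ≤ 1 / 4 := by nlinarith
  have h4 := neg_abs_le v
  have h5 : (tau i ^ 2 + (v : ℂ)).re = (tau i).re ^ 2 - (tau i).im ^ 2 + v := by
    simp [sq]
  rw [h5]
  nlinarith [abs_nonneg v]

theorem Admissible.isSectorialFamily {v : ℝ} (hv : Admissible v) :
    ∃ κ, IsSectorialFamily (fun i => tau i ^ 2 + (v : ℂ)) κ := by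
  have hmem : ∀ i, tau i ^ 2 + (v : ℂ) ∈ slitPlane := fun i => hv.mem_slitPlane (tau_mem i)
  obtain ⟨κ, hκ, h⟩ := exists_pos_forall_of_cofinite
    (P := fun κ (i : ZeroIndex) => ∀ x : ℝ, 0 ≤ x →
      κ * (‖tau i ^ 2 + (v : ℂ)‖ + x) ≤ ‖tau i ^ 2 + (v : ℂ) + x‖)
    (fun i a b hab hb x hx => le_trans (by gcongr) (hb x hx))
    -- The sector constant of the right half-plane (c = 0), valid for all but finitely many indices.
    (κ₀ := √((1 - 0) / 2)) (by positivity) (by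
      filter_upwards [eventually_re_tau_sq_add_nonneg v] with i hi x hx
      exact norm_add_ofReal_ge le_rfl one_pos (by simpa using hi) hx)
    (fun i => exists_sector_const (hmem i))
  exact ⟨κ, hmem, hκ, h, fun q hq => summable_norm_tau_sq_add_rpow v hq⟩

/-! ### Continuation of a Mellin transform by means of a Stirling expansion -/

theorem mellin_indicator_one {s : ℂ} (hs : s.re < 0) :
    HasMellin ((Ioi (1 : ℝ)).indicator fun _ => (1 : ℂ)) s (-1 / s) := by
  have e : ∀ t : ℝ, (t : ℂ) ^ (s - 1) • (Ioi (1 : ℝ)).indicator (fun _ => (1 : ℂ)) t =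
      (Ioi (1 : ℝ)).indicator (fun t : ℝ => (t : ℂ) ^ (s - 1)) t := by
    intro t
    by_cases ht : t ∈ Ioi (1 : ℝ) <;> simp [ht]
  have hsub : Ioi (0 : ℝ) ∩ Ioi 1 = Ioi 1 := inter_eq_right.2 (Ioi_subset_Ioi zero_le_one)
  have hre : (s - 1).re < -1 := by simp; linarith
  constructor
  · rw [MellinConvergent]
    simp only [e]
    rw [integrableOn_indicator_iff measurableSet_Ioi, inter_comm, hsub]
    exact integrableOn_Ioi_cpow_of_lt hre one_pos
  · rw [mellin]
    simp only [e]
    rw [setIntegral_indicator measurableSet_Ioi, hsub, integral_Ioi_cpow_of_lt hre one_pos]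
    simp

theorem locallyIntegrableOn_indicator {f : ℝ → ℂ} (hf : ContinuousOn f (Ioi 0))
    (hm : Measurable f) : LocallyIntegrableOn ((Ioi (1 : ℝ)).indicator f) (Ioi 0) :=
  (hf.locallyIntegrableOn measurableSet_Ioi).mono
    (hm.indicator measurableSet_Ioi).aestronglyMeasurable
    (Eventually.of_forall fun t => norm_indicator_le_norm_self f t)

/-- A factor log t amounts to differentiating the transform -1/s in s. -/
theorem mellin_indicator_log {s : ℂ} (hs : s.re < 0) :
    HasMellin (fun t : ℝ => Real.log t • (Ioi (1 : ℝ)).indicator (fun _ => (1 : ℂ)) t) s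
      (1 / s ^ 2) := by
  have h := mellin_hasDerivAt_of_isBigO_rpow (a := 0) (b := s.re - 1) (s := s)
    (f := (Ioi (1 : ℝ)).indicator fun _ => (1 : ℂ))
    (locallyIntegrableOn_indicator continuousOn_const measurable_const)
    (Asymptotics.IsBigO.of_bound 1 (Eventually.of_forall fun t => by
      simpa using norm_indicator_le_norm_self (fun _ => (1 : ℂ)) t)) hs
    ((Asymptotics.isBigO_zero _ _).congr' (by
      filter_upwards [Ioo_mem_nhdsGT (zero_lt_one (α := ℝ))] with t ht
      simp [ht.2.le]) .rfl) (by linarith)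
  refine ⟨h.1, ?_⟩
  have hs0 : s ≠ 0 := fun h0 => by simp [h0] at hs
  have h2 : HasDerivAt (fun s : ℂ => -1 / s) (1 / s ^ 2) s := by
    refine (((hasDerivAt_inv hs0).const_mul (-1)).congr_deriv ?_).congr_of_eventuallyEq
      (Eventually.of_forall fun s => by simp [div_eq_mul_inv])
    field_simp
  refine h.2.unique (h2.congr_of_eventuallyEq ?_)
  filter_upwards [(isOpen_lt continuous_re continuous_const).mem_nhds hs] with z hz
  exact (mellin_indicator_one hz).2

/-- A term of a Stirling expansion. -/
noncomputable def expansionTerm (m : ℝ) (b a : ℂ) (z : ℝ) : ℂ :=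
  (b * (Real.log z : ℂ) + a) * ((z ^ m : ℝ) : ℂ)

/-- A term of a Stirling expansion, cut off at `z = 1`. -/
noncomputable def expansionTail (m : ℝ) (b a : ℂ) : ℝ → ℂ :=
  (Ioi (1 : ℝ)).indicator (expansionTerm m b a)

theorem hasMellin_expansionTail (m : ℝ) (b a : ℂ) {σ : ℂ} (hσ : m < σ.re) :
    HasMellin (expansionTail m b a) (-σ) (b / (σ - m) ^ 2 + a / (σ - m)) := by
  have hs : (-σ + m).re < 0 := by simp; linarith
  have h1 := mellin_indicator_one hs
  have h2 := mellin_indicator_log hs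
  have h3 := hasMellin_add (h2.1.const_smul b) (h1.1.const_smul a)
  rw [mellin_const_smul, mellin_const_smul, h1.2, h2.2] at h3
  have e : ∀ t ∈ Ioi (0 : ℝ), (t : ℂ) ^ (-σ - 1) • expansionTail m b a t =
      (t : ℂ) ^ (-σ - 1) • ((t : ℂ) ^ (m : ℂ) • (b • (Real.log t •
        (Ioi (1 : ℝ)).indicator (fun _ => (1 : ℂ)) t) +
          a • (Ioi (1 : ℝ)).indicator (fun _ => (1 : ℂ)) t)) := by
    intro t ht
    have ht : 0 < t := ht
    by_cases h : t ∈ Ioi (1 : ℝ)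
    · simp only [expansionTail, indicator_of_mem h, expansionTerm, ofReal_cpow ht.le, smul_eq_mul,
        real_smul]
      ring
    · simp [expansionTail, indicator_of_notMem h]
  constructor
  · exact IntegrableOn.congr_fun (MellinConvergent.cpow_smul.2 h3.1) (fun t ht => (e t ht).symm)
      measurableSet_Ioi
  · rw [mellin, setIntegral_congr_fun measurableSet_Ioi e]
    refine (mellin_cpow_smul _ (-σ) (m : ℂ)).trans ?_
    rw [h3.2, smul_eq_mul, smul_eq_mul]
    have hne : σ - m ≠ 0 := fun h0 => by
      have := congrArg re h0
      simp at this
      linarith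
    have : -σ + m = -(σ - m) := by ring
    rw [this, neg_sq, neg_div_neg_eq]
    ring

theorem continuousOn_expansionTerm (m : ℝ) (b a : ℂ) :
    ContinuousOn (expansionTerm m b a) (Ioi 0) := by
  intro t ht
  have ht : t ≠ 0 := ne_of_gt ht
  have h1 : ContinuousAt (fun z : ℝ => (Real.log z : ℂ)) t :=
    continuous_ofReal.continuousAt.comp (Real.continuousAt_log ht)
  have h2 : ContinuousAt (fun z : ℝ => ((z ^ m : ℝ) : ℂ)) t :=
    continuous_ofReal.continuousAt.comp (Real.continuousAt_rpow_const _ _ (Or.inl ht))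
  exact (((continuousAt_const.mul h1).add continuousAt_const).mul h2).continuousWithinAt

theorem measurable_expansionTerm (m : ℝ) (b a : ℂ) : Measurable (expansionTerm m b a) := by
  unfold expansionTerm
  fun_prop

section Continuation

variable {f : ℝ → ℂ} {μ : ℕ → ℝ} {b a : ℕ → ℂ}

/-- `f` minus the first terms of its Stirling expansion, cut off at `1`. -/
noncomputable def expansionRemainder (f : ℝ → ℂ) (μ : ℕ → ℝ) (b a : ℕ → ℂ) (N : ℕ) (z : ℝ) : ℂ :=
  f z - ∑ n ∈ Finset.range (N + 1), expansionTail (μ n) (b n) (a n) z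

theorem expansionRemainder_isBigO_zero {A : ℝ} (hA : ∀ z : ℝ, 0 < z → ‖f z‖ ≤ A * z) (N : ℕ) :
    expansionRemainder f μ b a N =O[𝓝[>] 0] fun z : ℝ => z ^ (-(-1) : ℝ) := by
  refine Asymptotics.IsBigO.of_bound A ?_
  filter_upwards [Ioo_mem_nhdsGT (zero_lt_one (α := ℝ))] with z hz
  have h : z ∉ Ioi (1 : ℝ) := fun h => lt_asymm hz.2 h
  have h0 := hz.1
  have e : ∑ n ∈ Finset.range (N + 1), expansionTail (μ n) (b n) (a n) z = 0 :=
    Finset.sum_eq_zero fun n _ => indicator_of_notMem h _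
  rw [expansionRemainder, e, sub_zero, neg_neg, Real.rpow_one, Real.norm_of_nonneg h0.le]
  exact hA z h0

theorem expansionRemainder_isBigO_atTop (h : HasStirlingExpansion f μ b a) (N : ℕ) :
    expansionRemainder f μ b a N =O[atTop] fun z : ℝ => z ^ (-(-μ N)) := by
  rw [neg_neg]
  refine (h.isLittleO N).isBigO.congr' ?_ .rfl
  filter_upwards [eventually_gt_atTop 1] with z hz
  rw [expansionRemainder]
  congr 1
  exact Finset.sum_congr rfl fun n _ => (indicator_of_mem (show z ∈ Ioi 1 from hz)
    (expansionTerm (μ n) (b n) (a n))).symm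

theorem locallyIntegrableOn_expansionRemainder (hf : ContinuousOn f (Ioi 0)) (N : ℕ) :
    LocallyIntegrableOn (expansionRemainder f μ b a N) (Ioi 0) := by
  refine LocallyIntegrableOn.sub (hf.locallyIntegrableOn measurableSet_Ioi) ?_
  induction Finset.range (N + 1) using Finset.induction_on with
  | empty => simpa using locallyIntegrableOn_zero
  | insert n s hn ih =>
    simp only [Finset.sum_insert hn]
    exact (locallyIntegrableOn_indicator (continuousOn_expansionTerm _ _ _)
      (measurable_expansionTerm _ _ _)).add ih

/-- The meromorphic continuation of the Mellin transform of `f`. -/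
noncomputable def mellinContinuation (f : ℝ → ℂ) (μ : ℕ → ℝ) (b a : ℕ → ℂ) (N : ℕ) (σ : ℂ) : ℂ :=
  mellin (expansionRemainder f μ b a N) (-σ) +
    ∑ n ∈ Finset.range (N + 1), (b n / (σ - μ n) ^ 2 + a n / (σ - μ n))

theorem mellinConvergent_expansionRemainder (h : HasStirlingExpansion f μ b a)
    (hf : ContinuousOn f (Ioi 0)) {A : ℝ} (hA : ∀ z : ℝ, 0 < z → ‖f z‖ ≤ A * z) {N : ℕ} {σ : ℂ}
    (hσ : μ N < σ.re) (hσ1 : σ.re < 1) :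
    MellinConvergent (expansionRemainder f μ b a N) (-σ) :=
  mellinConvergent_of_isBigO_rpow (locallyIntegrableOn_expansionRemainder hf N)
    (expansionRemainder_isBigO_atTop h N) (by simpa using hσ)
    (expansionRemainder_isBigO_zero hA N) (by simpa using hσ1)

theorem differentiableAt_mellin_expansionRemainder (h : HasStirlingExpansion f μ b a)
    (hf : ContinuousOn f (Ioi 0)) {A : ℝ} (hA : ∀ z : ℝ, 0 < z → ‖f z‖ ≤ A * z) {N : ℕ} {σ : ℂ}
    (hσ : μ N < σ.re) (hσ1 : σ.re < 1) :
    DifferentiableAt ℂ (fun σ => mellin (expansionRemainder f μ b a N) (-σ)) σ :=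
  (mellin_differentiableAt_of_isBigO_rpow (locallyIntegrableOn_expansionRemainder hf N)
    (expansionRemainder_isBigO_atTop h N) (by simpa using hσ)
    (expansionRemainder_isBigO_zero hA N) (by simpa using hσ1)).comp σ differentiableAt_id.neg

/-- Removing one more term from the integrand and adding its exact transform changes nothing where
both integrals converge. -/
theorem mellinContinuation_succ (h : HasStirlingExpansion f μ b a)
    (hf : ContinuousOn f (Ioi 0)) {A : ℝ} (hA : ∀ z : ℝ, 0 < z → ‖f z‖ ≤ A * z) {N : ℕ} {σ : ℂ}
    (hσ : μ N < σ.re) (hσ1 : σ.re < 1) :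
    mellinContinuation f μ b a (N + 1) σ = mellinContinuation f μ b a N σ := by
  have hlt : μ (N + 1) < σ.re := (h.strictAnti (Nat.lt_succ_self N)).trans hσ
  have h1 := mellinConvergent_expansionRemainder h hf hA hlt hσ1
  have h2 := hasMellin_expansionTail (μ (N + 1)) (b (N + 1)) (a (N + 1)) hlt
  have h3 := (hasMellin_add h1 h2.1).2
  have e : (fun t => expansionRemainder f μ b a (N + 1) t +
      expansionTail (μ (N + 1)) (b (N + 1)) (a (N + 1)) t) = expansionRemainder f μ b a N := by
    funext t
    rw [expansionRemainder, expansionRemainder, Finset.sum_range_succ _ (N + 1)]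
    ring
  rw [e, h2.2] at h3
  rw [mellinContinuation, mellinContinuation, h3, Finset.sum_range_succ _ (N + 1)]
  ring

theorem mellinContinuation_eq_of_le (h : HasStirlingExpansion f μ b a)
    (hf : ContinuousOn f (Ioi 0)) {A : ℝ} (hA : ∀ z : ℝ, 0 < z → ‖f z‖ ≤ A * z) {N K : ℕ}
    (hNK : N ≤ K) {σ : ℂ} (hσ : μ N < σ.re) (hσ1 : σ.re < 1) :
    mellinContinuation f μ b a K σ = mellinContinuation f μ b a N σ := by
  induction K, hNK using Nat.le_induction with
  | base => rfl
  | succ K hK ih =>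
    rw [mellinContinuation_succ h hf hA ((h.strictAnti.antitone hK).trans_lt hσ) hσ1, ih]

theorem mellinContinuation_eq (h : HasStirlingExpansion f μ b a)
    (hf : ContinuousOn f (Ioi 0)) {A : ℝ} (hA : ∀ z : ℝ, 0 < z → ‖f z‖ ≤ A * z) {N K : ℕ}
    {σ : ℂ} (hN : μ N < σ.re) (hK : μ K < σ.re) (hσ1 : σ.re < 1) :
    mellinContinuation f μ b a K σ = mellinContinuation f μ b a N σ := by
  rcases le_total N K with hle | hle
  · exact mellinContinuation_eq_of_le h hf hA hle hN hσ1
  · exact (mellinContinuation_eq_of_le h hf hA hle hK hσ1).symm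

theorem eq_zero_of_tendsto_mul_log_add {b a : ℂ}
    (h : Tendsto (fun z : ℝ => b * (Real.log z : ℂ) + a) atTop (𝓝 0)) : b = 0 ∧ a = 0 := by
  have h1 : Tendsto (fun z : ℝ => a * (((Real.log z)⁻¹ : ℝ) : ℂ)) atTop (𝓝 0) := by
    have : Tendsto (fun z : ℝ => (((Real.log z)⁻¹ : ℝ) : ℂ)) atTop (𝓝 ((0 : ℝ) : ℂ)) :=
      (continuous_ofReal.tendsto 0).comp (tendsto_inv_atTop_zero.comp Real.tendsto_log_atTop)
    simpa using this.const_mul a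
  have h2 : Tendsto (fun z : ℝ => (((Real.log z)⁻¹ : ℝ) : ℂ)) atTop (𝓝 0) := by
    have : Tendsto (fun z : ℝ => (((Real.log z)⁻¹ : ℝ) : ℂ)) atTop (𝓝 ((0 : ℝ) : ℂ)) :=
      (continuous_ofReal.tendsto 0).comp (tendsto_inv_atTop_zero.comp Real.tendsto_log_atTop)
    simpa using this
  have hb : b = 0 := by
    have h3 := (h.mul h2).sub h1
    rw [zero_mul, sub_zero] at h3
    refine tendsto_nhds_unique (f := fun _ : ℝ => b) tendsto_const_nhds (h3.congr' ?_)
    filter_upwards [eventually_gt_atTop 1] with z hz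
    have : (Real.log z : ℂ) ≠ 0 := by exact_mod_cast (Real.log_pos hz).ne'
    push_cast
    field_simp
    ring
  refine ⟨hb, ?_⟩
  simp only [hb, zero_mul, zero_add] at h
  exact tendsto_nhds_unique tendsto_const_nhds h

/-- The expansion is arbitrary, so it may list exponents above the true growth of f. Comparing
successive terms shows that their coefficients vanish. -/
theorem HasStirlingExpansion.coeff_eq_zero (h : HasStirlingExpansion f μ b a) {p : ℝ}
    (hp : f =O[atTop] fun z : ℝ => z ^ p) (n : ℕ) (hn : p < μ n) : b n = 0 ∧ a n = 0 := by
  induction n using Nat.strong_induction_on with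
  | _ n ih =>
    have h1 := h.isLittleO n
    have hsum : ∀ z : ℝ, ∑ k ∈ Finset.range (n + 1),
        (b k * (Real.log z : ℂ) + a k) * ((z ^ μ k : ℝ) : ℂ) =
        (b n * (Real.log z : ℂ) + a n) * ((z ^ μ n : ℝ) : ℂ) := by
      intro z
      rw [Finset.sum_range_succ, Finset.sum_eq_zero, zero_add]
      intro k hk
      have hk := Finset.mem_range.1 hk
      obtain ⟨e1, e2⟩ := ih k hk (hn.trans (h.strictAnti hk))
      simp [e1, e2]
    simp only [hsum] at h1
    have h2 : f =o[atTop] fun z : ℝ => z ^ μ n := hp.trans_isLittleO <| by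
      refine (Asymptotics.isLittleO_iff_tendsto' ?_).2 ?_
      · filter_upwards [eventually_gt_atTop 0] with z hz h0
        exact absurd h0 (Real.rpow_pos_of_pos hz _).ne'
      · refine (tendsto_rpow_neg_atTop (sub_pos.2 hn)).congr' ?_
        filter_upwards [eventually_gt_atTop 0] with z hz
        rw [← Real.rpow_sub hz, neg_sub]
    have h3 := h2.sub h1
    refine eq_zero_of_tendsto_mul_log_add ?_
    rw [← Asymptotics.isLittleO_one_iff ℝ, Asymptotics.isLittleO_iff]
    intro ε hε
    filter_upwards [(Asymptotics.isLittleO_iff.1 h3) hε, eventually_gt_atTop 0] with z hz hz0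
    have hpos : 0 < z ^ μ n := Real.rpow_pos_of_pos hz0 _
    rw [sub_sub_cancel, norm_mul, norm_real, Real.norm_of_nonneg hpos.le] at hz
    rw [norm_one, mul_one]
    exact le_of_mul_le_mul_right hz hpos

theorem mellinContinuation_eq_mellin (h : HasStirlingExpansion f μ b a)
    (hf : ContinuousOn f (Ioi 0)) {A : ℝ} (hA : ∀ z : ℝ, 0 < z → ‖f z‖ ≤ A * z) {p : ℝ}
    (hp : f =O[atTop] fun z : ℝ => z ^ p) {N : ℕ} {σ : ℂ}
    (hN : μ N < σ.re) (hpσ : p < σ.re) (hσ1 : σ.re < 1) :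
    mellinContinuation f μ b a N σ = mellin f (-σ) := by
  have htail : ∀ n, HasMellin (expansionTail (μ n) (b n) (a n)) (-σ)
      (b n / (σ - μ n) ^ 2 + a n / (σ - μ n)) := by
    intro n
    -- Exponents above p may lie beyond the convergence range at σ, but their coefficients vanish;
    -- the others are below Re σ.
    by_cases hn : p < μ n
    · obtain ⟨e1, e2⟩ := h.coeff_eq_zero hp n hn
      have : expansionTail (μ n) 0 0 = fun _ => 0 := by
        funext z
        simp [expansionTail, expansionTerm, indicator]
      rw [e1, e2, this]
      constructor
      · simp [MellinConvergent]
      · simp [mellin]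
    · exact hasMellin_expansionTail _ _ _ (by linarith)
  have hsum : ∀ s : Finset ℕ, HasMellin (fun z => ∑ n ∈ s, expansionTail (μ n) (b n) (a n) z) (-σ)
      (∑ n ∈ s, (b n / (σ - μ n) ^ 2 + a n / (σ - μ n))) := by
    intro s
    induction s using Finset.induction_on with
    | empty => exact ⟨by simp [MellinConvergent], by simp [mellin]⟩
    | insert n s hn ih =>
      simp only [Finset.sum_insert hn]
      have := hasMellin_add (htail n).1 ih.1
      rwa [(htail n).2, ih.2] at this
  have h1 := mellinConvergent_expansionRemainder h hf hA hN hσ1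
  have h2 := hsum (Finset.range (N + 1))
  have h3 := (hasMellin_add h1 h2.1).2
  rw [h2.2] at h3
  rw [mellinContinuation, ← h3]
  congr 1
  funext z
  simp [expansionRemainder]

theorem meromorphicAt_mellinContinuation (h : HasStirlingExpansion f μ b a)
    (hf : ContinuousOn f (Ioi 0)) {A : ℝ} (hA : ∀ z : ℝ, 0 < z → ‖f z‖ ≤ A * z) {N : ℕ} {σ : ℂ}
    (hσ : μ N < σ.re) (hσ1 : σ.re < 1) : MeromorphicAt (mellinContinuation f μ b a N) σ := by
  have hopen : IsOpen {z : ℂ | μ N < z.re ∧ z.re < 1} :=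
    (isOpen_lt continuous_const continuous_re).inter (isOpen_lt continuous_re continuous_const)
  have h1 : AnalyticAt ℂ (fun σ => mellin (expansionRemainder f μ b a N) (-σ)) σ :=
    DifferentiableOn.analyticAt (s := {z : ℂ | μ N < z.re ∧ z.re < 1})
      (fun z hz => (differentiableAt_mellin_expansionRemainder h hf hA hz.1
        hz.2).differentiableWithinAt) (hopen.mem_nhds ⟨hσ, hσ1⟩)
  refine h1.meromorphicAt.add (MeromorphicAt.fun_sum fun n _ => ?_)
  have h2 : MeromorphicAt (fun z : ℂ => z - μ n) σ := by fun_prop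
  exact ((MeromorphicAt.const _ _).div (h2.pow 2)).add ((MeromorphicAt.const _ _).div h2)

/-- The k-th term gives b/σ² + a/σ and all else is regular at 0, while σ sin(πσ)/π = σ²(1 + O(σ²)).
The product is b + aσ + O(σ²). -/
theorem sin_pi_mul_div_mul_mellinContinuation (h : HasStirlingExpansion f μ b a)
    (hf : ContinuousOn f (Ioi 0)) {A : ℝ} (hA : ∀ z : ℝ, 0 < z → ‖f z‖ ≤ A * z) {N k : ℕ}
    (hk : μ k = 0) (hN : μ N < 0) : ∃ g : ℂ → ℂ, AnalyticAt ℂ g 0 ∧ g 0 = b k ∧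
      HasDerivAt g (a k) 0 ∧ (fun σ => σ * sin (Real.pi * σ) / Real.pi *
        mellinContinuation f μ b a N σ) =ᶠ[𝓝[≠] 0] g := by
  have hopen : IsOpen {z : ℂ | μ N < z.re ∧ z.re < 1} :=
    (isOpen_lt continuous_const continuous_re).inter (isOpen_lt continuous_re continuous_const)
  have h1 : AnalyticAt ℂ (fun σ => mellin (expansionRemainder f μ b a N) (-σ)) 0 :=
    DifferentiableOn.analyticAt (s := {z : ℂ | μ N < z.re ∧ z.re < 1})
      (fun z hz => (differentiableAt_mellin_expansionRemainder h hf hA hz.1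
        hz.2).differentiableWithinAt) (hopen.mem_nhds (by simpa using hN))
  have hkN : k ∈ Finset.range (N + 1) := by
    have : k < N := h.strictAnti.lt_iff_gt.1 (by rwa [hk])
    simp; omega
  set r : ℂ → ℂ := fun σ => mellin (expansionRemainder f μ b a N) (-σ) +
    ∑ n ∈ (Finset.range (N + 1)).erase k, (b n / (σ - μ n) ^ 2 + a n / (σ - μ n)) with hr
  have hra : AnalyticAt ℂ r 0 := by
    refine h1.add (Finset.analyticAt_fun_sum _ fun n hn => ?_)
    have hne : (0 : ℂ) - μ n ≠ 0 := by
      rw [zero_sub, neg_ne_zero, ofReal_ne_zero, ← hk]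
      exact fun h0 => (Finset.mem_erase.1 hn).1 (h.strictAnti.injective h0)
    have h2 : AnalyticAt ℂ (fun z : ℂ => z - μ n) 0 := by fun_prop
    exact (analyticAt_const.div (h2.pow 2) (pow_ne_zero 2 hne)).add (analyticAt_const.div h2 hne)
  have hsin : AnalyticAt ℂ (fun σ : ℂ => sin (Real.pi * σ)) 0 := by fun_prop
  -- Order 3 is needed: the vanishing quadratic term of the sine makes S stationary at 0, so S does
  -- not disturb the derivative a.
  obtain ⟨F, hF, hF'⟩ := hsin.exists_eventuallyEq_sum_add_pow_mul 3
  set S : ℂ → ℂ := fun σ => 1 + σ ^ 2 * (F σ / Real.pi) with hS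
  have hSd : HasDerivAt S 0 0 := by
    have := (((hasDerivAt_pow 2 (0 : ℂ)).mul (hF.differentiableAt.div_const
      (Real.pi : ℂ)).hasDerivAt)).const_add 1
    refine this.congr_deriv ?_
    simp
  have hπ : (Real.pi : ℂ) ≠ 0 := by exact_mod_cast Real.pi_ne_zero
  have hSeq : ∀ᶠ σ in 𝓝 (0 : ℂ), sin (Real.pi * σ) = Real.pi * σ * S σ := by
    filter_upwards [hF'] with σ hσ
    have d1 : deriv (fun σ : ℂ => sin (Real.pi * σ)) = fun σ => cos (Real.pi * σ) * Real.pi := by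
      funext z
      simpa using ((hasDerivAt_id z).const_mul (Real.pi : ℂ)).csin.deriv
    have d2 : deriv (fun σ : ℂ => cos (Real.pi * σ) * Real.pi) 0 = 0 := by
      have := (((hasDerivAt_id (0 : ℂ)).const_mul (Real.pi : ℂ)).ccos.mul_const (Real.pi : ℂ)).deriv
      simpa using this
    rw [hσ]
    simp only [Finset.sum_range_succ, Finset.sum_range_zero, iteratedDeriv_succ, iteratedDeriv_zero,
      d1, d2, hS]
    simp
    field_simp
  refine ⟨fun σ => S σ * (b k + a k * σ + σ ^ 2 * r σ), ?_, ?_, ?_, ?_⟩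
  · have : AnalyticAt ℂ S 0 := by
      rw [hS]
      exact analyticAt_const.add ((analyticAt_id.pow 2).mul (hF.div_const))
    fun_prop
  · simp [hS]
  · have h2 : HasDerivAt (fun σ => b k + a k * σ + σ ^ 2 * r σ) (a k) 0 := by
      have := (((hasDerivAt_id (0 : ℂ)).const_mul (a k)).const_add (b k)).add
        ((hasDerivAt_pow 2 (0 : ℂ)).mul hra.differentiableAt.hasDerivAt)
      refine this.congr_deriv ?_
      simp
    refine (hSd.mul h2).congr_deriv ?_
    simp [hS]
  · filter_upwards [nhdsWithin_le_nhds hSeq, self_mem_nhdsWithin] with σ hσ hσ0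
    have hσ0 : σ ≠ 0 := hσ0
    rw [hσ, mellinContinuation, ← Finset.add_sum_erase _ _ hkN, hk]
    simp only [hr, ofReal_zero, sub_zero]
    field_simp
    ring

end Continuation

/-! ### Continuation of the zeta function of a sectorial family -/

theorem rpow_neg_le_add {x r q Q : ℝ} (hx : 0 < x) (hq : q ≤ r) (hQ : r ≤ Q) :
    x ^ (-r) ≤ x ^ (-q) + x ^ (-Q) := by
  have h1 : 0 ≤ x ^ (-q) := by positivity
  have h2 : 0 ≤ x ^ (-Q) := by positivity
  rcases le_total 1 x with h | h
  · have := Real.rpow_le_rpow_of_exponent_le h (neg_le_neg hq)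
    linarith
  · have := Real.rpow_le_rpow_of_exponent_ge hx h (neg_le_neg hQ)
    linarith

theorem _root_.toMeromorphicNFOn_eventuallyEq_of_analyticAt {F g : ℂ → ℂ}
    (hF : MeromorphicOn F univ)
    {z : ℂ} (hg : AnalyticAt ℂ g z) (h : F =ᶠ[𝓝[≠] z] g) :
    toMeromorphicNFOn F univ =ᶠ[𝓝 z] g :=
  (MeromorphicNFAt.eventuallyEq_nhdsNE_iff_eventuallyEq_nhds
    (meromorphicNFOn_toMeromorphicNFOn F univ (mem_univ z)) hg.meromorphicNFAt).1
    ((hF.toMeromorphicNFOn_eq_self_on_nhdsNE (mem_univ z)).trans h)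

namespace IsSectorialFamily

variable {ι : Type*} {l : ι → ℂ} {κ : ℝ}

theorem analyticAt_tsum_cpow (h : IsSectorialFamily l κ) {σ : ℂ} (hσ : 1 / 2 < σ.re) :
    AnalyticAt ℂ (fun σ => ∑' i, l i ^ (-σ)) σ := by
  set q := (σ.re + 1 / 2) / 2 with hq
  set Q := σ.re + 1 with hQ
  set R := |σ.im| + 1 with hR
  set U : Set ℂ := {z | q < z.re ∧ z.re < Q ∧ |z.im| < R} with hU
  have hUo : IsOpen U := (isOpen_lt continuous_const continuous_re).inter
    ((isOpen_lt continuous_re continuous_const).inter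
      (isOpen_lt continuous_im.abs continuous_const))
  refine DifferentiableOn.analyticAt (s := U) ?_ (hUo.mem_nhds ⟨by linarith, by linarith,
      by linarith⟩)
  refine differentiableOn_tsum_of_summable_norm
    (u := fun i => (‖l i‖ ^ (-q) + ‖l i‖ ^ (-Q)) * Real.exp (Real.pi * R))
    (((h.summable q (by linarith)).add (h.summable Q (by linarith))).mul_right _) (fun i z hz => ?_)
    hUo fun i z hz => ?_
  · exact (differentiableAt_id.neg.const_cpow
      (Or.inl (slitPlane_ne_zero (h.mem_slitPlane i)))).differentiableWithinAt
  · refine (norm_cpow_neg_le (slitPlane_ne_zero (h.mem_slitPlane i)) z).trans ?_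
    have h1 := rpow_neg_le_add (h.norm_pos i) hz.1.le hz.2.1.le
    have h2 := hz.2.2.le
    have := Real.pi_pos
    gcongr

/-- The meromorphic continuation of `∑ᵢ lᵢ^(-σ)` and its Taylor polynomial of degree `1` at `0`. -/
theorem exists_continuation (h : IsSectorialFamily l κ) {μ : ℕ → ℝ} {b a : ℕ → ℂ}
    (hexp : HasStirlingExpansion (logSum l) μ b a) {k : ℕ} (hk : μ k = 0) :
    ∃ G : ℂ → ℂ, MeromorphicNFOn G univ ∧
      (∀ σ : ℂ, 1 / 2 < σ.re → HasSum (fun i => l i ^ (-σ)) (G σ)) ∧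
      G 0 = b k ∧ HasDerivAt G (a k) 0 := by
  classical
  have hf : ContinuousOn (logSum l) (Ioi 0) := h.continuousOn_logSum.mono Ioi_subset_Ici_self
  obtain ⟨A, hA⟩ : ∃ A : ℝ, ∀ z : ℝ, 0 < z → ‖logSum l z‖ ≤ A * z :=
    ⟨_, fun z hz => by simpa using h.norm_logSum_le hz.le (p := 1) (by norm_num) le_rfl⟩
  set D : ℂ → ℂ := fun σ => ∑' i, l i ^ (-σ) with hD
  set M : ℕ → ℂ → ℂ := fun N σ =>
    σ * sin (Real.pi * σ) / Real.pi * mellinContinuation (logSum l) μ b a N σ with hM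
  -- In the strip 1/2 < Re σ < 1 the series and the continued Mellin transform are both defined, and
  -- they agree.
  have hMD : ∀ (N : ℕ) (σ : ℂ), μ N < σ.re → 1 / 2 < σ.re → σ.re < 1 → M N σ = D σ := by
    intro N σ hN h0 h1
    have hp : logSum l =O[atTop] fun z : ℝ => z ^ ((σ.re + 1 / 2) / 2) := by
      refine Asymptotics.IsBigO.of_bound
        (κ⁻¹ * ((σ.re + 1 / 2) / 2)⁻¹ * ∑' i, ‖l i‖ ^ (-((σ.re + 1 / 2) / 2))) ?_
      filter_upwards [eventually_ge_atTop 0] with z hz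
      rw [Real.norm_of_nonneg (r := z ^ ((σ.re + 1 / 2) / 2)) (by positivity)]
      exact h.norm_logSum_le hz (by linarith) (by linarith)
    have hs := sin_pi_mul_ne_zero (σ := σ) (by linarith) h1
    have hσ : σ ≠ 0 := fun h => by simp [h] at h0; linarith
    have hπ : (Real.pi : ℂ) ≠ 0 := by exact_mod_cast Real.pi_ne_zero
    simp only [hM]
    rw [mellinContinuation_eq_mellin hexp hf hA hp hN (by linarith) h1, h.mellin_logSum h0 h1]
    simp only [hD]
    generalize sin (Real.pi * σ) = S at hs ⊢
    field_simp
  have hex : ∀ σ : ℂ, ∃ N, μ N < σ.re := fun σ =>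
    (hexp.tendsto_atBot.eventually_lt_atBot σ.re).exists
  choose N hN using hex
  -- The truncation N may vary with σ, since different truncations agree wherever both apply.
  -- Passing to meromorphic normal form then fills the removable singularities, including the one at
  -- 0.
  set F : ℂ → ℂ := fun σ => if 1 / 2 < σ.re then D σ else M (N σ) σ with hF
  have hFM : ∀ (K : ℕ) (σ : ℂ), μ K < σ.re → σ.re < 1 → F σ = M K σ := by
    intro K σ hK h1
    by_cases h0 : 1 / 2 < σ.re
    · simp only [hF, if_pos h0]
      exact (hMD K σ hK h0 h1).symm
    · simp only [hF, if_neg h0, hM]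
      rw [mellinContinuation_eq hexp hf hA hK (hN σ) h1]
  have hev : ∀ (K : ℕ) (σ : ℂ), μ K < σ.re → σ.re < 1 → F =ᶠ[𝓝 σ] M K := by
    intro K σ hK h1
    have hopen : IsOpen {z : ℂ | μ K < z.re ∧ z.re < 1} :=
      (isOpen_lt continuous_const continuous_re).inter (isOpen_lt continuous_re continuous_const)
    filter_upwards [hopen.mem_nhds ⟨hK, h1⟩] with z hz
    exact hFM K z hz.1 hz.2
  have hevD : ∀ σ : ℂ, 1 / 2 < σ.re → F =ᶠ[𝓝 σ] D := by
    intro σ h0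
    filter_upwards [(isOpen_lt continuous_const continuous_re).mem_nhds h0] with z hz
    simp only [hF]
    rw [if_pos hz]
  have hmero : MeromorphicOn F univ := by
    intro σ _
    by_cases h0 : 1 / 2 < σ.re
    · exact (h.analyticAt_tsum_cpow h0).meromorphicAt.congr
        ((hevD σ h0).symm.filter_mono nhdsWithin_le_nhds)
    · refine MeromorphicAt.congr ?_
        ((hev (N σ) σ (hN σ) (by linarith)).symm.filter_mono nhdsWithin_le_nhds)
      refine MeromorphicAt.mul (AnalyticAt.meromorphicAt (by fun_prop))
        (meromorphicAt_mellinContinuation hexp hf hA (hN σ) (by linarith))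
  obtain ⟨g, hg, hg0, hg1, hgM⟩ := sin_pi_mul_div_mul_mellinContinuation hexp hf hA hk (hN 0)
  have hG := toMeromorphicNFOn_eventuallyEq_of_analyticAt hmero hg
    (((hev (N 0) 0 (hN 0) (by simp)).filter_mono nhdsWithin_le_nhds).trans hgM)
  refine ⟨toMeromorphicNFOn F univ, meromorphicNFOn_toMeromorphicNFOn F univ, fun σ hσ => ?_,
    hG.eq_of_nhds.trans hg0, hg1.congr_of_eventuallyEq hG⟩
  have h1 := (toMeromorphicNFOn_eventuallyEq_of_analyticAt hmero (h.analyticAt_tsum_cpow hσ)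
    ((hevD σ hσ).filter_mono nhdsWithin_le_nhds)).eq_of_nhds
  rw [h1]
  exact (h.summable_cpow hσ).hasSum

end IsSectorialFamily

/-! ### Reality and positivity; log Δ in terms of Ξ -/

/-- `∏ (1 + y / τ²)` over the zeros. -/
noncomputable def tauProd (y : ℂ) : ℂ :=
  ∏' i, (1 + y / tau i ^ 2)

theorem tau_sq_ne_zero (i : ZeroIndex) : tau i ^ 2 ≠ 0 :=
  pow_ne_zero 2 fun h => by simpa [h] using tau_re_pos i

theorem summable_norm_tau_sq_inv : Summable fun i => ‖tau i ^ 2‖⁻¹ := by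
  simpa using summable_norm_tau_sq_add_inv 0

theorem Xi_half_add_eq (w : ℂ) : Xi (1 / 2 + w) = Xi (1 / 2) * tauProd (w ^ 2) :=
  Xi_half_add_eq_tprod w

theorem Xi_half_im : (Xi (1 / 2)).im = 0 := by
  simpa using Xi_ofReal_im (1 / 2)

theorem Xi_half_re_pos : 0 < (Xi (1 / 2)).re := by
  simpa using Xi_ofReal_re_pos_of_mem_Icc (x := 1 / 2) (by constructor <;> norm_num)

/-- If w² is real then the conjugate of w is ±w, and Ξ(1/2 + w) is even in w. -/
theorem Xi_half_add_im {w : ℂ} (hw : (w ^ 2).im = 0) : (Xi (1 / 2 + w)).im = 0 := by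
  rw [← conj_eq_iff_im, ← Xi_conj, map_add, map_div₀, map_one, map_ofNat]
  have h1 : (starRingEnd ℂ w) ^ 2 = w ^ 2 := by rw [← map_pow, conj_eq_iff_im.2 hw]
  rcases sq_eq_sq_iff_eq_or_eq_neg.1 h1 with h | h
  · rw [h]
  · rw [h, ← sub_eq_add_neg, Xi_half_sub]

theorem tauProd_ofReal_im (y : ℝ) : (tauProd y).im = 0 := by
  obtain ⟨w, hw⟩ := IsAlgClosed.exists_pow_nat_eq (y : ℂ) two_pos
  have h1 := Xi_half_add_eq w
  rw [hw] at h1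
  have h2 := Xi_half_add_im (w := w) (by rw [hw]; exact ofReal_im y)
  rw [h1, mul_im, Xi_half_im, zero_mul, add_zero] at h2
  exact (mul_eq_zero.1 h2).resolve_left Xi_half_re_pos.ne'

theorem tauProd_zero : tauProd 0 = 1 := by simp [tauProd]

theorem Admissible.add_ne_zero {v : ℝ} (hv : Admissible v) (i : ZeroIndex) :
    tau i ^ 2 + (v : ℂ) ≠ 0 :=
  slitPlane_ne_zero (hv.mem_slitPlane (tau_mem i))

theorem Admissible.mono {v y : ℝ} (hv : Admissible v) (h : v ≤ y) : Admissible y :=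
  fun τ hτ => (hv τ hτ).trans_le h

theorem Admissible.tauProd_ne_zero {v : ℝ} (hv : Admissible v) : tauProd v ≠ 0 :=
  tprod_one_add_div_ne_zero summable_norm_tau_sq_inv fun i => by
    rw [one_add_div (tau_sq_ne_zero i)]
    exact div_ne_zero (hv.add_ne_zero i) (tau_sq_ne_zero i)

/-- On the real axis the product is real and continuous with value 1 at 0, and it has no zero
between 0 and v because all points there are admissible. -/
theorem Admissible.tauProd_re_pos {v : ℝ} (hv : Admissible v) : 0 < (tauProd v).re := by
  have hc : Continuous fun y : ℝ => (tauProd y).re :=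
    continuous_re.comp ((differentiable_tprod_one_add_div summable_norm_tau_sq_inv).continuous.comp
      continuous_ofReal)
  by_contra! hle
  have h0 : (0 : ℝ) ∈ uIcc (tauProd (v : ℝ)).re (tauProd (0 : ℝ)).re := by
    rw [mem_uIcc]
    left
    simpa [tauProd_zero] using hle
  obtain ⟨y, hy, hy0⟩ := intermediate_value_uIcc (a := v) (b := 0) hc.continuousOn h0
  have hya : Admissible y := by
    rcases le_total v 0 with h | h
    · rw [uIcc_of_le h] at hy
      exact hv.mono hy.1
    · rw [uIcc_of_ge h] at hy
      exact admissible_of_nonneg hy.1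
  exact hya.tauProd_ne_zero (Complex.ext hy0 (tauProd_ofReal_im y))

theorem Xi_half_add_pos {v : ℝ} (hv : Admissible v) {w : ℂ} (hw : w ^ 2 = (v : ℂ)) :
    0 < (Xi (1 / 2 + w)).re ∧ (Xi (1 / 2 + w)).im = 0 := by
  refine ⟨?_, Xi_half_add_im (by rw [hw]; exact ofReal_im v)⟩
  rw [Xi_half_add_eq, hw, mul_re, Xi_half_im, zero_mul, sub_zero]
  exact mul_pos Xi_half_re_pos hv.tauProd_re_pos

theorem hasProd_deltaFactor (v : ℝ) (z : ℂ) :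
    HasProd (deltaFactor v z) (∏' i : ZeroIndex, (1 + z / (tau i ^ 2 + (v : ℂ)))) := by
  refine (multipliable_one_add_div (summable_norm_tau_sq_add_inv v) z).hasProd.sigma fun τ => ?_
  have h := hasProd_fintype fun _ : Fin (mult τ) => 1 + z / ((τ : ℂ) ^ 2 + (v : ℂ))
  simpa [deltaFactor, tau] using h

theorem Delta_eq_tprod (v : ℝ) (z : ℂ) :
    Delta v z = ∏' i : ZeroIndex, (1 + z / (tau i ^ 2 + (v : ℂ))) :=
  (hasProd_deltaFactor v z).tprod_eq

theorem hasSum_zetaTerm {v : ℝ} {σ s : ℂ}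
    (h : HasSum (fun i : ZeroIndex => (tau i ^ 2 + (v : ℂ)) ^ (-σ)) s) :
    HasSum (zetaTerm v σ) s := by
  refine h.sigma fun τ => ?_
  have h := hasSum_fintype fun _ : Fin (mult τ) => ((τ : ℂ) ^ 2 + (v : ℂ)) ^ (-σ)
  simpa [zetaTerm, tau] using h

/-- Factor by factor, (1 + z/(τ²+v))(1 + v/τ²) = 1 + (z+v)/τ². -/
theorem Admissible.Delta_mul_tauProd {v : ℝ} (hv : Admissible v) (z : ℂ) :
    Delta v z * tauProd v = tauProd (z + v) := by
  rw [Delta_eq_tprod, tauProd, tauProd,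
    ← (multipliable_one_add_div (summable_norm_tau_sq_add_inv v) z).tprod_mul
      (multipliable_one_add_div summable_norm_tau_sq_inv (v : ℂ))]
  refine tprod_congr fun i => ?_
  have h1 := hv.add_ne_zero i
  have h2 := tau_sq_ne_zero i
  generalize tau i ^ 2 = t at h1 h2 ⊢
  field_simp
  ring

theorem Admissible.Delta_eq_ofReal {v : ℝ} (hv : Admissible v) {x : ℝ} (hx : Admissible (x + v)) :
    ∃ r : ℝ, 0 < r ∧ Delta v (x : ℂ) = r := by
  refine ⟨(tauProd ((x + v : ℝ) : ℂ)).re / (tauProd (v : ℂ)).re,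
    div_pos hx.tauProd_re_pos hv.tauProd_re_pos, ?_⟩
  have h1 := hv.Delta_mul_tauProd (x : ℂ)
  rw [← ofReal_add] at h1
  have e : ∀ y : ℝ, tauProd y = ((tauProd y).re : ℂ) := fun y =>
    Complex.ext (by simp) (by simpa using tauProd_ofReal_im y)
  rw [e v, e (x + v)] at h1
  have h2 : ((tauProd (v : ℂ)).re : ℂ) ≠ 0 := by exact_mod_cast hv.tauProd_re_pos.ne'
  rw [ofReal_div, eq_div_iff h2]
  exact h1

/-- A sum of principal logarithms could differ from the principal logarithm by a multiple of 2πi.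
Here its exponential stays positive and it starts from 0, so its imaginary part, being continuous,
never reaches ±π. -/
theorem Admissible.logDelta_eq_logSum {v : ℝ} (hv : Admissible v) {z : ℝ} (hz : 0 ≤ z) :
    logDelta v z = logSum (fun i => tau i ^ 2 + (v : ℂ)) z := by
  obtain ⟨κ, h⟩ := hv.isSectorialFamily
  set L := logSum (fun i => tau i ^ 2 + (v : ℂ)) with hL
  have hexp : ∀ x : ℝ, 0 ≤ x → ∃ r : ℝ, 0 < r ∧ exp (L x) = r := fun x hx => by
    obtain ⟨r, hr, hr'⟩ := hv.Delta_eq_ofReal (x := x) (hv.mono (by linarith))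
    exact ⟨r, hr, by rw [h.exp_logSum hx, ← hr', Delta_eq_tprod]⟩
  have hL0 : L 0 = 0 := by simp [hL, logSum]
  have hpi : ∀ x : ℝ, 0 ≤ x → |(L x).im| ≠ Real.pi := by
    intro x hx habs
    obtain ⟨r, hr, hr'⟩ := hexp x hx
    have h1 : (exp (L x)).re = r := by rw [hr', ofReal_re]
    rw [exp_re, ← Real.cos_abs, habs, Real.cos_pi] at h1
    have := Real.exp_pos (L x).re
    linarith
  have hlt : |(L z).im| < Real.pi := by
    by_contra! hge
    have hc : ContinuousOn (fun x => |(L x).im|) (Icc 0 z) :=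
      (continuous_abs.comp continuous_im).comp_continuousOn
        (h.continuousOn_logSum.mono Icc_subset_Ici_self)
    obtain ⟨x, hx, hx'⟩ := intermediate_value_Icc hz hc
      (show Real.pi ∈ Icc |(L 0).im| |(L z).im| from ⟨by simp [hL0, Real.pi_pos.le], hge⟩)
    exact hpi x hx.1 hx'
  rw [logDelta, Delta_eq_tprod, ← h.exp_logSum hz, log_exp (abs_lt.1 hlt).1 (abs_lt.1 hlt).2.le]

theorem log_eq_ofReal_log_norm {z : ℂ} (h : 0 < z.re ∧ z.im = 0) :
    log z = ((Real.log ‖z‖ : ℝ) : ℂ) := by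
  have hz : z = (z.re : ℂ) := Complex.ext (by simp) (by simp [h.2])
  rw [hz, norm_real, Real.norm_of_nonneg h.1.le, ofReal_log h.1.le]

theorem Admissible.logDelta_eq {v : ℝ} (hv : Admissible v) {w : ℂ} (hw : w ^ 2 = (v : ℂ)) {z : ℝ}
    (hz : 0 ≤ z) (hzv : 0 ≤ z + v) : logDelta v z =
      ((Real.log ‖Xi ((1 / 2 + √(z + v) : ℝ) : ℂ)‖ - Real.log ‖Xi (1 / 2 + w)‖ : ℝ) : ℂ) := by
  obtain ⟨r, hr, hr'⟩ := hv.Delta_eq_ofReal (x := z) (hv.mono (by linarith))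
  have hvp := hv.tauProd_ne_zero
  have hX := slitPlane_ne_zero (Or.inl Xi_half_re_pos)
  have h1 := hv.Delta_mul_tauProd (z : ℂ)
  have h2 := Xi_half_add_eq w
  have h3 := Xi_half_add_eq (√(z + v) : ℂ)
  rw [hw] at h2
  rw [← ofReal_pow, Real.sq_sqrt hzv, ofReal_add, ← h1] at h3
  have h4 : Xi ((1 / 2 + √(z + v) : ℝ) : ℂ) = Delta v z * Xi (1 / 2 + w) := by
    push_cast
    rw [h3, h2]
    ring
  have hne : Xi (1 / 2 + w) ≠ 0 := by rw [h2]; exact mul_ne_zero hX hvp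
  have hD : Delta v (z : ℂ) ≠ 0 := by rw [hr']; exact_mod_cast hr.ne'
  rw [h4, norm_mul, Real.log_mul (norm_ne_zero_iff.2 hD) (norm_ne_zero_iff.2 hne),
    add_sub_cancel_right, logDelta]
  exact log_eq_ofReal_log_norm (by rw [hr']; simpa using hr)

/-! ### The expansion of log Δ and the value of a₀(v) -/

theorem strictAnti_halfExponent : StrictAnti fun n : ℕ => ((1 - n) / 2 : ℝ) := by
  intro m n h
  have : (m : ℝ) < n := by exact_mod_cast h
  simp only
  linarith

theorem tendsto_halfExponent : Tendsto (fun n : ℕ => ((1 - n) / 2 : ℝ)) atTop atBot := by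
  refine Tendsto.atBot_div_const (by norm_num) ?_
  exact tendsto_atBot_add_const_left _ 1 (tendsto_neg_atTop_atBot.comp tendsto_natCast_atTop_atTop)

theorem Admissible.exists_hasStirlingExpansion {v : ℝ} (hv : Admissible v) {w : ℂ}
    (hw : w ^ 2 = (v : ℂ)) : ∃ b a : ℕ → ℂ,
      HasStirlingExpansion (logDelta v) (fun n : ℕ => ((1 - n) / 2 : ℝ)) b a ∧ b 1 = 7 / 8 ∧
      a 1 = ((1 / 4 * Real.log (8 * Real.pi) : ℝ) : ℂ) - log (Xi (1 / 2 + w)) := by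
  obtain ⟨A, B, hA, hB, h⟩ := exists_log_norm_Xi_expansion v
  set c := Real.log ‖Xi (1 / 2 + w)‖ with hc
  refine ⟨fun n => A n, fun n => ((B n - if n = 1 then c else 0 : ℝ) : ℂ),
    ⟨strictAnti_halfExponent, tendsto_halfExponent, fun N => ?_⟩, by simp only [hA]; norm_num, ?_⟩
  -- The constant c belongs to index 1, whose exponent is 0. For N = 0 the sum stops before it, and
  -- c is absorbed into o(z^(1/2)).
  · have hsmall : (fun _ : ℝ => if N = 0 then c else 0) =o[atTop]
        fun z : ℝ => z ^ ((1 - N) / 2 : ℝ) := by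
      split_ifs with hN
      · rw [Asymptotics.isLittleO_const_left]
        right
        rw [hN]
        exact tendsto_norm_atTop_atTop.comp (tendsto_rpow_atTop (by norm_num))
      · exact Asymptotics.isLittleO_zero _ _
    have h1 := (h N).sub hsmall
    rw [← Asymptotics.isLittleO_norm_left] at h1 ⊢
    refine h1.congr' ?_ .rfl
    filter_upwards [eventually_ge_atTop 0, eventually_ge_atTop (-v)] with z hz hzv
    have hS : ∑ n ∈ Finset.range (N + 1), (A n * Real.log z + (B n - if n = 1 then c else 0)) *
        z ^ ((1 - n) / 2 : ℝ) =
        ∑ n ∈ Finset.range (N + 1), (A n * Real.log z + B n) * z ^ ((1 - n) / 2 : ℝ) -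
          (c - if N = 0 then c else 0) := by
      have e : ∀ n ∈ Finset.range (N + 1), (A n * Real.log z + (B n - if n = 1 then c else 0)) *
          z ^ ((1 - n) / 2 : ℝ) =
          (A n * Real.log z + B n) * z ^ ((1 - n) / 2 : ℝ) - if n = 1 then c else 0 := by
        intro n _
        split_ifs with hn
        · rw [hn]; simp; ring
        · simp
      rw [Finset.sum_congr rfl e, Finset.sum_sub_distrib, Finset.sum_ite_eq']
      rcases Nat.eq_zero_or_pos N with hN | hN
      · simp [hN]
      · simp [hN.ne', hN]
    have hC : ∑ n ∈ Finset.range (N + 1), ((A n : ℂ) * (Real.log z : ℂ) +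
        ((B n - if n = 1 then c else 0 : ℝ) : ℂ)) * ((z ^ ((1 - n) / 2 : ℝ) : ℝ) : ℂ) =
        ((∑ n ∈ Finset.range (N + 1), (A n * Real.log z + (B n - if n = 1 then c else 0)) *
        z ^ ((1 - n) / 2 : ℝ) : ℝ) : ℂ) := by
      rw [ofReal_sum]
      refine Finset.sum_congr rfl fun n _ => ?_
      rw [ofReal_mul, ofReal_add, ofReal_mul]
    rw [hv.logDelta_eq hw hz (by linarith), hC, ← ofReal_sub, norm_real, hS]
    congr 1
    ring
  · simp only [hB, if_true, log_eq_ofReal_log_norm (Xi_half_add_pos hv hw)]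
    push_cast
    ring

theorem Admissible.isStirlingConstant {v : ℝ} (hv : Admissible v) {w : ℂ} (hw : w ^ 2 = (v : ℂ)) :
    IsStirlingConstant (logDelta v)
      (((1 / 4 * Real.log (8 * Real.pi) : ℝ) : ℂ) - log (Xi (1 / 2 + w))) := by
  obtain ⟨b, a, h, -, ha⟩ := hv.exists_hasStirlingExpansion hw
  exact ⟨_, b, a, 1, h, by simp, ha⟩

theorem Admissible.exists_isContinuation {v : ℝ} (hv : Admissible v) {μ : ℕ → ℝ} {b a : ℕ → ℂ}
    (h : HasStirlingExpansion (logDelta v) μ b a) {k : ℕ} (hk : μ k = 0) :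
    ∃ G, IsContinuation v G ∧ G 0 = b k ∧ HasDerivAt G (a k) 0 := by
  obtain ⟨κ, hl⟩ := hv.isSectorialFamily
  have h' : HasStirlingExpansion (logSum fun i => tau i ^ 2 + (v : ℂ)) μ b a := by
    refine ⟨h.strictAnti, h.tendsto_atBot, fun N => (h.isLittleO N).congr' ?_ .rfl⟩
    filter_upwards [eventually_ge_atTop 0] with z hz
    rw [hv.logDelta_eq_logSum hz]
  obtain ⟨G, h1, h2, h3, h4⟩ := hl.exists_continuation h' hk
  exact ⟨G, ⟨h1, fun σ hσ => hasSum_zetaTerm (h2 σ hσ)⟩, h3, h4⟩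

theorem exists_sq_eq_ofReal (v : ℝ) : ∃ w : ℂ, w ^ 2 = (v : ℂ) :=
  IsAlgClosed.exists_pow_nat_eq (v : ℂ) two_pos

theorem Admissible.isContinuation_bigZ {v : ℝ} (hv : Admissible v) : IsContinuation v (bigZ v) := by
  obtain ⟨w, hw⟩ := exists_sq_eq_ofReal v
  obtain ⟨b, a, h, -, -⟩ := hv.exists_hasStirlingExpansion hw
  obtain ⟨G, hG, -⟩ := hv.exists_isContinuation h (k := 1) (by simp)
  exact Classical.epsilon_spec ⟨G, hG⟩

/-- Every expansion yields a continuation with its own constant as derivative at 0, and the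
continuation is unique. Hence the Stirling constant is unique too, with no direct comparison of
expansions. -/
theorem Admissible.hasDerivAt_bigZ_of_isStirlingConstant {v : ℝ} (hv : Admissible v) {c : ℂ}
    (hc : IsStirlingConstant (logDelta v) c) : HasDerivAt (bigZ v) c 0 := by
  obtain ⟨μ, b, a, n, h, hn, rfl⟩ := hc
  obtain ⟨G, hG, -, h1⟩ := hv.exists_isContinuation h hn
  rwa [← hG.unique hv.isContinuation_bigZ]

theorem Admissible.bigZ_zero {v : ℝ} (hv : Admissible v) : bigZ v 0 = 7 / 8 := by
  obtain ⟨w, hw⟩ := exists_sq_eq_ofReal v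
  obtain ⟨b, a, h, hb, -⟩ := hv.exists_hasStirlingExpansion hw
  obtain ⟨G, hG, h1, -⟩ := hv.exists_isContinuation h (k := 1) (by simp)
  rw [← hG.unique hv.isContinuation_bigZ, h1, hb]

theorem Admissible.isStirlingConstant_aZero {v : ℝ} (hv : Admissible v) :
    IsStirlingConstant (logDelta v) (aZero v) := by
  obtain ⟨w, hw⟩ := exists_sq_eq_ofReal v
  exact Classical.epsilon_spec ⟨_, hv.isStirlingConstant hw⟩

theorem Admissible.aZero_eq {v : ℝ} (hv : Admissible v) {w : ℂ} (hw : w ^ 2 = (v : ℂ)) :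
    aZero v = ((1 / 4 * Real.log (8 * Real.pi) : ℝ) : ℂ) - log (Xi (1 / 2 + w)) :=
  (hv.hasDerivAt_bigZ_of_isStirlingConstant hv.isStirlingConstant_aZero).unique
    (hv.hasDerivAt_bigZ_of_isStirlingConstant (hv.isStirlingConstant hw))

theorem half_sq_eq : ((1 / 2 : ℂ)) ^ 2 = ((1 / 4 : ℝ) : ℂ) := by
  push_cast
  norm_num

theorem admissible_quarter : Admissible (1 / 4) := admissible_of_nonneg (by norm_num)

/-- At w = 1/2 the product formula reads Ξ(1/2) ∏(1 + 1/(4τ²)) = Ξ(1) = 1, which cancels the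
normalization. -/
theorem Delta_quarter_eq {v : ℝ} {w : ℂ} (hw : w ^ 2 = (v : ℂ)) :
    Delta (1 / 4) ((v : ℂ) - 1 / 4) = Xi (1 / 2 + w) := by
  have h1 := admissible_quarter.Delta_mul_tauProd ((v : ℂ) - 1 / 4)
  have h2 := Xi_half_add_eq (1 / 2)
  have h3 := Xi_half_add_eq w
  rw [half_sq_eq, add_halves, Xi_one] at h2
  rw [hw] at h3
  have e : (v : ℂ) - 1 / 4 + ((1 / 4 : ℝ) : ℂ) = v := by push_cast; ring
  rw [e] at h1
  rw [h3, ← h1]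
  linear_combination Delta (1 / 4) ((v : ℂ) - 1 / 4) * h2

/-! ### The special values at v = 0 and v = 1/4 -/

theorem norm_Xi_half : ‖Xi (1 / 2)‖ =
    ‖riemannZeta (1 / 2)‖ * Real.Gamma (1 / 4) / (4 * Real.pi ^ (1 / 4 : ℝ)) := by
  have hG := Real.Gamma_pos_of_pos (show (0 : ℝ) < 1 / 4 by norm_num)
  rw [Xi_eq_div (by norm_num) (ne_neg_two_mul_nat (Or.inl (by norm_num))), bigF, norm_div, norm_div,
    norm_mul, norm_mul, norm_cpow_eq_rpow_re_of_pos Real.pi_pos,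
    show ((1 / 2 : ℂ) / 2) = ((1 / 4 : ℝ) : ℂ) by push_cast; norm_num, Complex.Gamma_ofReal,
    norm_real, Real.norm_of_nonneg hG.le, ofReal_re]
  have e : ‖(1 / 2 : ℂ)‖ * ‖(1 / 2 : ℂ) - 1‖ = 1 / 4 := by
    rw [← norm_mul]; norm_num
  rw [e]
  field_simp

theorem quarter_log_sub_log_Xi_half :
    ((1 / 4 * Real.log (8 * Real.pi) : ℝ) : ℂ) - log (Xi (1 / 2)) =
    ((Real.log ((2 : ℝ) ^ (11 / 4 : ℝ) * Real.pi ^ (1 / 2 : ℝ) * (Real.Gamma (1 / 4))⁻¹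
      * ‖riemannZeta (1 / 2)‖⁻¹) : ℝ) : ℂ) := by
  have hG := Real.Gamma_pos_of_pos (show (0 : ℝ) < 1 / 4 by norm_num)
  have hX : 0 < ‖Xi (1 / 2)‖ := norm_pos_iff.2 (slitPlane_ne_zero (Or.inl Xi_half_re_pos))
  have hζ : 0 < ‖riemannZeta (1 / 2)‖ := by
    refine lt_of_le_of_ne (norm_nonneg _) fun h => ?_
    rw [norm_Xi_half, ← h] at hX
    simp at hX
  have hπ := Real.pi_pos
  rw [log_eq_ofReal_log_norm ⟨Xi_half_re_pos, Xi_half_im⟩, ← ofReal_sub, norm_Xi_half]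
  congr 1
  have e8 : Real.log 8 = 3 * Real.log 2 := by
    rw [show (8 : ℝ) = 2 ^ 3 by norm_num, Real.log_pow]; norm_num
  have e4 : Real.log 4 = 2 * Real.log 2 := by
    rw [show (4 : ℝ) = 2 ^ 2 by norm_num, Real.log_pow]; norm_num
  rw [Real.log_mul (by norm_num) hπ.ne', Real.log_div (by positivity) (by positivity),
    Real.log_mul hζ.ne' hG.ne', Real.log_mul (by norm_num) (by positivity), Real.log_rpow hπ,
    Real.log_mul (by positivity) (by positivity), Real.log_mul (by positivity) (by positivity),
    Real.log_mul (by positivity) (by positivity), Real.log_rpow (by norm_num), Real.log_rpow hπ,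
    Real.log_inv, Real.log_inv, e8, e4]
  ring

end ZetaZeros

theorem mainTheorem5 :
    (∀ v : ℝ, ZetaZeros.Admissible v →
      -- `𝒵(·, v)` is the meromorphic continuation, and the Delta product converges
      ZetaZeros.IsContinuation v (ZetaZeros.bigZ v) ∧
      (∀ z : ℂ, Multipliable (ZetaZeros.deltaFactor v z)) ∧
      -- the derivative at `σ = 0` is the Stirling constant `a₀(v)`
      ZetaZeros.IsStirlingConstant (ZetaZeros.logDelta v) (ZetaZeros.aZero v) ∧
      HasDerivAt (ZetaZeros.bigZ v) (ZetaZeros.aZero v) 0 ∧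
      ZetaZeros.aZero v =
        ZetaZeros.aZero (1 / 4) - Complex.log (ZetaZeros.Delta (1 / 4) ((v : ℂ) - 1 / 4)) ∧
      -- the explicit value; `w` is either square root of `v`
      ∀ w : ℂ, w ^ 2 = (v : ℂ) →
        (0 < (ZetaZeros.Xi (1 / 2 + w)).re ∧ (ZetaZeros.Xi (1 / 2 + w)).im = 0) ∧
        HasDerivAt (ZetaZeros.bigZ v)
          (((1 / 4 * Real.log (8 * Real.pi) : ℝ) : ℂ)
            - Complex.log (ZetaZeros.Xi (1 / 2 + w))) 0) ∧
    -- the cases `v = 0` and `v = 1/4`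
    ZetaZeros.Admissible 0 ∧ ZetaZeros.Admissible (1 / 4) ∧
    ZetaZeros.bigZ 0 0 = ZetaZeros.bigZ (1 / 4) 0 ∧
    ZetaZeros.bigZ (1 / 4) 0 = 7 / 8 ∧
    deriv (ZetaZeros.bigZ 0) 0 =
      deriv (ZetaZeros.bigZ (1 / 4)) 0 - Complex.log (ZetaZeros.Xi (1 / 2)) ∧
    HasDerivAt (ZetaZeros.bigZ 0)
      ((Real.log ((2 : ℝ) ^ (11 / 4 : ℝ) * Real.pi ^ (1 / 2 : ℝ) * (Real.Gamma (1 / 4))⁻¹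
        * ‖riemannZeta (1 / 2)‖⁻¹) : ℝ) : ℂ) 0 := by
  have h0 : ZetaZeros.Admissible 0 := ZetaZeros.admissible_of_nonneg le_rfl
  have h4 := ZetaZeros.admissible_quarter
  -- The root of v = 0 is w = 0, so Ξ is evaluated at 1/2; for v = 1/4 the root w = 1/2 gives Ξ(1) =
  -- 1 and the logarithm disappears.
  have hd0 := h0.hasDerivAt_bigZ_of_isStirlingConstant (h0.isStirlingConstant (w := 0) (by simp))
  rw [add_zero] at hd0
  refine ⟨fun v hv => ⟨hv.isContinuation_bigZ,
    fun z => (ZetaZeros.hasProd_deltaFactor v z).multipliable, hv.isStirlingConstant_aZero,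
    hv.hasDerivAt_bigZ_of_isStirlingConstant hv.isStirlingConstant_aZero, ?_, fun w hw =>
      ⟨ZetaZeros.Xi_half_add_pos hv hw,
        hv.hasDerivAt_bigZ_of_isStirlingConstant (hv.isStirlingConstant hw)⟩⟩,
    h0, h4, h0.bigZ_zero.trans h4.bigZ_zero.symm, h4.bigZ_zero, ?_, ?_⟩
  · obtain ⟨w, hw⟩ := ZetaZeros.exists_sq_eq_ofReal v
    rw [hv.aZero_eq hw, h4.aZero_eq ZetaZeros.half_sq_eq, ZetaZeros.Delta_quarter_eq hw,
      add_halves, ZetaZeros.Xi_one, Complex.log_one, sub_zero]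
  · rw [hd0.deriv, (h4.hasDerivAt_bigZ_of_isStirlingConstant
      (h4.isStirlingConstant ZetaZeros.half_sq_eq)).deriv, add_halves, ZetaZeros.Xi_one,
      Complex.log_one, sub_zero]
  · rwa [ZetaZeros.quarter_log_sub_log_Xi_half] at hd0
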